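/- Let $m\ge 1$ and let $Q_0,Q_1:[0,\infty)\to\mathbb C^{m\times m}$ be such that the entries of $Q_1$ are absolutely continuous on $[0,b]$ for every $b>0$ and the entries of $Q_0,Q_1,Q_1'$ belong to $L(0,\infty)$. For $\rho\in\mathbb C$ consider $$\ell_\rho(Y):=Y''+(\rho^2 I+2i\rho Q_1(x)+Q_0(x))Y=0,\qquad x>0,$$ where a solution is a function $Y$ on $[0,\infty)$ such that $Y'$ exists and is locally absolutely continuous and the equation holds almost everywhere. Let $\Pi_\pm=\{\rho:\pm\operatorname{Im}\rho>0\}$. Let $P_\pm$ and $T_\pm$ be the matrix functions on $[0,\infty)$ which are the (unique) solutions of the Cauchy problems $$P_\pm'(x)=\pm Q_1(x)P_\pm(x),\qquad P_\pm(0)=I,$$ $$T_\pm'(x)=\pm Q_1(x)T_\pm(x)+\frac1{2i}\bigl(Q_1'(x)\pm Q_1^2(x)\pm Q_0(x)\bigr)P_\pm(x),\qquad \lim_{x\to\infty}T_\pm(x)=0$$ (the second one for locally absolutely continuous $T_\pm$ and almost all $x$). Then for each $\alpha>0$ there exists $\rho_\alpha>0$, with $\rho_\alpha\to0$ as $\alpha\to\infty$,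 such that in each of the two closed half-planes $\overline{\Pi}$, $\Pi\in\{\Pi_+,\Pi_-\}$, taken separately (on the real axis the two systems need not coincide), for $\rho\in\overline{\Pi}$, $|\rho|>\rho_\alpha$, $x\ge 0$, the equation $\ell_\rho(Y)=0$ has a fundamental system of matrix solutions $E_+(x,\rho)$, $E_-(x,\rho)$ (the $2m$ columns of $E_+$ and $E_-$ form a basis of the space of vector solutions), and both $E_+$ and $E_-$ have the following properties, where the prime and $(\nu)$ denote derivatives in $x$. $(i_1)$ $E_\pm^{(\nu)}(x,\rho)$, $\nu=0,1$, are continuous in $(x,\rho)$ for $x\ge0$, $\rho\in\overline{\Pi}$, $|\rho|>\rho_\alpha$. $(i_2)$ For each fixed $x\ge0$, $E_\pm^{(\nu)}(x,\rho)$, $\nu=0,1$, extend analytically in $\rho$ to a neighbourhood of $\{\rho\in\Pi:|\rho|\ge\rho_\alpha\}$. $(i_3)$ As $|\rho|\to\infty$, $\rho\in\overline{\Pi}$, uniformly with respect to $x\ge\alpha$, $$E_\pm(x,\rho)=e^{\pm i\rho x}\Bigl(P_\mp(x)+\frac{T_\mp(x)}{\rho}+o(\rho^{-1})\Bigr),$$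 $$E_\pm'(x,\rho)=\pm e^{\pm i\rho x}\Bigl((i\rho I-Q_1(x))P_\mp(x)+iT_\mp(x)+o(1)\Bigr).$$ $(i_4)$ As $x\to\infty$, for each fixed $\rho\in\Pi$, $|\rho|>\rho_\alpha$, $$E_\pm^{(\nu)}(x,\rho)=(\pm i\rho)^\nu e^{\pm i\rho x}\bigl(P_\mp(x)+o(1)\bigr),\qquad \nu=0,1.$$ -/

import Mathlib

open Filter Topology MeasureTheory Set

noncomputable section

namespace MatrixPencil

variable {m : ℕ} {κ : Type}

/-- Entrywise derivative of a matrix function on the half-line `x ≥ 0` (one-sided at `x = 0`). -/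
def mderiv (Y : ℝ → Matrix (Fin m) κ ℂ) (x : ℝ) : Matrix (Fin m) κ ℂ :=
  Matrix.of fun j k => derivWithin (fun t => Y t j k) (Ici 0) x

/-- The `ν`-th derivative `Y^{(ν)}` on the half-line. -/
def mderivN (ν : ℕ) (Y : ℝ → Matrix (Fin m) κ ℂ) : ℝ → Matrix (Fin m) κ ℂ :=
  mderiv^[ν] Y

/-- All entries are absolutely continuous on `[0, b]` for each `b > 0`. -/
def LocallyAC (Y : ℝ → Matrix (Fin m) κ ℂ) : Prop :=
  ∀ b : ℝ, 0 < b → ∀ j k, AbsolutelyContinuousOnInterval (fun x => Y x j k) 0 b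

/-- All entries belong to `L(0, ∞)`. -/
def EntriesIntegrable (Y : ℝ → Matrix (Fin m) κ ℂ) : Prop :=
  ∀ j k, IntegrableOn (fun x => Y x j k) (Ioi 0) volume

/-- The coefficient class: `Q₁` is locally absolutely continuous on the closed half-line and
`Q₀`, `Q₁`, `Q₁'` are integrable on `(0, ∞)`. -/
structure CoeffClass (Q₁ Q₀ : ℝ → Matrix (Fin m) (Fin m) ℂ) : Prop where
  ac : LocallyAC Q₁
  int_Q₀ : EntriesIntegrable Q₀
  int_Q₁ : EntriesIntegrable Q₁
  int_deriv : EntriesIntegrable (mderiv Q₁)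

/-- `Y` (with columns indexed by `κ`) solves `Y'' + (ρ² I + 2 i ρ Q₁ + Q₀) Y = 0` on the half-line:
`Y` is differentiable for `x ≥ 0`, `Y'` is locally absolutely continuous, and the equation holds
for almost all `x > 0`. -/
structure IsSolution (Q₁ Q₀ : ℝ → Matrix (Fin m) (Fin m) ℂ) (ρ : ℂ)
    (Y : ℝ → Matrix (Fin m) κ ℂ) : Prop where
  diff : ∀ j k, DifferentiableOn ℝ (fun x => Y x j k) (Ici 0)
  ac : LocallyAC (mderiv Y)
  eqn : ∀ᵐ x ∂(volume.restrict (Ioi (0 : ℝ))), ∀ j k,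
    HasDerivAt (fun t => mderiv Y t j k)
      ((-((ρ ^ 2 • (1 : Matrix (Fin m) (Fin m) ℂ) + (2 * Complex.I * ρ) • Q₁ x + Q₀ x) * Y x)) j k)
      x

/-- The `2 m` columns of the matrix solutions `Y₁`, `Y₂` form a basis of the space of
(column vector) solutions: every column solution is `Y₁ a + Y₂ b` for unique constant
columns `a`, `b`. -/
structure IsFundamentalSystem (Q₁ Q₀ : ℝ → Matrix (Fin m) (Fin m) ℂ) (ρ : ℂ)
    (Y₁ Y₂ : ℝ → Matrix (Fin m) (Fin m) ℂ) : Prop where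
  left : IsSolution Q₁ Q₀ ρ Y₁
  right : IsSolution Q₁ Q₀ ρ Y₂
  basis : ∀ y : ℝ → Matrix (Fin m) Unit ℂ, IsSolution Q₁ Q₀ ρ y →
    ∃! c : Matrix (Fin m) Unit ℂ × Matrix (Fin m) Unit ℂ,
      ∀ x : ℝ, 0 ≤ x → y x = Y₁ x * c.1 + Y₂ x * c.2

/-- The sign `±1` as a complex number. -/
def sgn (σ : ℤˣ) : ℂ := ((σ : ℤ) : ℂ)

/-- The open half-plane `Π_τ = {ρ : τ Im ρ > 0}`. -/
def openHalf (τ : ℤˣ) : Set ℂ := {ρ | 0 < ((τ : ℤ) : ℝ) * ρ.im}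

/-- The closed half-plane `{ρ : τ Im ρ ≥ 0}`. -/
def closedHalf (τ : ℤˣ) : Set ℂ := {ρ | 0 ≤ ((τ : ℤ) : ℝ) * ρ.im}

/-- The Cauchy problem `P' = σ Q₁ P`, `P(0) = I` on the half-line. -/
structure SolvesP (σ : ℤˣ) (Q₁ P : ℝ → Matrix (Fin m) (Fin m) ℂ) : Prop where
  eqn : ∀ x : ℝ, 0 ≤ x → ∀ j k,
    HasDerivWithinAt (fun t => P t j k) ((sgn σ • (Q₁ x * P x)) j k) (Ici 0) x
  init : P 0 = 1

/-- The Cauchy problem `T' = σ Q₁ T + (1 / (2 i)) (Q₁' + σ Q₁² + σ Q₀) P`, `T(x) → 0` as `x → ∞`,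
on the half-line, for locally absolutely continuous `T` and almost all `x > 0`. -/
structure SolvesT (σ : ℤˣ) (Q₁ Q₀ P T : ℝ → Matrix (Fin m) (Fin m) ℂ) : Prop where
  ac : LocallyAC T
  eqn : ∀ᵐ x ∂(volume.restrict (Ioi (0 : ℝ))), ∀ j k,
    HasDerivAt (fun t => T t j k)
      ((sgn σ • (Q₁ x * T x) + (1 / (2 * Complex.I)) •
        ((mderiv Q₁ x + sgn σ • (Q₁ x) ^ 2 + sgn σ • Q₀ x) * P x)) j k) x
  lim : Tendsto T atTop (𝓝 0)

/-- The exponential `exp(σ i ρ x)`. -/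
def ex (σ : ℤˣ) (ρ : ℂ) (x : ℝ) : ℂ := Complex.exp (sgn σ * Complex.I * ρ * x)

/-- `r(x, ρ) = o(1)` as `|ρ| → ∞`, `ρ` in the closed half-plane of sign `τ`, uniformly in
`x ≥ α`. -/
def UniformSmall (τ : ℤˣ) (α : ℝ) (r : ℝ → ℂ → Matrix (Fin m) (Fin m) ℂ) : Prop :=
  ∀ ε : ℝ, 0 < ε → ∃ R : ℝ, ∀ ρ ∈ closedHalf τ, R < ‖ρ‖ → ∀ x : ℝ, α ≤ x →
    ∀ j k, ‖r x ρ j k‖ ≤ ε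

end MatrixPencil

end

/-! Put c = iρ and A = c − Q₁. Since c is scalar, ρ² + 2iρQ₁ + Q₀ = −A² + Q₁² + Q₀, so A² is the
negative of the pencil up to terms free of ρ. Writing Y = u + w and Y' = A(u − w) turns the equation
into u' = Au + f, w' = −Aw − f with 2Af = (Q₁' − Q₁² − Q₀)u − (Q₁' + Q₁² + Q₀)w. Solving for f gains
a factor 1/ρ. The propagators P₋ and P₊ absorb the terms ∓Q₁: with u = e^{κx}P₋a, w = e^{κx}P₊b and
κ = ±iρ, the amplitudes a, b see only scalar exponentials and an integrable source
(`WKBData.hasACDeriv_solution`).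

Replacing (ρ, Q₁) by (−ρ, −Q₁) fixes the pencil and exchanges the half-planes, so it suffices to
treat Im ρ ≥ 0 (`WKBData.exists_fundamentalSystem_reflect`). For κ = iρ both amplitudes are
integrated from infinity; for κ = −iρ, b is integrated from infinity and a from α. Every exponential
then has modulus at most one, and the integral operator on [α, ∞) has norm at most a constant times
μ(α)/|ρ|, where μ(α) is the integral of ‖Q₁'‖ + ‖Q₁‖² + ‖Q₀‖ over [α, ∞). Thus it is a contraction
beyond a threshold proportional to μ(α), which tends to zero. The Neumann series
(`IsNeumannKernel.exists_solution`) is continuous in (x, ρ) and holomorphic in ρ.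

One feedback step gives ρf → (1/2i) times the source. The amplitude without exponential then yields
a tail integral, which is exactly the first correction T (`WKBData.unifSmall_main`), while the
oscillating amplitude is o(1/ρ) by a Riemann–Lebesgue lemma uniform in x and in the closed
half-plane (`uniform_riemann_lebesgue`). As x → ∞ the integrals from infinity vanish for all Im ρ ≥
0; the integral from α vanishes because Im ρ > 0.

The first order system, whose fundamental matrix is entire in ρ, carries both solutions from α back
to 0 (`IsPencilSolution.exists_extension`). For the dominant solution a(α) = 0, so the initial data
at α can be inverted by elimination (`existsUnique_of_isUnit`), which gives the basis property on
the real axis as well. -/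

noncomputable section

namespace MatrixPencil

/-! ### Absolutely continuous functions with values in normed spaces -/

section AbsoluteContinuity

variable {X Z : Type*} [PseudoMetricSpace X] [PseudoMetricSpace Z]

theorem absolutelyContinuousOnInterval_of_dist_le {F : ℝ → X} {G : ℝ → Z} {a b : ℝ}
    (hG : AbsolutelyContinuousOnInterval G a b)
    (h : ∀ x ∈ uIcc a b, ∀ y ∈ uIcc a b, dist (F x) (F y) ≤ dist (G x) (G y)) :
    AbsolutelyContinuousOnInterval F a b := by
  rw [absolutelyContinuousOnInterval_iff] at hG ⊢
  intro ε hε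
  obtain ⟨δ, hδ, H⟩ := hG ε hε
  refine ⟨δ, hδ, fun E hE hs => lt_of_le_of_lt (Finset.sum_le_sum fun i hi => ?_) (H E hE hs)⟩
  exact h _ (hE.1 i hi).1 _ (hE.1 i hi).2

theorem absolutelyContinuousOnInterval_congr {F G : ℝ → X} {a b : ℝ}
    (hG : AbsolutelyContinuousOnInterval G a b) (h : EqOn F G (uIcc a b)) :
    AbsolutelyContinuousOnInterval F a b :=
  absolutelyContinuousOnInterval_of_dist_le hG fun x hx y hy => by rw [h hx, h hy]

variable {E : Type*} [NormedAddCommGroup E]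

theorem absolutelyContinuousOnInterval_mul {R : Type*} [NormedRing R] {F G : ℝ → R} {a b : ℝ}
    (hF : AbsolutelyContinuousOnInterval F a b) (hG : AbsolutelyContinuousOnInterval G a b) :
    AbsolutelyContinuousOnInterval (fun x => F x * G x) a b := by
  obtain ⟨C, hC⟩ := hF.exists_bound
  obtain ⟨D, hD⟩ := hG.exists_bound
  have h0 : Tendsto (fun J : ℕ × (ℕ → ℝ × ℝ) =>
      C * ∑ i ∈ Finset.range J.1, dist (G (J.2 i).1) (G (J.2 i).2) +
      D * ∑ i ∈ Finset.range J.1, dist (F (J.2 i).1) (F (J.2 i).2))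
      (AbsolutelyContinuousOnInterval.totalLengthFilter ⊓
        𝓟 (AbsolutelyContinuousOnInterval.disjWithin a b)) (𝓝 0) := by
    simpa using (Tendsto.const_mul C hG).add (Tendsto.const_mul D hF)
  refine squeeze_zero' (Eventually.of_forall fun _ => Finset.sum_nonneg fun _ _ => dist_nonneg)
    ?_ h0
  rw [eventually_inf_principal]
  filter_upwards with J hJ
  rw [Finset.mul_sum, Finset.mul_sum, ← Finset.sum_add_distrib]
  refine Finset.sum_le_sum fun i hi => ?_
  have h1 := hC _ (hJ.1 i hi).1
  have h2 := hD _ (hJ.1 i hi).2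
  rw [dist_eq_norm, dist_eq_norm, dist_eq_norm]
  calc ‖F (J.2 i).1 * G (J.2 i).1 - F (J.2 i).2 * G (J.2 i).2‖
      = ‖F (J.2 i).1 * (G (J.2 i).1 - G (J.2 i).2) + (F (J.2 i).1 - F (J.2 i).2) * G (J.2 i).2‖ := by
        congr 1; noncomm_ring
    _ ≤ ‖F (J.2 i).1‖ * ‖G (J.2 i).1 - G (J.2 i).2‖ + ‖F (J.2 i).1 - F (J.2 i).2‖ * ‖G (J.2 i).2‖ :=
        (norm_add_le _ _).trans (add_le_add (norm_mul_le _ _) (norm_mul_le _ _))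
    _ ≤ C * ‖G (J.2 i).1 - G (J.2 i).2‖ + D * ‖F (J.2 i).1 - F (J.2 i).2‖ := by
        rw [mul_comm ‖F (J.2 i).1 - F (J.2 i).2‖]; gcongr

theorem absolutelyContinuousOnInterval_apply {E' : Type*} [NormedAddCommGroup E']
    [NormedSpace ℂ E] [NormedSpace ℂ E'] {F : ℝ → E →L[ℂ] E'} {G : ℝ → E} {a b : ℝ}
    (hF : AbsolutelyContinuousOnInterval F a b) (hG : AbsolutelyContinuousOnInterval G a b) :
    AbsolutelyContinuousOnInterval (fun x => F x (G x)) a b := by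
  obtain ⟨C, hC⟩ := hF.exists_bound
  obtain ⟨D, hD⟩ := hG.exists_bound
  have h0 : Tendsto (fun J : ℕ × (ℕ → ℝ × ℝ) =>
      C * ∑ i ∈ Finset.range J.1, dist (G (J.2 i).1) (G (J.2 i).2) +
      D * ∑ i ∈ Finset.range J.1, dist (F (J.2 i).1) (F (J.2 i).2))
      (AbsolutelyContinuousOnInterval.totalLengthFilter ⊓
        𝓟 (AbsolutelyContinuousOnInterval.disjWithin a b)) (𝓝 0) := by
    simpa using (Tendsto.const_mul C hG).add (Tendsto.const_mul D hF)
  refine squeeze_zero' (Eventually.of_forall fun _ => Finset.sum_nonneg fun _ _ => dist_nonneg)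
    ?_ h0
  rw [eventually_inf_principal]
  filter_upwards with J hJ
  rw [Finset.mul_sum, Finset.mul_sum, ← Finset.sum_add_distrib]
  refine Finset.sum_le_sum fun i hi => ?_
  have h1 := hC _ (hJ.1 i hi).1
  have h2 := hD _ (hJ.1 i hi).2
  rw [dist_eq_norm, dist_eq_norm, dist_eq_norm]
  calc ‖F (J.2 i).1 (G (J.2 i).1) - F (J.2 i).2 (G (J.2 i).2)‖
      = ‖F (J.2 i).1 (G (J.2 i).1 - G (J.2 i).2) + (F (J.2 i).1 - F (J.2 i).2) (G (J.2 i).2)‖ := by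
        congr 1; simp
    _ ≤ ‖F (J.2 i).1‖ * ‖G (J.2 i).1 - G (J.2 i).2‖ + ‖F (J.2 i).1 - F (J.2 i).2‖ * ‖G (J.2 i).2‖ :=
        (norm_add_le _ _).trans (add_le_add (ContinuousLinearMap.le_opNorm _ _)
          (ContinuousLinearMap.le_opNorm _ _))
    _ ≤ C * ‖G (J.2 i).1 - G (J.2 i).2‖ + D * ‖F (J.2 i).1 - F (J.2 i).2‖ := by
        rw [mul_comm ‖F (J.2 i).1 - F (J.2 i).2‖]; gcongr

/-- Increments are dominated by those of the scalar primitive of `‖f‖`, for which absolute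
continuity is known. -/
theorem absolutelyContinuousOnInterval_integral [NormedSpace ℝ E] {f : ℝ → E} {a b : ℝ}
    (h : IntervalIntegrable f volume a b) :
    AbsolutelyContinuousOnInterval (fun x => ∫ t in a..x, f t) a b := by
  have hac := h.norm.absolutelyContinuousOnInterval_intervalIntegral (left_mem_uIcc (a := a) (b := b))
  refine absolutelyContinuousOnInterval_of_dist_le hac fun x hx y hy => ?_
  have hx' : IntervalIntegrable f volume a x := h.mono_set (uIcc_subset_uIcc left_mem_uIcc hx)
  have hy' : IntervalIntegrable f volume a y := h.mono_set (uIcc_subset_uIcc left_mem_uIcc hy)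
  rw [dist_eq_norm, Real.dist_eq, intervalIntegral.integral_interval_sub_left hx' hy',
    intervalIntegral.integral_interval_sub_left hx'.norm hy'.norm]
  exact intervalIntegral.norm_integral_le_abs_integral_norm

end AbsoluteContinuity

/-! ### Calculus of absolutely continuous functions on a half-line -/

/-- `F` is absolutely continuous on `[a, b]` for all `b ≥ a`, with a.e. derivative `f`. -/
structure HasACDeriv {E : Type*} [NormedAddCommGroup E] [NormedSpace ℝ E] (a : ℝ) (F f : ℝ → E) :
    Prop where
  ac : ∀ b, a ≤ b → AbsolutelyContinuousOnInterval F a b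
  deriv : ∀ᵐ x ∂(volume.restrict (Ioi a)), HasDerivAt F (f x) x

namespace HasACDeriv

section NormedSpace

variable {E : Type*} [NormedAddCommGroup E] [NormedSpace ℝ E] {a : ℝ} {F G f g : ℝ → E}

theorem continuousOn (h : HasACDeriv a F f) : ContinuousOn F (Ici a) := by
  intro x hx
  have h1 := (h.ac (x + 1) (by have : a ≤ x := hx; linarith)).continuousOn
  rw [uIcc_of_le (by have : a ≤ x := hx; linarith)] at h1
  refine (h1 x ⟨hx, by linarith⟩).mono_of_mem_nhdsWithin ?_
  have : Icc a (x + 1) = Ici a ∩ Iic (x + 1) := rfl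
  rw [this]
  exact inter_mem_nhdsWithin _ (Iic_mem_nhds (by linarith))

theorem mono (h : HasACDeriv a F f) {b : ℝ} (hab : a ≤ b) : HasACDeriv b F f :=
  ⟨fun c hc => (h.ac c (hab.trans hc)).mono
    (by rw [uIcc_of_le hc, uIcc_of_le (hab.trans hc)]; exact Icc_subset_Icc_left hab),
    ae_restrict_of_ae_restrict_of_subset (Ioi_subset_Ioi hab) h.deriv⟩

theorem congr_deriv (h : HasACDeriv a F f) (hfg : ∀ x, a < x → f x = g x) : HasACDeriv a F g :=
  ⟨h.ac, by
    filter_upwards [h.deriv, ae_restrict_mem measurableSet_Ioi] with x hx hx'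
    rw [← hfg x hx']; exact hx⟩

theorem congr (h : HasACDeriv a F f) (hFG : ∀ x, a ≤ x → G x = F x) : HasACDeriv a G f :=
  ⟨fun b hb => absolutelyContinuousOnInterval_congr (h.ac b hb)
      fun x hx => hFG x (by rw [uIcc_of_le hb] at hx; exact hx.1), by
    filter_upwards [h.deriv, ae_restrict_mem measurableSet_Ioi] with x hx hx'
    refine hx.congr_of_eventuallyEq ?_
    filter_upwards [Ioi_mem_nhds hx'] with y hy using hFG y (le_of_lt hy)⟩

theorem add (hF : HasACDeriv a F f) (hG : HasACDeriv a G g) :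
    HasACDeriv a (fun x => F x + G x) (fun x => f x + g x) :=
  ⟨fun b hb => (hF.ac b hb).fun_add (hG.ac b hb), by
    filter_upwards [hF.deriv, hG.deriv] with x h1 h2 using h1.add h2⟩

theorem sub (hF : HasACDeriv a F f) (hG : HasACDeriv a G g) :
    HasACDeriv a (fun x => F x - G x) (fun x => f x - g x) :=
  ⟨fun b hb => (hF.ac b hb).fun_sub (hG.ac b hb), by
    filter_upwards [hF.deriv, hG.deriv] with x h1 h2 using h1.sub h2⟩

theorem neg (hF : HasACDeriv a F f) : HasACDeriv a (fun x => -F x) (fun x => -f x) :=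
  ⟨fun b hb => (hF.ac b hb).fun_neg, by
    filter_upwards [hF.deriv] with x h1 using h1.neg⟩

theorem of_contDiff (hF : ContDiff ℝ 1 F) (h : ∀ x, HasDerivAt F (f x) x) : HasACDeriv a F f :=
  ⟨fun _ _ => hF.contDiffOn.absolutelyContinuousOnInterval, Eventually.of_forall h⟩

theorem const (c : E) : HasACDeriv a (fun _ => c) (fun _ => 0) :=
  of_contDiff contDiff_const fun x => hasDerivAt_const x c

theorem const_smul {𝕜 : Type*} [NormedField 𝕜] [NormedSpace 𝕜 E] [SMulCommClass ℝ 𝕜 E]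
    (c : 𝕜) (hF : HasACDeriv a F f) : HasACDeriv a (fun x => c • F x) (fun x => c • f x) :=
  ⟨fun b hb => (hF.ac b hb).const_smul c, by
    filter_upwards [hF.deriv] with x h1 using h1.const_smul c⟩

/-- This is the source of all uniqueness and inversion statements below: each exhibits a product
whose almost everywhere derivative cancels. -/
theorem eq_of_deriv_zero (hF : HasACDeriv a F f) (h0 : ∀ x, a < x → f x = 0) :
    ∀ x, a ≤ x → F x = F a := by
  intro x hx
  obtain ⟨C, hC⟩ := (hF.ac x hx).const_of_ae_hasDerivAt_zero (by
    have h1 := (ae_restrict_iff' measurableSet_Ioi).1 hF.deriv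
    have h2 : ∀ᵐ y : ℝ, y ≠ a := by simp [ae_iff]
    filter_upwards [h1, h2] with y hy hya hyx
    rw [uIcc_of_le hx] at hyx
    have : a < y := lt_of_le_of_ne hyx.1 hya.symm
    have := hy this
    rwa [h0 y ‹_›] at this)
  rw [hC x right_mem_uIcc, hC a left_mem_uIcc]

theorem primitive [CompleteSpace E] (hf : ∀ b, IntegrableOn f (Icc a b) volume) :
    HasACDeriv a (fun x => ∫ t in a..x, f t) f := by
  have hi : ∀ b, a ≤ b → IntervalIntegrable f volume a b := fun b hb =>
    (intervalIntegrable_iff_integrableOn_Icc_of_le hb).2 (hf b)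
  refine ⟨fun b hb => absolutelyContinuousOnInterval_integral (hi b hb), ?_⟩
  rw [ae_restrict_iff' measurableSet_Ioi]
  -- Countably many intervals exhaust the half-line, so one null set serves for all of them.
  have : ∀ n : ℕ, ∀ᵐ x : ℝ, x ∈ uIcc a (a + n) → ∀ c ∈ uIcc a (a + n),
      HasDerivAt (fun x => ∫ t in c..x, f t) (f x) x := fun n =>
    (hi (a + n) (by simp)).ae_hasDerivAt_integral
  filter_upwards [ae_all_iff.2 this] with x hx hax
  obtain ⟨n, hn⟩ := exists_nat_ge (x - a)
  refine hx n ?_ a left_mem_uIcc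
  rw [uIcc_of_le (by simp)]
  exact ⟨le_of_lt hax, by linarith⟩

theorem sub_eq_integral [CompleteSpace E] (hF : HasACDeriv a F f)
    (hf : ∀ b, IntegrableOn f (Icc a b) volume) (x : ℝ) (hx : a ≤ x) :
    F x - F a = ∫ t in a..x, f t := by
  have h := (hF.sub (primitive hf)).eq_of_deriv_zero (fun x _ => sub_self (f x)) x hx
  simp only [intervalIntegral.integral_same, sub_zero] at h
  rw [← h]; abel

end NormedSpace

section Algebra

variable {R : Type*} [NormedRing R] [NormedAlgebra ℝ R] {a : ℝ} {F G f g : ℝ → R}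

theorem mul (hF : HasACDeriv a F f) (hG : HasACDeriv a G g) :
    HasACDeriv a (fun x => F x * G x) (fun x => f x * G x + F x * g x) :=
  ⟨fun b hb => absolutelyContinuousOnInterval_mul (hF.ac b hb) (hG.ac b hb), by
    filter_upwards [hF.deriv, hG.deriv] with x h1 h2 using h1.mul h2⟩

end Algebra

section Operators

variable {E E' : Type*} [NormedAddCommGroup E] [NormedAddCommGroup E'] [NormedSpace ℂ E]
  [NormedSpace ℂ E'] {a : ℝ}

theorem smul {F f : ℝ → ℂ} {G g : ℝ → E} (hF : HasACDeriv a F f) (hG : HasACDeriv a G g) :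
    HasACDeriv a (fun x => F x • G x) (fun x => f x • G x + F x • g x) :=
  ⟨fun b hb => (hF.ac b hb).fun_smul (hG.ac b hb), by
    filter_upwards [hF.deriv, hG.deriv] with x h1 h2
    rw [add_comm]; exact h1.smul h2⟩

theorem clm_apply {F f : ℝ → E →L[ℂ] E'} {G g : ℝ → E} (hF : HasACDeriv a F f)
    (hG : HasACDeriv a G g) :
    HasACDeriv a (fun x => F x (G x)) (fun x => f x (G x) + F x (g x)) :=
  ⟨fun b hb => absolutelyContinuousOnInterval_apply (hF.ac b hb) (hG.ac b hb), by
    filter_upwards [hF.deriv, hG.deriv] with x h1 h2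
    let B : (E →L[ℂ] E') →L[ℝ] E →L[ℝ] E' :=
      (ContinuousLinearMap.restrictScalarsL ℂ E E' ℝ ℝ)
    have h3 : HasDerivAt (fun x => B (F x)) (B (f x)) x := B.hasFDerivAt.comp_hasDerivAt x h1
    exact h3.clm_apply h2⟩

theorem clm_comp (L : E →L[ℂ] E') {G g : ℝ → E} (hG : HasACDeriv a G g) :
    HasACDeriv a (fun x => L (G x)) (fun x => L (g x)) := by
  have := (const (a := a) L).clm_apply hG
  exact this.congr_deriv fun x _ => by simp

theorem prodMk {F f : ℝ → E} {G g : ℝ → E'} (hF : HasACDeriv a F f) (hG : HasACDeriv a G g) :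
    HasACDeriv a (fun x => (F x, G x)) (fun x => (f x, g x)) := by
  have h1 := clm_comp (ContinuousLinearMap.inl ℂ E E') hF
  have h2 := clm_comp (ContinuousLinearMap.inr ℂ E E') hG
  refine ((h1.add h2).congr fun x _ => ?_).congr_deriv fun x _ => ?_ <;> simp

end Operators

theorem exp {a : ℝ} {F f : ℝ → ℝ} (hF : HasACDeriv a F f) :
    HasACDeriv a (fun x => Real.exp (F x)) (fun x => Real.exp (F x) * f x) := by
  refine ⟨fun b hb => ?_, by filter_upwards [hF.deriv] with x h1 using h1.exp⟩
  obtain ⟨C, hC⟩ := (hF.ac b hb).exists_bound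
  refine absolutelyContinuousOnInterval_of_dist_le ((hF.ac b hb).const_mul (Real.exp C))
    fun x hx y hy => ?_
  have hl : ∀ u ∈ Iic C, ∀ v ∈ Iic C, dist (Real.exp u) (Real.exp v) ≤ Real.exp C * dist u v := by
    intro u hu v hv
    have := Convex.norm_image_sub_le_of_norm_deriv_le (f := Real.exp) (C := Real.exp C)
      (s := Iic C) (fun x _ => Real.differentiableAt_exp) (fun x hx => by
        rw [Real.deriv_exp, Real.norm_eq_abs, abs_of_pos (Real.exp_pos x)]
        exact Real.exp_le_exp.2 hx) (convex_Iic C) hv hu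
    rwa [← dist_eq_norm, ← dist_eq_norm] at this
  refine (hl _ ((le_abs_self _).trans (hC x hx)) _ ((le_abs_self _).trans (hC y hy))).trans ?_
  rw [Real.dist_eq, Real.dist_eq, ← mul_sub, abs_mul, abs_of_pos (Real.exp_pos C)]

end HasACDeriv

/-! ### Holomorphic dependence of integrals on a parameter -/

section Holomorphic

variable {E : Type*} [NormedAddCommGroup E] [NormedSpace ℂ E]

/-- Cauchy's estimate on the circle of radius ε/4 about w, which stays inside the ball because ε/2 +
ε/4 < ε. -/
theorem norm_deriv_le_of_ball_bound {f : ℂ → E} {c : ℂ} {ε C : ℝ} (hε : 0 < ε)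
    (hf : DifferentiableOn ℂ f (Metric.ball c ε)) (hC : ∀ z ∈ Metric.ball c ε, ‖f z‖ ≤ C)
    {w : ℂ} (hw : w ∈ Metric.ball c (ε / 2)) : ‖deriv f w‖ ≤ C / (ε / 4) := by
  have hsub : Metric.closedBall w (ε / 4) ⊆ Metric.ball c ε := by
    intro z hz
    rw [Metric.mem_closedBall] at hz
    rw [Metric.mem_ball] at hw ⊢
    have := dist_triangle z w c
    linarith
  refine Complex.norm_deriv_le_of_forall_mem_sphere_norm_le (by positivity) ?_ ?_
  · refine (hf.mono ?_).diffContOnCl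
    exact (Metric.closure_ball_subset_closedBall).trans hsub
  · exact fun z hz => hC z (hsub (Metric.sphere_subset_closedBall hz))

/-- The derivative is an almost everywhere limit of difference quotients along a sequence, so
measurability of each `F z` suffices. -/
theorem aestronglyMeasurable_deriv {α : Type*} [MeasurableSpace α] {μ : Measure α}
    {F : ℂ → α → E} {c : ℂ} {ε : ℝ} (hε : 0 < ε)
    (hm : ∀ z ∈ Metric.ball c ε, AEStronglyMeasurable (F z) μ)
    (hd : ∀ᵐ s ∂μ, DifferentiableAt ℂ (fun z => F z s) c) :
    AEStronglyMeasurable (fun s => deriv (fun z => F z s) c) μ := by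
  let t : ℕ → ℂ := fun n => ((ε / (n + 2) : ℝ) : ℂ)
  have ht0 : ∀ n : ℕ, 0 < ε / ((n : ℝ) + 2) := fun n => by positivity
  have htb : ∀ n, c + t n ∈ Metric.ball c ε := fun n => by
    rw [Metric.mem_ball, dist_eq_norm, add_sub_cancel_left, Complex.norm_real, Real.norm_eq_abs,
      abs_of_pos (ht0 n), div_lt_iff₀ (by positivity)]
    have : (0 : ℝ) ≤ n := n.cast_nonneg
    nlinarith
  have hlim : Tendsto t atTop (𝓝[≠] 0) := by
    refine tendsto_nhdsWithin_iff.2 ⟨?_, Eventually.of_forall fun n => ?_⟩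
    · have h1 : Tendsto (fun n : ℕ => ε / ((n : ℝ) + 2)) atTop (𝓝 0) :=
        (tendsto_const_nhds).div_atTop
          (tendsto_atTop_add_const_right _ _ tendsto_natCast_atTop_atTop)
      have := (Complex.continuous_ofReal.tendsto 0).comp h1
      simpa [t, Function.comp_def] using this
    · simp only [t, mem_compl_iff, mem_singleton_iff, Complex.ofReal_eq_zero]
      exact (ht0 n).ne'
  refine aestronglyMeasurable_of_tendsto_ae (u := atTop)
    (f := fun n s => (t n)⁻¹ • (F (c + t n) s - F c s)) (fun n => ?_) ?_
  · exact ((hm _ (htb n)).sub (hm c (Metric.mem_ball_self hε))).const_smul _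
  · filter_upwards [hd] with s hs
    exact (hasDerivAt_iff_tendsto_slope_zero.1 hs.hasDerivAt).comp hlim

/-- Only the integrand has to be dominated locally: for holomorphic integrands Cauchy's estimate
dominates the derivative on a smaller ball. -/
theorem differentiableOn_integral_of_dominated [CompleteSpace E] {α : Type*} [MeasurableSpace α]
    {μ : Measure α} {F : ℂ → α → E} {U : Set ℂ} (hU : IsOpen U)
    (hm : ∀ z ∈ U, AEStronglyMeasurable (F z) μ)
    (hd : ∀ᵐ s ∂μ, DifferentiableOn ℂ (fun z => F z s) U)
    (hb : ∀ c ∈ U, ∃ h : α → ℝ, Integrable h μ ∧ ∀ᶠ ε in 𝓝[>] (0 : ℝ),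
      ∀ᵐ s ∂μ, ∀ z ∈ Metric.ball c ε, ‖F z s‖ ≤ h s) :
    DifferentiableOn ℂ (fun z => ∫ s, F z s ∂μ) U := by
  intro c hc
  obtain ⟨h, hh, hbd⟩ := hb c hc
  obtain ⟨ε₁, hε₁, hsub₁⟩ := Metric.isOpen_iff.1 hU c hc
  obtain ⟨ε, ⟨hbε, hεlt⟩, hε⟩ := ((hbd.and (mem_nhdsWithin_of_mem_nhds (Iio_mem_nhds hε₁))).and
    self_mem_nhdsWithin).exists
  have hε : 0 < ε := hε
  have hsub : Metric.ball c ε ⊆ U := (Metric.ball_subset_ball (le_of_lt hεlt)).trans hsub₁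
  have key := hasDerivAt_integral_of_dominated_loc_of_deriv_le (𝕜 := ℂ) (μ := μ) (F := F)
    (x₀ := c) (s := Metric.ball c (ε / 2)) (bound := fun s => h s / (ε / 4))
    (F' := fun z s => deriv (fun z => F z s) z) (Metric.ball_mem_nhds c (by positivity))
    (by filter_upwards [Metric.ball_mem_nhds c hε] with z hz using hm z (hsub hz))
    (hh.mono' (hm c hc) (by filter_upwards [hbε] with s hs using hs c (Metric.mem_ball_self hε)))
    (aestronglyMeasurable_deriv hε (fun z hz => hm z (hsub hz)) (by
      filter_upwards [hd] with s hs using (hs c hc).differentiableAt (hU.mem_nhds hc)))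
    (by filter_upwards [hd, hbε] with s hs hs' w hw using
          norm_deriv_le_of_ball_bound hε (hs.mono hsub) hs' hw)
    (hh.div_const _)
    (by
      filter_upwards [hd] with s hs w hw
      have hwU : w ∈ U := hsub (Metric.ball_subset_ball (by linarith) hw)
      exact ((hs w hwU).differentiableAt (hU.mem_nhds hwU)).hasDerivAt)
  exact key.2.differentiableAt.differentiableWithinAt

end Holomorphic

/-! ### Neumann series for integral equations with a parameter -/

section Kernel

variable {E : Type*} [NormedAddCommGroup E] [NormedSpace ℂ E]

/-- Hypotheses on an operator kernel `G x s ρ` on `S`, with parameter in `Ω`, under which the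
integral equation `z = e + ∫ G z` is solved by a Neumann series in the norm with weight `W`. -/
structure IsNeumannKernel (S : Set ℝ) (Ω U : Set ℂ) (θ : ℝ) (W : ℝ → ℂ → ℝ)
    (G : ℝ → ℝ → ℂ → (E →L[ℂ] E)) : Prop where
  measS : MeasurableSet S
  openU : IsOpen U
  sub : U ⊆ Ω
  θ_nonneg : 0 ≤ θ
  θ_lt : θ < 1
  one_le : ∀ x ∈ S, ∀ ρ ∈ Ω, 1 ≤ W x ρ
  contW : ContinuousOn (fun p : ℝ × ℂ => W p.1 p.2) (S ×ˢ Ω)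
  meas : ∀ x ∈ S, ∀ ρ ∈ Ω, AEStronglyMeasurable (fun s => G x s ρ) (volume.restrict S)
  dom : ∀ p ∈ S ×ˢ Ω, ∃ h : ℝ → ℝ, IntegrableOn h S volume ∧
    ∀ᶠ q in 𝓝[S ×ˢ Ω] p, ∀ s ∈ S, ‖G q.1 s q.2‖ * W s q.2 ≤ h s
  contract : ∀ x ∈ S, ∀ ρ ∈ Ω, ∫ s in S, ‖G x s ρ‖ * W s ρ ≤ θ * W x ρ
  cont : ∀ p ∈ S ×ˢ Ω, ∀ s ∈ S, s ≠ p.1 →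
    ContinuousWithinAt (fun q : ℝ × ℂ => G q.1 s q.2) (S ×ˢ Ω) p
  diff : ∀ x ∈ S, ∀ s ∈ S, DifferentiableOn ℂ (fun ρ => G x s ρ) U

/-- The regularity carried by the Neumann iterates, with bound `c W`. -/
structure IsRegular (S : Set ℝ) (Ω U : Set ℂ) (W : ℝ → ℂ → ℝ) (c : ℝ) (z : ℝ → ℂ → E) : Prop where
  cont : ContinuousOn (fun p : ℝ × ℂ => z p.1 p.2) (S ×ˢ Ω)
  diff : ∀ x ∈ S, DifferentiableOn ℂ (fun ρ => z x ρ) U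
  bound : ∀ x ∈ S, ∀ ρ ∈ Ω, ‖z x ρ‖ ≤ c * W x ρ

namespace IsNeumannKernel

variable {S : Set ℝ} {Ω U : Set ℂ} {θ c : ℝ} {W : ℝ → ℂ → ℝ} {G : ℝ → ℝ → ℂ → (E →L[ℂ] E)}
  {z : ℝ → ℂ → E}

theorem integrand_meas (hG : IsNeumannKernel S Ω U θ W G) (hz : IsRegular S Ω U W c z) {x : ℝ}
    (hx : x ∈ S) {ρ : ℂ} (hρ : ρ ∈ Ω) :
    AEStronglyMeasurable (fun s => G x s ρ (z s ρ)) (volume.restrict S) := by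
  have h1 : ContinuousOn (fun s => z s ρ) S :=
    hz.cont.comp (f := fun s : ℝ => (s, ρ)) (by fun_prop) fun s hs => ⟨hs, hρ⟩
  exact (isBoundedBilinearMap_apply (𝕜 := ℂ)).continuous.comp_aestronglyMeasurable
    ((hG.meas x hx ρ hρ).prodMk (h1.aestronglyMeasurable hG.measS))

theorem norm_integrand_le (hz : IsRegular S Ω U W c z) {x s : ℝ}
    (hs : s ∈ S) {ρ : ℂ} (hρ : ρ ∈ Ω) :
    ‖G x s ρ (z s ρ)‖ ≤ c * (‖G x s ρ‖ * W s ρ) := by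
  calc ‖G x s ρ (z s ρ)‖ ≤ ‖G x s ρ‖ * ‖z s ρ‖ := ContinuousLinearMap.le_opNorm _ _
    _ ≤ ‖G x s ρ‖ * (c * W s ρ) := by gcongr; exact hz.bound s hs ρ hρ
    _ = _ := by ring

theorem dom_integrable (hG : IsNeumannKernel S Ω U θ W G) {x : ℝ}
    (hx : x ∈ S) {ρ : ℂ} (hρ : ρ ∈ Ω) :
    IntegrableOn (fun s => ‖G x s ρ‖ * W s ρ) S volume := by
  obtain ⟨h, hh, hb⟩ := hG.dom (x, ρ) ⟨hx, hρ⟩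
  have hb' := hb.self_of_nhdsWithin (⟨hx, hρ⟩ : (x, ρ) ∈ S ×ˢ Ω)
  have h1 : ContinuousOn (fun s => W s ρ) S :=
    hG.contW.comp (f := fun s : ℝ => (s, ρ)) (by fun_prop) fun s hs => ⟨hs, hρ⟩
  refine hh.mono' ((hG.meas x hx ρ hρ).norm.mul (h1.aestronglyMeasurable hG.measS)) ?_
  filter_upwards [ae_restrict_mem hG.measS] with s hs
  rw [Real.norm_eq_abs, abs_of_nonneg (mul_nonneg (norm_nonneg _)
    (zero_le_one.trans (hG.one_le s hs ρ hρ)))]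
  exact hb' s hs

theorem integrand_integrable (hG : IsNeumannKernel S Ω U θ W G) (hz : IsRegular S Ω U W c z)
    {x : ℝ} (hx : x ∈ S) {ρ : ℂ} (hρ : ρ ∈ Ω) :
    IntegrableOn (fun s => G x s ρ (z s ρ)) S volume := by
  refine ((hG.dom_integrable hx hρ).const_mul c).mono' (hG.integrand_meas hz hx hρ) ?_
  filter_upwards [ae_restrict_mem hG.measS] with s hs using norm_integrand_le hz hs hρ

/-- Each application of the operator multiplies the weighted bound by θ. Continuity follows by
dominated convergence, holomorphy by Cauchy's estimate under the integral. -/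
theorem step [CompleteSpace E] (hG : IsNeumannKernel S Ω U θ W G) (hz : IsRegular S Ω U W c z)
    (hc : 0 ≤ c) :
    IsRegular S Ω U W (c * θ) (fun x ρ => ∫ s in S, G x s ρ (z s ρ)) := by
  refine ⟨?_, ?_, ?_⟩
  · intro p hp
    obtain ⟨h, hh, hb⟩ := hG.dom p hp
    refine continuousWithinAt_of_dominated (bound := fun s => c * h s) ?_ ?_ (hh.const_mul c) ?_
    · filter_upwards [self_mem_nhdsWithin] with q hq using hG.integrand_meas hz hq.1 hq.2
    · filter_upwards [self_mem_nhdsWithin, hb] with q hq hbq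
      filter_upwards [ae_restrict_mem hG.measS] with s hs
      exact (norm_integrand_le hz hs hq.2).trans (mul_le_mul_of_nonneg_left (hbq s hs) hc)
    -- The kernels may jump on the diagonal, which is a null set for each fixed x.
    · have hne : ∀ᵐ s ∂(volume.restrict S), s ≠ p.1 :=
        ae_restrict_of_ae (by simp [ae_iff])
      filter_upwards [ae_restrict_mem hG.measS, hne] with s hs hsp
      refine (hG.cont p hp s hs hsp).clm_apply ?_
      have h1 : ContinuousOn (fun ρ => z s ρ) Ω :=
        hz.cont.comp (f := fun ρ : ℂ => (s, ρ)) (by fun_prop) fun ρ hρ => ⟨hs, hρ⟩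
      exact (h1 p.2 hp.2).comp (f := Prod.snd) continuousWithinAt_snd fun q hq => hq.2
  · intro x hx
    refine differentiableOn_integral_of_dominated hG.openU
      (fun ρ hρ => hG.integrand_meas hz hx (hG.sub hρ)) ?_ fun ρ₀ hρ₀ => ?_
    · filter_upwards [ae_restrict_mem hG.measS] with s hs
      exact (hG.diff x hx s hs).clm_apply (hz.diff s hs)
    · obtain ⟨h, hh, hb⟩ := hG.dom (x, ρ₀) ⟨hx, hG.sub hρ₀⟩
      refine ⟨fun s => c * h s, hh.const_mul c, ?_⟩
      have h1 : ∀ᶠ ρ in 𝓝 ρ₀, ρ ∈ U ∧ ∀ s ∈ S, ‖G x s ρ‖ * W s ρ ≤ h s := by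
        have h2 : Tendsto (fun ρ : ℂ => (x, ρ)) (𝓝 ρ₀) (𝓝[S ×ˢ Ω] (x, ρ₀)) := by
          refine tendsto_nhdsWithin_iff.2 ⟨(by fun_prop : Continuous fun ρ : ℂ => (x, ρ)).tendsto _, ?_⟩
          filter_upwards [hG.openU.mem_nhds hρ₀] with ρ hρ using ⟨hx, hG.sub hρ⟩
        exact (eventually_mem_set.2 (hG.openU.mem_nhds hρ₀)).and (h2.eventually hb)
      obtain ⟨ε, hε, hball⟩ := Metric.eventually_nhds_iff_ball.1 h1
      filter_upwards [mem_nhdsWithin_of_mem_nhds (Iio_mem_nhds hε)] with δ hδ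
      filter_upwards [ae_restrict_mem hG.measS] with s hs ρ hρ
      have h3 := hball ρ (Metric.ball_subset_ball (le_of_lt hδ) hρ)
      exact (norm_integrand_le hz hs (hG.sub h3.1)).trans
        (mul_le_mul_of_nonneg_left (h3.2 s hs) hc)
  · intro x hx ρ hρ
    calc ‖∫ s in S, G x s ρ (z s ρ)‖ ≤ ∫ s in S, c * (‖G x s ρ‖ * W s ρ) := by
          refine norm_integral_le_of_norm_le ((hG.dom_integrable hx hρ).const_mul c) ?_
          filter_upwards [ae_restrict_mem hG.measS] with s hs using norm_integrand_le hz hs hρ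
      _ = c * ∫ s in S, ‖G x s ρ‖ * W s ρ := integral_const_mul _ _
      _ ≤ c * (θ * W x ρ) := mul_le_mul_of_nonneg_left (hG.contract x hx ρ hρ) hc
      _ = c * θ * W x ρ := by ring

/-- The Neumann iterates. -/
def iter (S : Set ℝ) (G : ℝ → ℝ → ℂ → (E →L[ℂ] E)) (e : E) : ℕ → ℝ → ℂ → E
  | 0 => fun _ _ => e
  | n + 1 => fun x ρ => ∫ s in S, G x s ρ (iter S G e n s ρ)

theorem iter_regular [CompleteSpace E] (hG : IsNeumannKernel S Ω U θ W G) (e : E) (n : ℕ) :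
    IsRegular S Ω U W (‖e‖ * θ ^ n) (iter S G e n) := by
  induction n with
  | zero =>
    refine ⟨continuousOn_const, fun _ _ => differentiableOn_const _, fun x hx ρ hρ => ?_⟩
    simpa [iter] using le_mul_of_one_le_right (norm_nonneg e) (hG.one_le x hx ρ hρ)
  | succ n ih =>
    have h := hG.step ih (mul_nonneg (norm_nonneg e) (pow_nonneg hG.θ_nonneg n))
    rw [mul_assoc, ← pow_succ] at h
    exact h

/-- The iterates are bounded by the geometric sequence `‖e‖ θ ^ n` times the weight, so their sum
inherits continuity and holomorphy, and termwise integration gives the integral equation. -/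
theorem exists_solution [CompleteSpace E] (hG : IsNeumannKernel S Ω U θ W G) (e : E) :
    ∃ z : ℝ → ℂ → E, IsRegular S Ω U W (‖e‖ * (1 - θ)⁻¹) z ∧
      ∀ x ∈ S, ∀ ρ ∈ Ω, z x ρ = e + ∫ s in S, G x s ρ (z s ρ) := by
  have hsum : Summable fun n => ‖e‖ * θ ^ n :=
    (summable_geometric_of_lt_one hG.θ_nonneg hG.θ_lt).mul_left _
  have hbd : ∀ x ∈ S, ∀ ρ ∈ Ω, ∀ n, ‖iter S G e n x ρ‖ ≤ ‖e‖ * θ ^ n * W x ρ :=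
    fun x hx ρ hρ n => (hG.iter_regular e n).bound x hx ρ hρ
  -- A local bound on the weight turns the pointwise geometric bound into locally uniform
  -- convergence.
  have hlocW : ∀ p ∈ S ×ˢ Ω, ∀ᶠ q in 𝓝[S ×ˢ Ω] p, W q.1 q.2 ≤ W p.1 p.2 + 1 := fun p hp =>
    ((hG.contW p hp).eventually (Iio_mem_nhds (lt_add_one _))).mono fun q hq => le_of_lt hq
  have hnn : ∀ n, 0 ≤ ‖e‖ * θ ^ n := fun n => mul_nonneg (norm_nonneg _) (pow_nonneg hG.θ_nonneg n)
  have hreg : IsRegular S Ω U W (‖e‖ * (1 - θ)⁻¹) (fun x ρ => ∑' n, iter S G e n x ρ) := by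
    refine ⟨?_, ?_, ?_⟩
    · intro p hp
      obtain ⟨V, hV, hVW⟩ := mem_nhdsWithin_iff_exists_mem_nhds_inter.1 (hlocW p hp)
      have hc : ContinuousOn (fun q : ℝ × ℂ => ∑' n, iter S G e n q.1 q.2) (V ∩ S ×ˢ Ω) :=
        continuousOn_tsum (u := fun n => ‖e‖ * θ ^ n * (W p.1 p.2 + 1))
          (fun n => (hG.iter_regular e n).cont.mono inter_subset_right) (hsum.mul_right _)
          (fun n q hq => (hbd _ hq.2.1 _ hq.2.2 n).trans
            (mul_le_mul_of_nonneg_left (hVW hq) (hnn n)))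
      refine (hc p ⟨mem_of_mem_nhds hV, hp⟩).mono_of_mem_nhdsWithin ?_
      exact inter_mem (mem_nhdsWithin_of_mem_nhds hV) self_mem_nhdsWithin
    · intro x hx ρ₀ hρ₀
      have h2 : Tendsto (fun ρ : ℂ => (x, ρ)) (𝓝 ρ₀) (𝓝[S ×ˢ Ω] (x, ρ₀)) := by
        refine tendsto_nhdsWithin_iff.2 ⟨(by fun_prop : Continuous fun ρ : ℂ => (x, ρ)).tendsto _, ?_⟩
        filter_upwards [hG.openU.mem_nhds hρ₀] with ρ hρ using ⟨hx, hG.sub hρ⟩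
      have h3 := (eventually_mem_set.2 (hG.openU.mem_nhds hρ₀)).and
        (h2.eventually (hlocW (x, ρ₀) ⟨hx, hG.sub hρ₀⟩))
      obtain ⟨V, hVsub, hVo, hV0⟩ := eventually_nhds_iff.1 h3
      have hd : DifferentiableOn ℂ (fun ρ => ∑' n, iter S G e n x ρ) V :=
        Complex.differentiableOn_tsum_of_summable_norm
          (u := fun n => ‖e‖ * θ ^ n * (W x ρ₀ + 1)) (hsum.mul_right _)
          (fun n => ((hG.iter_regular e n).diff x hx).mono fun ρ hρ => (hVsub ρ hρ).1) hVo
          (fun n ρ hρ => (hbd _ hx _ (hG.sub (hVsub ρ hρ).1) n).trans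
            (mul_le_mul_of_nonneg_left (hVsub ρ hρ).2 (hnn n)))
      exact ((hd ρ₀ hV0).differentiableAt (hVo.mem_nhds hV0)).differentiableWithinAt
    · intro x hx ρ hρ
      have h4 : HasSum (fun n => ‖e‖ * θ ^ n * W x ρ) (‖e‖ * (1 - θ)⁻¹ * W x ρ) :=
        ((hasSum_geometric_of_lt_one hG.θ_nonneg hG.θ_lt).mul_left _).mul_right _
      exact tsum_of_norm_bounded h4 (hbd x hx ρ hρ)
  refine ⟨_, hreg, fun x hx ρ hρ => ?_⟩
  have hsm : ∀ y ∈ S, Summable fun n => iter S G e n y ρ := fun y hy =>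
    Summable.of_norm_bounded (hsum.mul_right (W y ρ)) (hbd y hy ρ hρ)
  have h5 : ∀ n, ∫ s in S, ‖G x s ρ (iter S G e n s ρ)‖ ≤ ‖e‖ * θ ^ n * (θ * W x ρ) := fun n => by
    calc ∫ s in S, ‖G x s ρ (iter S G e n s ρ)‖
        ≤ ∫ s in S, ‖e‖ * θ ^ n * (‖G x s ρ‖ * W s ρ) := by
          refine integral_mono_ae (hG.integrand_integrable (hG.iter_regular e n) hx hρ).norm
            ((hG.dom_integrable hx hρ).const_mul _) ?_
          filter_upwards [ae_restrict_mem hG.measS] with s hs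
          exact norm_integrand_le (hG.iter_regular e n) hs hρ
      _ = ‖e‖ * θ ^ n * ∫ s in S, ‖G x s ρ‖ * W s ρ := integral_const_mul _ _
      _ ≤ _ := mul_le_mul_of_nonneg_left (hG.contract x hx ρ hρ) (hnn n)
  have h6 := hasSum_integral_of_summable_integral_norm (μ := volume.restrict S)
    (F := fun n s => G x s ρ (iter S G e n s ρ))
    (fun n => hG.integrand_integrable (hG.iter_regular e n) hx hρ)
    (Summable.of_nonneg_of_le (fun n => integral_nonneg fun s => norm_nonneg _) h5
      (hsum.mul_right _))
  have h7 : ∫ s in S, G x s ρ (∑' n, iter S G e n s ρ)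
      = ∫ s in S, ∑' n, G x s ρ (iter S G e n s ρ) := by
    refine setIntegral_congr_fun hG.measS fun s hs => ?_
    exact (G x s ρ).map_tsum (hsm s hs)
  rw [(hsm x hx).tsum_eq_zero_add, h7, ← h6.tsum_eq]
  rfl

end IsNeumannKernel

end Kernel

/-! ### Linear Cauchy problems with integrable coefficients -/

section Volterra

theorem setIntegral_Ici_indicator_Iio {E : Type*} [NormedAddCommGroup E] [NormedSpace ℝ E]
    (F : ℝ → E) {a x : ℝ} (hx : a ≤ x) :
    ∫ s in Ici a, (Iio x).indicator F s = ∫ s in a..x, F s := by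
  rw [setIntegral_indicator measurableSet_Iio, Ici_inter_Iio, integral_Ico_eq_integral_Ioo,
    ← integral_Ioc_eq_integral_Ioo, intervalIntegral.integral_of_le hx]

/-- The integrand is half the derivative of the exponential, so the integral is half its increment.
This gives the contraction factor 1/2 below. -/
theorem integral_mul_exp_primitive {g : ℝ → ℝ}
    (hg : ∀ b, IntegrableOn g (Icc 0 b) volume) (κ : ℝ) {x : ℝ} (hx : 0 ≤ x) :
    IntegrableOn (fun s => κ * g s * Real.exp (2 * κ * ∫ t in (0 : ℝ)..s, g t)) (Icc 0 x) volume ∧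
    ∫ s in (0 : ℝ)..x, κ * g s * Real.exp (2 * κ * ∫ t in (0 : ℝ)..s, g t) ≤
      1 / 2 * Real.exp (2 * κ * ∫ t in (0 : ℝ)..x, g t) := by
  have h1 : HasACDeriv 0 (fun x => ∫ t in (0 : ℝ)..x, g t) g := HasACDeriv.primitive hg
  have h2 := (h1.const_smul (2 * κ)).exp
  simp only [smul_eq_mul] at h2
  have hint : ∀ b, IntegrableOn
      (fun s => κ * g s * Real.exp (2 * κ * ∫ t in (0 : ℝ)..s, g t)) (Icc 0 b) volume := by
    intro b
    have hc : ContinuousOn (fun s => Real.exp (2 * κ * ∫ t in (0 : ℝ)..s, g t)) (Icc 0 b) :=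
      h2.continuousOn.mono Icc_subset_Ici_self
    exact IntegrableOn.mul_continuousOn ((hg b).const_mul κ) hc isCompact_Icc
  refine ⟨hint x, ?_⟩
  have h3 := h2.sub_eq_integral (fun b => by
    refine ((hint b).const_mul 2).congr (Eventually.of_forall fun s => ?_)
    simp only; ring) x hx
  have h4 : ∫ s in (0 : ℝ)..x, κ * g s * Real.exp (2 * κ * ∫ t in (0 : ℝ)..s, g t) =
      1 / 2 * ∫ s in (0 : ℝ)..x, Real.exp (2 * κ * ∫ t in (0 : ℝ)..s, g t) * (2 * κ * g s) := by
    rw [← intervalIntegral.integral_const_mul]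
    congr 1; ext s; ring
  rw [h4, ← h3]
  have : 0 < Real.exp (2 * κ * ∫ t in (0 : ℝ)..0, g t) := Real.exp_pos _
  linarith

variable {E : Type*} [NormedAddCommGroup E] [NormedSpace ℂ E]

/-- A family of operator coefficients, entire in the parameter and locally integrable. -/
structure IsVolterraCoeff (L : ℝ → ℂ → E) (g : ℝ → ℝ) (c : ℂ → ℝ) : Prop where
  g_nonneg : ∀ s, 0 ≤ g s
  g_int : ∀ b, IntegrableOn g (Icc 0 b) volume
  c_nonneg : ∀ ρ, 0 ≤ c ρ
  c_cont : Continuous c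
  bound : ∀ s ρ, 0 ≤ s → ‖L s ρ‖ ≤ c ρ * g s
  meas : ∀ ρ, AEStronglyMeasurable (fun s => L s ρ) (volume.restrict (Ici 0))
  diff : ∀ s, Differentiable ℂ (L s)

namespace IsVolterraCoeff

variable {g : ℝ → ℝ} {c : ℂ → ℝ}

theorem comp_clm {E' : Type*} [NormedAddCommGroup E'] [NormedSpace ℂ E'] {L : ℝ → ℂ → E}
    (h : IsVolterraCoeff L g c) (B : E →L[ℂ] E') :
    IsVolterraCoeff (fun s ρ => B (L s ρ)) g (fun ρ => ‖B‖ * c ρ) where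
  g_nonneg := h.g_nonneg
  g_int := h.g_int
  c_nonneg ρ := mul_nonneg (norm_nonneg _) (h.c_nonneg ρ)
  c_cont := continuous_const.mul h.c_cont
  bound s ρ hs := (B.le_opNorm _).trans (by
    rw [mul_assoc]; exact mul_le_mul_of_nonneg_left (h.bound s ρ hs) (norm_nonneg _))
  meas ρ := B.continuous.comp_aestronglyMeasurable (h.meas ρ)
  diff s := B.differentiable.comp (h.diff s)

variable {L : ℝ → ℂ → (E →L[ℂ] E)}

/-- The exponential weight makes a Volterra operator a contraction for every ρ, without any
smallness. Hence the parameter domain is the whole plane and solutions are entire in ρ. -/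
theorem isNeumannKernel (h : IsVolterraCoeff L g c) :
    IsNeumannKernel (Ici 0) univ univ (1 / 2)
      (fun x ρ => Real.exp (2 * c ρ * ∫ t in (0 : ℝ)..x, g t))
      (fun x s ρ => (Iio x).indicator (fun s => L s ρ) s) := by
  have hφ : HasACDeriv 0 (fun x => ∫ t in (0 : ℝ)..x, g t) g := HasACDeriv.primitive h.g_int
  have hii : ∀ x, 0 ≤ x → IntervalIntegrable g volume 0 x := fun x hx =>
    (intervalIntegrable_iff_integrableOn_Icc_of_le hx).2 (h.g_int x)
  have hφ0 : ∀ x, 0 ≤ x → 0 ≤ ∫ t in (0 : ℝ)..x, g t := fun x hx =>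
    intervalIntegral.integral_nonneg hx fun s _ => h.g_nonneg s
  have hφm : ∀ x y, 0 ≤ x → x ≤ y → ∫ t in (0 : ℝ)..x, g t ≤ ∫ t in (0 : ℝ)..y, g t :=
    fun x y hx hxy => intervalIntegral.integral_mono_interval le_rfl hx hxy
      (Eventually.of_forall fun s => h.g_nonneg s) (hii y (hx.trans hxy))
  refine ⟨measurableSet_Ici, isOpen_univ, Subset.rfl, by norm_num, by norm_num, ?_, ?_, ?_, ?_, ?_,
    ?_, ?_⟩
  · intro x hx ρ _
    exact Real.one_le_exp (mul_nonneg (mul_nonneg zero_le_two (h.c_nonneg ρ)) (hφ0 x hx))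
  · refine Real.continuous_exp.comp_continuousOn ?_
    refine ContinuousOn.mul ?_ ?_
    · exact ((continuous_const.mul h.c_cont).comp continuous_snd).continuousOn
    · exact hφ.continuousOn.comp continuousOn_fst fun p hp => hp.1
  · intro x _ ρ _
    exact (h.meas ρ).indicator measurableSet_Iio
  · rintro ⟨x₀, ρ₀⟩ ⟨hx₀, -⟩
    have hx₀ : 0 ≤ x₀ := hx₀
    refine ⟨(Iio (x₀ + 1)).indicator
      (fun s => (c ρ₀ + 1) * g s * Real.exp (2 * (c ρ₀ + 1) * ∫ t in (0 : ℝ)..(x₀ + 1), g t)),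
      ?_, ?_⟩
    · rw [IntegrableOn, integrable_indicator_iff measurableSet_Iio, IntegrableOn,
        Measure.restrict_restrict measurableSet_Iio]
      refine ((((h.g_int (x₀ + 1)).mono_set ?_).const_mul (c ρ₀ + 1)).mul_const _)
      exact fun s hs => ⟨hs.2, le_of_lt hs.1⟩
    · have h1 : ∀ᶠ q : ℝ × ℂ in 𝓝 (x₀, ρ₀), q.1 < x₀ + 1 ∧ c q.2 < c ρ₀ + 1 :=
        (continuous_fst.tendsto (x₀, ρ₀) |>.eventually (Iio_mem_nhds (lt_add_one x₀))).and
        ((h.c_cont.comp continuous_snd).tendsto (x₀, ρ₀) |>.eventually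
          (Iio_mem_nhds (lt_add_one (c ρ₀))))
      -- Enlarging x₀ and `c ρ₀` by one leaves room for all nearby parameters, so a single function
      -- dominates.
      filter_upwards [mem_nhdsWithin_of_mem_nhds h1, self_mem_nhdsWithin] with q hq hq0 s hs
      have hs : 0 ≤ s := hs
      by_cases hsq : s < q.1
      · have hsx : s < x₀ + 1 := hsq.trans hq.1
        rw [indicator_of_mem (by exact hsq), indicator_of_mem (by exact hsx)]
        have h2 := h.bound s q.2 hs
        have h3 := h.c_nonneg ρ₀
        have h4 := h.g_nonneg s
        have h5 := hφm s (x₀ + 1) hs hsx.le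
        have h6 := hφ0 s hs
        refine mul_le_mul (h2.trans ?_) (Real.exp_le_exp.2 ?_) (Real.exp_pos _).le (by positivity)
        · exact mul_le_mul_of_nonneg_right hq.2.le h4
        · have := hq.2.le
          gcongr
      · rw [indicator_of_notMem (by exact hsq), norm_zero, zero_mul]
        refine indicator_nonneg (fun s _ => ?_) s
        have h3 := h.c_nonneg ρ₀
        have h4 := h.g_nonneg s
        positivity
  · intro x hx ρ _
    have hx : 0 ≤ x := hx
    obtain ⟨h1, h2⟩ := integral_mul_exp_primitive h.g_int (c ρ) hx
    have h3 : ∀ s, ‖(Iio x).indicator (fun s => L s ρ) s‖ *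
        Real.exp (2 * c ρ * ∫ t in (0 : ℝ)..s, g t) =
        (Iio x).indicator
          (fun s => ‖L s ρ‖ * Real.exp (2 * c ρ * ∫ t in (0 : ℝ)..s, g t)) s := fun s => by
      by_cases hs : s ∈ Iio x
      · rw [indicator_of_mem hs, indicator_of_mem hs]
      · rw [indicator_of_notMem hs, indicator_of_notMem hs, norm_zero, zero_mul]
    simp_rw [h3]
    rw [setIntegral_Ici_indicator_Iio _ hx]
    refine le_trans ?_ h2
    have h1' := (intervalIntegrable_iff_integrableOn_Icc_of_le hx).2 h1
    have hle : ∀ s ∈ Icc 0 x, ‖L s ρ‖ * Real.exp (2 * c ρ * ∫ t in (0 : ℝ)..s, g t) ≤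
        c ρ * g s * Real.exp (2 * c ρ * ∫ t in (0 : ℝ)..s, g t) := fun s hs =>
      mul_le_mul_of_nonneg_right (h.bound s ρ hs.1) (Real.exp_pos _).le
    refine intervalIntegral.integral_mono_on hx ?_ h1' hle
    rw [intervalIntegrable_iff_integrableOn_Icc_of_le hx]
    refine h1.mono' (AEStronglyMeasurable.mul ?_ ?_) ?_
    · exact ((h.meas ρ).mono_measure (Measure.restrict_mono Icc_subset_Ici_self le_rfl)).norm
    · refine ContinuousOn.aestronglyMeasurable ?_ measurableSet_Icc
      exact Real.continuous_exp.comp_continuousOn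
        (continuousOn_const.mul (hφ.continuousOn.mono Icc_subset_Ici_self))
    · filter_upwards [ae_restrict_mem measurableSet_Icc] with s hs
      rw [Real.norm_eq_abs, abs_of_nonneg (by positivity)]
      exact hle s hs
  · rintro ⟨x, ρ⟩ ⟨hx, -⟩ s hs hsx
    have hsx : s ≠ x := hsx
    have hL : ContinuousWithinAt (fun q : ℝ × ℂ => L s q.2) (Ici 0 ×ˢ univ) (x, ρ) :=
      ((h.diff s).continuous.comp continuous_snd).continuousWithinAt
    rcases lt_or_gt_of_ne hsx with hlt | hgt
    · refine hL.congr_of_eventuallyEq ?_ (indicator_of_mem (by exact hlt) _)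
      have : ∀ᶠ q : ℝ × ℂ in 𝓝 (x, ρ), s < q.1 :=
        continuous_fst.tendsto (x, ρ) |>.eventually (Ioi_mem_nhds hlt)
      filter_upwards [mem_nhdsWithin_of_mem_nhds this] with q hq
      exact indicator_of_mem (by exact hq) _
    · refine (continuousWithinAt_const (b := (0 : E →L[ℂ] E))).congr_of_eventuallyEq ?_
        (indicator_of_notMem (by exact not_lt.2 hgt.le) _)
      have : ∀ᶠ q : ℝ × ℂ in 𝓝 (x, ρ), q.1 < s :=
        continuous_fst.tendsto (x, ρ) |>.eventually (Iio_mem_nhds hgt)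
      filter_upwards [mem_nhdsWithin_of_mem_nhds this] with q hq
      exact indicator_of_notMem (by exact not_lt.2 (le_of_lt hq)) _
  · intro x _ s _
    by_cases hs : s ∈ Iio x
    · simp only [indicator_of_mem hs]
      exact (h.diff s).differentiableOn
    · simp only [indicator_of_notMem hs]
      exact differentiableOn_const _

theorem exists_solution [CompleteSpace E] (h : IsVolterraCoeff L g c) (e : E) :
    ∃ z : ℝ → ℂ → E, ContinuousOn (fun p : ℝ × ℂ => z p.1 p.2) (Ici 0 ×ˢ univ) ∧
      (∀ x, 0 ≤ x → Differentiable ℂ (z x)) ∧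
      (∀ x, 0 ≤ x → ∀ ρ, ‖z x ρ‖ ≤ 2 * ‖e‖ * Real.exp (2 * c ρ * ∫ t in (0 : ℝ)..x, g t)) ∧
      (∀ ρ, z 0 ρ = e) ∧
      ∀ ρ, HasACDeriv 0 (fun x => z x ρ) (fun x => L x ρ (z x ρ)) := by
  obtain ⟨z, hz, heq⟩ := h.isNeumannKernel.exists_solution e
  have heq' : ∀ x, 0 ≤ x → ∀ ρ, z x ρ = e + ∫ s in (0 : ℝ)..x, L s ρ (z s ρ) := by
    intro x hx ρ
    rw [heq x hx ρ (mem_univ _), ← setIntegral_Ici_indicator_Iio _ hx]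
    congr 2; ext s
    by_cases hs : s ∈ Iio x
    · rw [indicator_of_mem hs, indicator_of_mem hs]
    · rw [indicator_of_notMem hs, indicator_of_notMem hs, _root_.zero_apply]
  have hint : ∀ ρ b, IntegrableOn (fun s => L s ρ (z s ρ)) (Icc 0 b) volume := by
    intro ρ b
    have hzc : ContinuousOn (fun s => z s ρ) (Icc 0 b) :=
      hz.cont.comp (f := fun s : ℝ => (s, ρ)) (by fun_prop) fun s hs => ⟨hs.1, mem_univ _⟩
    obtain ⟨C, hC⟩ := isCompact_Icc.exists_bound_of_continuousOn hzc
    refine ((h.g_int b).const_mul (c ρ * C)).mono' ?_ ?_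
    · exact (isBoundedBilinearMap_apply (𝕜 := ℂ)).continuous.comp_aestronglyMeasurable
        (((h.meas ρ).mono_measure (Measure.restrict_mono Icc_subset_Ici_self le_rfl)).prodMk
          (hzc.aestronglyMeasurable measurableSet_Icc))
    · filter_upwards [ae_restrict_mem measurableSet_Icc] with s hs
      calc ‖L s ρ (z s ρ)‖ ≤ ‖L s ρ‖ * ‖z s ρ‖ := ContinuousLinearMap.le_opNorm _ _
        _ ≤ (c ρ * g s) * C := mul_le_mul (h.bound s ρ hs.1) (hC s hs) (norm_nonneg _)
            (mul_nonneg (h.c_nonneg ρ) (h.g_nonneg s))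
        _ = c ρ * C * g s := by ring
  refine ⟨z, hz.cont, fun x hx => differentiableOn_univ.1 (hz.diff x hx), fun x hx ρ => ?_,
    fun ρ => ?_, fun ρ => ?_⟩
  · have := hz.bound x hx ρ (mem_univ _)
    norm_num at this
    rw [mul_comm 2 ‖e‖]; exact this
  · simpa using heq' 0 le_rfl ρ
  · refine (((HasACDeriv.const e).add (HasACDeriv.primitive (hint ρ))).congr
      fun x hx => heq' x hx ρ).congr_deriv fun x _ => zero_add _

end IsVolterraCoeff

variable {R : Type*} [NormedRing R] [NormedAlgebra ℂ R]

/-- A fundamental solution `Φ` of `Φ' = M Φ` together with its inverse `Ψ`. -/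
structure IsFundamentalPair (M Φ Ψ : ℝ → ℂ → R) : Prop where
  cont : ContinuousOn (fun p : ℝ × ℂ => Φ p.1 p.2) (Ici 0 ×ˢ univ)
  cont' : ContinuousOn (fun p : ℝ × ℂ => Ψ p.1 p.2) (Ici 0 ×ˢ univ)
  diff : ∀ x, 0 ≤ x → Differentiable ℂ (Φ x)
  diff' : ∀ x, 0 ≤ x → Differentiable ℂ (Ψ x)
  deriv : ∀ ρ, HasACDeriv 0 (fun x => Φ x ρ) (fun x => M x ρ * Φ x ρ)
  deriv' : ∀ ρ, HasACDeriv 0 (fun x => Ψ x ρ) (fun x => -(Ψ x ρ * M x ρ))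
  init : ∀ ρ, Φ 0 ρ = 1
  inv_mul : ∀ x, 0 ≤ x → ∀ ρ, Ψ x ρ * Φ x ρ = 1

/-- Φ and Ψ are solved for independently, by left and right multiplication; ΨΦ has zero derivative
and initial value 1. This gives a one-sided inverse only, and the other side is supplied where the
ring allows it. -/
theorem IsVolterraCoeff.exists_fundamentalPair [CompleteSpace R] {M : ℝ → ℂ → R} {g : ℝ → ℝ}
    {c : ℂ → ℝ} (h : IsVolterraCoeff M g c) :
    ∃ Φ Ψ : ℝ → ℂ → R, IsFundamentalPair M Φ Ψ ∧ ∃ C : ℂ → ℝ, ∀ x, 0 ≤ x → ∀ ρ,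
      ‖Φ x ρ‖ ≤ 2 * ‖(1 : R)‖ * Real.exp (C ρ * ∫ t in (0 : ℝ)..x, g t) ∧
      ‖Ψ x ρ‖ ≤ 2 * ‖(1 : R)‖ * Real.exp (C ρ * ∫ t in (0 : ℝ)..x, g t) := by
  have hL := h.comp_clm (ContinuousLinearMap.mul ℂ R)
  have hR := h.comp_clm (-(ContinuousLinearMap.mul ℂ R).flip)
  obtain ⟨Φ, h1, h2, h3, h4, h6⟩ := hL.exists_solution 1
  obtain ⟨Ψ, k1, k2, k3, k4, k6⟩ := hR.exists_solution 1
  have h6' : ∀ ρ, HasACDeriv 0 (fun x => Φ x ρ) (fun x => M x ρ * Φ x ρ) := h6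
  have k6' : ∀ ρ, HasACDeriv 0 (fun x => Ψ x ρ) (fun x => -(Ψ x ρ * M x ρ)) := k6
  refine ⟨Φ, Ψ, ⟨h1, k1, h2, k2, h6', k6', h4, fun x hx ρ => ?_⟩,
    fun ρ => 2 * (max (‖ContinuousLinearMap.mul ℂ R‖ * c ρ)
      (‖-(ContinuousLinearMap.mul ℂ R).flip‖ * c ρ)), fun x hx ρ => ?_⟩
  · have := ((k6' ρ).mul (h6' ρ)).eq_of_deriv_zero (fun x _ => by noncomm_ring) x hx
    rw [this, h4, k4, one_mul]
  · have h0 : 0 ≤ ∫ t in (0 : ℝ)..x, g t :=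
      intervalIntegral.integral_nonneg hx fun s _ => h.g_nonneg s
    constructor
    · refine (h3 x hx ρ).trans ?_
      gcongr
      exact mul_le_mul_of_nonneg_left (le_max_left _ _) zero_le_two
    · refine (k3 x hx ρ).trans ?_
      gcongr
      exact mul_le_mul_of_nonneg_left (le_max_right _ _) zero_le_two

end Volterra

/-! ### Continuous derivatives up to the endpoint, and tail integrals -/

namespace HasACDeriv

variable {E : Type*} [NormedAddCommGroup E] [NormedSpace ℝ E] {a : ℝ}
  {F f : ℝ → E}

theorem hasDerivWithinAt [CompleteSpace E] (h : HasACDeriv a F f) (hf : ContinuousOn f (Ici a))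
    {x : ℝ}
    (hx : a ≤ x) : HasDerivWithinAt F (f x) (Ici a) x := by
  -- Freezing f to the left of a makes the fundamental theorem of calculus available at the endpoint
  -- itself.
  let φ : ℝ → E := fun t => f (max a t)
  have hφ : Continuous φ :=
    hf.comp_continuous (continuous_const.max continuous_id) fun t => le_max_left a t
  have hφf : ∀ t, a ≤ t → φ t = f t := fun t ht => by simp only [φ, max_eq_right ht]
  have h1 : HasDerivAt (fun x => F a + ∫ t in a..x, φ t) (φ x) x :=
    ((hφ.integral_hasStrictDerivAt a x).hasDerivAt).const_add _
  rw [hφf x hx] at h1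
  refine h1.hasDerivWithinAt.congr_of_mem (fun y hy => ?_) hx
  have hy : a ≤ y := hy
  have h2 := h.sub_eq_integral (fun b => (hf.mono Icc_subset_Ici_self).integrableOn_Icc) y hy
  have h3 : ∫ t in a..y, f t = ∫ t in a..y, φ t :=
    intervalIntegral.integral_congr fun t ht => by
      rw [uIcc_of_le hy] at ht; exact (hφf t ht.1).symm
  rw [← h3, ← h2]; abel

theorem of_hasDerivWithinAt [CompleteSpace E] (hf : ContinuousOn f (Ici a))
    (h : ∀ x, a ≤ x → HasDerivWithinAt F (f x) (Ici a) x) : HasACDeriv a F f := by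
  have h1 : HasACDeriv a (fun x => F a + ∫ t in a..x, f t) f :=
    ((const (F a)).add (primitive fun b =>
      (hf.mono Icc_subset_Ici_self).integrableOn_Icc)).congr_deriv fun x _ => zero_add _
  refine h1.congr fun x hx => ?_
  rw [intervalIntegral.integral_eq_sub_of_hasDeriv_right_of_le hx
    (fun y hy => ((h y hy.1).continuousWithinAt).mono Icc_subset_Ici_self)
    (fun y hy => (h y hy.1.le).mono (fun t ht => hy.1.le.trans (le_of_lt ht)))
    ((intervalIntegrable_iff_integrableOn_Icc_of_le hx).2
      (hf.mono Icc_subset_Ici_self).integrableOn_Icc)]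
  abel

theorem integral_Ioi_eq {h : ℝ → E} (hh : IntegrableOn h (Ici a) volume) {x : ℝ} (hx : a ≤ x) :
    ∫ s in Ioi x, h s = (∫ s in Ioi a, h s) - ∫ s in a..x, h s := by
  have := intervalIntegral.integral_interval_add_Ioi (hh.mono_set Ioi_subset_Ici_self)
    (hh.mono_set (Ioi_subset_Ici hx))
  rw [← this]; abel

theorem tail [CompleteSpace E] {h : ℝ → E} (hh : IntegrableOn h (Ici a) volume) :
    HasACDeriv a (fun x => ∫ s in Ioi x, h s) (fun x => -h x) :=
  (((const (∫ s in Ioi a, h s)).sub (primitive fun _ => hh.mono_set Icc_subset_Ici_self)).congr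
    fun _ hx => integral_Ioi_eq hh hx).congr_deriv fun _ _ => zero_sub _

end HasACDeriv

section Tail

variable {E : Type*} [NormedAddCommGroup E] [NormedSpace ℝ E] {a : ℝ}

theorem tendsto_integral_Ioi_zero {h : ℝ → E} (hh : IntegrableOn h (Ici a) volume) :
    Tendsto (fun x => ∫ s in Ioi x, h s) atTop (𝓝 0) := by
  have h1 := intervalIntegral_tendsto_integral_Ioi a (hh.mono_set Ioi_subset_Ici_self) tendsto_id
  have h2 := (tendsto_const_nhds (x := ∫ s in Ioi a, h s)).sub h1
  rw [sub_self] at h2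
  refine h2.congr' ?_
  filter_upwards [eventually_ge_atTop a] with x hx
  exact (HasACDeriv.integral_Ioi_eq hh hx).symm

end Tail

section BoundedMul

variable {R : Type*} [NormedRing R] {a C : ℝ} {p h : ℝ → R}

theorem integrableOn_bdd_mul (hp : ContinuousOn p (Ici a)) (hC : ∀ x, a ≤ x → ‖p x‖ ≤ C)
    (hh : IntegrableOn h (Ici a) volume) : IntegrableOn (fun x => p x * h x) (Ici a) volume := by
  refine (hh.norm.const_mul C).mono'
    ((hp.aestronglyMeasurable measurableSet_Ici).mul hh.aestronglyMeasurable) ?_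
  filter_upwards [ae_restrict_mem measurableSet_Ici] with x hx
  exact (norm_mul_le _ _).trans (mul_le_mul_of_nonneg_right (hC x hx) (norm_nonneg _))

theorem integrableOn_mul_bdd (hp : ContinuousOn p (Ici a)) (hC : ∀ x, a ≤ x → ‖p x‖ ≤ C)
    (hh : IntegrableOn h (Ici a) volume) : IntegrableOn (fun x => h x * p x) (Ici a) volume := by
  refine (hh.norm.mul_const C).mono'
    (hh.aestronglyMeasurable.mul (hp.aestronglyMeasurable measurableSet_Ici)) ?_
  filter_upwards [ae_restrict_mem measurableSet_Ici] with x hx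
  exact (norm_mul_le _ _).trans (mul_le_mul_of_nonneg_left (hC x hx) (norm_nonneg _))

end BoundedMul

/-! ### The Cauchy problems for P and T -/

section Propagator

variable {R : Type*} [NormedRing R] [NormedAlgebra ℂ R]

/-- `p` solves `p' = q p`, `p 0 = 1`, on the half-line, with inverse `pinv`; both are bounded by
`C`. -/
structure IsPropagator (C : ℝ) (q p pinv : ℝ → R) : Prop where
  deriv : HasACDeriv 0 p (fun x => q x * p x)
  deriv_inv : HasACDeriv 0 pinv (fun x => -(pinv x * q x))
  init : p 0 = 1
  inv_mul : ∀ x, 0 ≤ x → pinv x * p x = 1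
  mul_inv : ∀ x, 0 ≤ x → p x * pinv x = 1
  bound : ∀ x, 0 ≤ x → ‖p x‖ ≤ C
  bound_inv : ∀ x, 0 ≤ x → ‖pinv x‖ ≤ C

theorem IsPropagator.mono {C D : ℝ} {q p pinv : ℝ → R} (h : IsPropagator C q p pinv) (hCD : C ≤ D) :
    IsPropagator D q p pinv :=
  ⟨h.deriv, h.deriv_inv, h.init, h.inv_mul, h.mul_inv, fun x hx => (h.bound x hx).trans hCD,
    fun x hx => (h.bound_inv x hx).trans hCD⟩

/-- Since q is integrable on the whole half-line, the exponential bounds for the solution and its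
inverse are uniform in x. Dedekind finiteness makes the inverse two-sided. -/
theorem exists_propagator [CompleteSpace R] [IsDedekindFiniteMonoid R] {q : ℝ → R}
    (hq : IntegrableOn q (Ici 0) volume) : ∃ C p pinv, IsPropagator C q p pinv := by
  -- The parameter is a dummy: the coefficient does not depend on it, and 0 is substituted at the
  -- end.
  have hV : IsVolterraCoeff (fun s (_ : ℂ) => q s) (fun s => ‖q s‖) (fun _ => 1) :=
    ⟨fun _ => norm_nonneg _, fun b => (hq.mono_set Icc_subset_Ici_self).norm,
      fun _ => zero_le_one, continuous_const, fun s _ _ => (one_mul ‖q s‖).ge,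
      fun _ => hq.aestronglyMeasurable, fun _ => differentiable_const _⟩
  obtain ⟨Φ, Ψ, h, D, hD⟩ := hV.exists_fundamentalPair
  have hle : ∀ x, 0 ≤ x → 2 * ‖(1 : R)‖ * Real.exp (D 0 * ∫ t in (0 : ℝ)..x, ‖q t‖) ≤
      2 * ‖(1 : R)‖ * Real.exp (|D 0| * ∫ t in Ioi (0 : ℝ), ‖q t‖) := by
    intro x hx
    have h1 : ∫ t in (0 : ℝ)..x, ‖q t‖ ≤ ∫ t in Ioi (0 : ℝ), ‖q t‖ := by
      rw [intervalIntegral.integral_of_le hx]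
      exact setIntegral_mono_set (hq.mono_set Ioi_subset_Ici_self).norm
        (Eventually.of_forall fun _ => norm_nonneg _) (Eventually.of_forall Ioc_subset_Ioi_self)
    have h2 : 0 ≤ ∫ t in (0 : ℝ)..x, ‖q t‖ :=
      intervalIntegral.integral_nonneg hx fun _ _ => norm_nonneg _
    refine mul_le_mul_of_nonneg_left (Real.exp_le_exp.2 ?_) (by positivity)
    exact mul_le_mul (le_abs_self _) h1 h2 (abs_nonneg _)
  exact ⟨_, fun x => Φ x 0, fun x => Ψ x 0, h.deriv 0, h.deriv' 0, h.init 0,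
    fun x hx => h.inv_mul x hx 0, fun x hx => mul_eq_one_symm (h.inv_mul x hx 0),
    fun x hx => (hD x hx 0).1.trans (hle x hx), fun x hx => (hD x hx 0).2.trans (hle x hx)⟩

namespace IsPropagator

variable {C : ℝ} {q p pinv : ℝ → R}

theorem unique (h : IsPropagator C q p pinv) {y : ℝ → R}
    (hy : HasACDeriv 0 y (fun x => q x * y x)) (hy0 : y 0 = 1) {x : ℝ} (hx : 0 ≤ x) :
    y x = p x := by
  have h1 := (h.deriv_inv.mul hy).eq_of_deriv_zero (fun x _ => by noncomm_ring) x hx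
  have h2 := h.inv_mul 0 le_rfl
  rw [h.init, mul_one] at h2
  rw [hy0, h2, one_mul] at h1
  calc y x = p x * (pinv x * y x) := by rw [← mul_assoc, h.mul_inv x hx, one_mul]
    _ = p x := by rw [h1, mul_one]

/-- The solution of `T' = q T + w p` vanishing at infinity. -/
def correction (p pinv w : ℝ → R) (x : ℝ) : R :=
  -(p x * ∫ s in Ioi x, pinv s * w s * p s)

variable {w : ℝ → R}

theorem integrable_conj (h : IsPropagator C q p pinv) (hw : IntegrableOn w (Ici 0) volume) :
    IntegrableOn (fun s => pinv s * w s * p s) (Ici 0) volume :=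
  integrableOn_mul_bdd h.deriv.continuousOn h.bound
    (integrableOn_bdd_mul h.deriv_inv.continuousOn h.bound_inv hw)

/-- Variation of constants: differentiating the tail integral produces `p * pinv * w * p`, which
collapses to `w * p`. -/
theorem correction_deriv [CompleteSpace R] (h : IsPropagator C q p pinv)
    (hw : IntegrableOn w (Ici 0) volume) :
    HasACDeriv 0 (correction p pinv w) (fun x => q x * correction p pinv w x + w x * p x) := by
  refine (h.deriv.mul (HasACDeriv.tail (h.integrable_conj hw))).neg.congr_deriv fun x hx => ?_
  have h1 : p x * (pinv x * w x * p x) = w x * p x := by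
    rw [← mul_assoc, ← mul_assoc, h.mul_inv x hx.le, one_mul]
  simp only [correction, mul_neg, h1]
  noncomm_ring

theorem correction_tendsto [CompleteSpace R] (h : IsPropagator C q p pinv)
    (hw : IntegrableOn w (Ici 0) volume) :
    Tendsto (correction p pinv w) atTop (𝓝 0) := by
  have h1 := (tendsto_integral_Ioi_zero (h.integrable_conj hw)).norm.const_mul C
  rw [norm_zero, mul_zero] at h1
  refine squeeze_zero_norm' ?_ h1
  filter_upwards [eventually_ge_atTop 0] with x hx
  rw [correction, norm_neg]
  exact (norm_mul_le _ _).trans (mul_le_mul_of_nonneg_right (h.bound x hx) (norm_nonneg _))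

theorem correction_bound (h : IsPropagator C q p pinv) (hw : IntegrableOn w (Ici 0) volume) :
    ∃ D, ∀ x, 0 ≤ x → ‖correction p pinv w x‖ ≤ D := by
  have hC : 0 ≤ C := (norm_nonneg _).trans (h.bound 0 le_rfl)
  refine ⟨C * ∫ s in Ioi (0 : ℝ), ‖pinv s * w s * p s‖, fun x hx => ?_⟩
  rw [correction, norm_neg]
  refine (norm_mul_le _ _).trans (mul_le_mul (h.bound x hx) ?_ (norm_nonneg _) hC)
  refine (norm_integral_le_integral_norm _).trans ?_
  exact setIntegral_mono_set ((h.integrable_conj hw).mono_set Ioi_subset_Ici_self).norm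
    (Eventually.of_forall fun _ => norm_nonneg _) (Eventually.of_forall (Ioi_subset_Ioi hx))

/-- `pinv` times the difference of two solutions is constant; it also tends to zero because `pinv`
is bounded. -/
theorem correction_unique [CompleteSpace R] (h : IsPropagator C q p pinv)
    (hw : IntegrableOn w (Ici 0) volume)
    {y : ℝ → R} (hy : HasACDeriv 0 y (fun x => q x * y x + w x * p x))
    (hlim : Tendsto y atTop (𝓝 0)) {x : ℝ} (hx : 0 ≤ x) : y x = correction p pinv w x := by
  have h0 := hy.sub (h.correction_deriv hw)
  have h1 := (h.deriv_inv.mul h0).eq_of_deriv_zero (fun x _ => by noncomm_ring)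
  have h2 : Tendsto (fun x => pinv x * (y x - correction p pinv w x)) atTop (𝓝 0) := by
    have h3 := (hlim.sub (h.correction_tendsto hw)).norm.const_mul C
    rw [sub_zero, norm_zero, mul_zero] at h3
    refine squeeze_zero_norm' ?_ h3
    filter_upwards [eventually_ge_atTop 0] with x hx
    exact (norm_mul_le _ _).trans (mul_le_mul_of_nonneg_right (h.bound_inv x hx) (norm_nonneg _))
  have h4 : pinv 0 * (y 0 - correction p pinv w 0) = 0 := by
    refine tendsto_nhds_unique (tendsto_const_nhds.congr' ?_) h2
    filter_upwards [eventually_ge_atTop 0] with x hx using (h1 x hx).symm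
  have h5 := h1 x hx
  rw [h4] at h5
  calc y x = p x * (pinv x * (y x - correction p pinv w x)) + correction p pinv w x := by
        rw [← mul_assoc, h.mul_inv x hx, one_mul, sub_add_cancel]
    _ = correction p pinv w x := by rw [h5, mul_zero, zero_add]

end IsPropagator

end Propagator

/-! ### Exponential kernels in the upper half-plane and the Riemann–Lebesgue lemma -/

section ScalarKernel

/-- `c e^{2iρωε(s-x)}` for `ε(s-x) > 0`, and zero otherwise. -/
def expKernel (ε ω : ℝ) (c : ℂ) (x s : ℝ) (ρ : ℂ) : ℂ :=
  if 0 < ε * (s - x) then c * Complex.exp (2 * Complex.I * ρ * (ω * (ε * (s - x)) : ℝ)) else 0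

/-- Scalar kernels bounded by one on the closed upper half-plane. -/
structure IsScalarKernel (k : ℝ → ℝ → ℂ → ℂ) : Prop where
  norm_le : ∀ x s ρ, 0 ≤ ρ.im → ‖k x s ρ‖ ≤ 1
  meas : ∀ x ρ, Measurable (fun s => k x s ρ)
  cont : ∀ x s ρ, s ≠ x → ContinuousAt (fun p : ℝ × ℂ => k p.1 s p.2) (x, ρ)
  diff : ∀ x s, Differentiable ℂ (k x s)

theorem norm_exp_two_I_mul (ρ : ℂ) (t : ℝ) :
    ‖Complex.exp (2 * Complex.I * ρ * (t : ℝ))‖ = Real.exp (-(2 * ρ.im * t)) := by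
  rw [Complex.norm_exp]
  congr 1
  simp [Complex.mul_re, Complex.mul_im]

variable {ε ω : ℝ} {c : ℂ}

theorem expKernel_isScalarKernel (hε : ε ≠ 0) (hω : 0 ≤ ω) (hc : ‖c‖ ≤ 1) :
    IsScalarKernel (expKernel ε ω c) where
  norm_le x s ρ hρ := by
    unfold expKernel
    split_ifs with h
    · rw [norm_mul, norm_exp_two_I_mul]
      refine mul_le_one₀ hc (Real.exp_pos _).le (Real.exp_le_one_iff.2 ?_)
      have := mul_nonneg hω h.le
      have := mul_nonneg hρ this
      nlinarith
    · simp
  meas x ρ := by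
    unfold expKernel
    refine Measurable.ite ?_ (by fun_prop) measurable_const
    exact measurableSet_lt measurable_const (by fun_prop)
  cont x s ρ hs := by
    have h0 : ε * (s - x) ≠ 0 := mul_ne_zero hε (sub_ne_zero.2 hs)
    have hcont : ContinuousAt (fun p : ℝ × ℂ => ε * (s - p.1)) (x, ρ) := by fun_prop
    rcases lt_or_gt_of_ne h0 with h | h
    · refine (continuousAt_const (y := (0 : ℂ))).congr ?_
      filter_upwards [hcont.eventually (Iio_mem_nhds h)] with p hp
      have hp : ε * (s - p.1) < 0 := hp
      simp only [expKernel, if_neg hp.le.not_gt]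
    · have : ContinuousAt (fun p : ℝ × ℂ =>
          c * Complex.exp (2 * Complex.I * p.2 * (ω * (ε * (s - p.1)) : ℝ))) (x, ρ) := by fun_prop
      refine this.congr ?_
      filter_upwards [hcont.eventually (Ioi_mem_nhds h)] with p hp
      have hp : 0 < ε * (s - p.1) := hp
      simp only [expKernel, if_pos hp]
  diff x s := by
    unfold expKernel
    split_ifs with h
    · fun_prop
    · exact differentiable_const _

variable {E : Type*} [NormedAddCommGroup E] [NormedSpace ℂ E] {α : ℝ} {h : ℝ → E} {ρ : ℂ}

theorem IsScalarKernel.integrable_smul {k : ℝ → ℝ → ℂ → ℂ} (hk : IsScalarKernel k) (hρ : 0 ≤ ρ.im)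
    (hh : IntegrableOn h (Ici α) volume) (x : ℝ) :
    IntegrableOn (fun s => k x s ρ • h s) (Ici α) volume :=
  hh.norm.mono' ((hk.meas x ρ).aestronglyMeasurable.smul hh.aestronglyMeasurable)
    (Eventually.of_forall fun s => by
      rw [norm_smul]; exact mul_le_of_le_one_left (norm_nonneg _) (hk.norm_le x s ρ hρ))

theorem IsScalarKernel.norm_integral_smul_le {k : ℝ → ℝ → ℂ → ℂ} (hk : IsScalarKernel k)
    (hρ : 0 ≤ ρ.im) (hh : IntegrableOn h (Ici α) volume) (x : ℝ) :
    ‖∫ s in Ici α, k x s ρ • h s‖ ≤ ∫ s in Ici α, ‖h s‖ :=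
  norm_integral_le_of_norm_le hh.norm (Eventually.of_forall fun s => by
    rw [norm_smul]; exact mul_le_of_le_one_left (norm_nonneg _) (hk.norm_le x s ρ hρ))

theorem integral_expKernel_forward (h : ℝ → E) (ω : ℝ) (c : ℂ) {x : ℝ} (hx : α ≤ x) (ρ : ℂ) :
    ∫ s in Ici α, expKernel 1 ω c x s ρ • h s =
      ∫ s in Ioi x, (c * Complex.exp (2 * Complex.I * ρ * (ω * (s - x) : ℝ))) • h s := by
  have : (fun s => expKernel 1 ω c x s ρ • h s) = (Ioi x).indicator
      (fun s => (c * Complex.exp (2 * Complex.I * ρ * (ω * (s - x) : ℝ))) • h s) := by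
    ext s
    by_cases hs : x < s
    · rw [indicator_of_mem (by exact hs), expKernel, if_pos (by linarith), one_mul]
    · rw [indicator_of_notMem (by exact hs), expKernel, if_neg (by linarith), zero_smul]
  rw [this, setIntegral_indicator measurableSet_Ioi, inter_eq_right.2 (Ioi_subset_Ici hx)]

theorem integral_expKernel_backward (h : ℝ → E) (ω : ℝ) (c : ℂ) {x : ℝ} (hx : α ≤ x) (ρ : ℂ) :
    ∫ s in Ici α, expKernel (-1) ω c x s ρ • h s =
      ∫ s in α..x, (c * Complex.exp (2 * Complex.I * ρ * (ω * (x - s) : ℝ))) • h s := by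
  rw [← setIntegral_Ici_indicator_Iio _ hx]
  congr 1; ext s
  by_cases hs : s < x
  · rw [indicator_of_mem (by exact hs), expKernel, if_pos (by linarith)]
    congr 5; ring
  · rw [indicator_of_notMem (by exact hs), expKernel, if_neg (by linarith), zero_smul]

theorem hasACDeriv_cexp (a : ℝ) (κ : ℂ) :
    HasACDeriv a (fun x : ℝ => Complex.exp (κ * x)) (fun x : ℝ => κ * Complex.exp (κ * x)) := by
  refine HasACDeriv.of_contDiff ?_ fun x => ?_
  · exact (contDiff_const.mul Complex.ofRealCLM.contDiff).cexp
  · have h1 : HasDerivAt (fun x : ℝ => κ * (x : ℂ)) κ x := by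
      simpa using (Complex.ofRealCLM.hasDerivAt (x := x)).const_mul κ
    rw [mul_comm]
    exact h1.cexp

theorem integrableOn_Icc_cexp_smul (hh : IntegrableOn h (Ici α) volume) (κ : ℂ) (b : ℝ) :
    IntegrableOn (fun s : ℝ => Complex.exp (κ * s) • h s) (Icc α b) volume :=
  IntegrableOn.continuousOn_smul (hh.mono_set Icc_subset_Ici_self)
    (by fun_prop) isCompact_Icc

/-- Factoring e^{−κx} out of the kernel leaves a plain tail integral. The condition α ≥ 0 keeps
e^{κs} bounded by one, so the factored integrand remains integrable. -/
theorem hasACDeriv_expKernel_forward [CompleteSpace E] (hα : 0 ≤ α) (hω : 0 ≤ ω) (hρ : 0 ≤ ρ.im)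
    (hh : IntegrableOn h (Ici α) volume) :
    HasACDeriv α (fun x => ∫ s in Ici α, expKernel 1 ω c x s ρ • h s)
      (fun x => -(2 * Complex.I * ρ * ω) • (∫ s in Ici α, expKernel 1 ω c x s ρ • h s) -
        c • h x) := by
  set κ : ℂ := 2 * Complex.I * ρ * ω with hκ
  have hint : IntegrableOn (fun s : ℝ => Complex.exp (κ * s) • h s) (Ici α) volume := by
    refine hh.norm.mono' ((by fun_prop : Continuous fun s : ℝ =>
      Complex.exp (κ * s)).aestronglyMeasurable.smul hh.aestronglyMeasurable) ?_
    filter_upwards [ae_restrict_mem measurableSet_Ici] with s hs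
    rw [norm_smul]
    refine mul_le_of_le_one_left (norm_nonneg _) ?_
    have h1 : κ * s = 2 * Complex.I * ρ * ((ω * s : ℝ) : ℂ) := by rw [hκ]; push_cast; ring
    rw [h1, norm_exp_two_I_mul, Real.exp_le_one_iff]
    have : 0 ≤ ρ.im * (ω * s) := mul_nonneg hρ (mul_nonneg hω (hα.trans hs))
    linarith
  have heq : ∀ x, α ≤ x → ∫ s in Ici α, expKernel 1 ω c x s ρ • h s =
      Complex.exp (-κ * x) • (c • ∫ s in Ioi x, Complex.exp (κ * s) • h s) := by
    intro x hx
    rw [integral_expKernel_forward h ω c hx ρ, smul_smul, ← integral_smul]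
    congr 1; ext s
    rw [smul_smul]
    congr 1
    rw [mul_comm (Complex.exp _) c, mul_assoc c (Complex.exp _), ← Complex.exp_add, hκ]
    congr 2; push_cast; ring
  refine (((hasACDeriv_cexp α (-κ)).smul ((HasACDeriv.tail hint).const_smul c)).congr
    heq).congr_deriv fun x hx => ?_
  rw [heq x hx.le, smul_neg, smul_neg, ← sub_eq_add_neg, smul_smul, smul_smul (Complex.exp _),
    smul_smul _ (Complex.exp (κ * x))]
  congr 1
  · rw [smul_smul, smul_smul]
  · congr 1
    rw [mul_comm (Complex.exp _) c, mul_assoc, ← Complex.exp_add]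
    simp

theorem hasACDeriv_expKernel_backward [CompleteSpace E] (hh : IntegrableOn h (Ici α) volume) :
    HasACDeriv α (fun x => ∫ s in Ici α, expKernel (-1) ω c x s ρ • h s)
      (fun x => (2 * Complex.I * ρ * ω) • (∫ s in Ici α, expKernel (-1) ω c x s ρ • h s) +
        c • h x) := by
  set κ : ℂ := 2 * Complex.I * ρ * ω with hκ
  have hint := integrableOn_Icc_cexp_smul hh (-κ)
  have heq : ∀ x, α ≤ x → ∫ s in Ici α, expKernel (-1) ω c x s ρ • h s =
      Complex.exp (κ * x) • (c • ∫ s in α..x, Complex.exp (-κ * s) • h s) := by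
    intro x hx
    rw [integral_expKernel_backward h ω c hx ρ, smul_smul, ← intervalIntegral.integral_smul]
    congr 1; ext s
    rw [smul_smul]
    congr 1
    rw [mul_comm (Complex.exp _) c, mul_assoc c (Complex.exp _), ← Complex.exp_add, hκ]
    congr 2; push_cast; ring
  refine (((hasACDeriv_cexp α κ).smul ((HasACDeriv.primitive hint).const_smul c)).congr
    heq).congr_deriv fun x hx => ?_
  rw [heq x hx.le, smul_smul (Complex.exp _), smul_smul _ (Complex.exp (-κ * x))]
  congr 1
  · rw [smul_smul, smul_smul, smul_smul]
  · congr 1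
    rw [mul_comm (Complex.exp _) c, mul_assoc, ← Complex.exp_add]
    simp

/-- The forward kernel vanishes as soon as x ≥ s. The backward one really decays, which takes Im ρ >
0; this is where the spatial asymptotics use the open half-plane. -/
theorem tendsto_expKernel_zero (hε : ε = 1 ∨ (ε = -1 ∧ 0 < ω ∧ 0 < ρ.im)) (s : ℝ) :
    Tendsto (fun x => expKernel ε ω c x s ρ) atTop (𝓝 0) := by
  rcases hε with rfl | ⟨rfl, hω, hρ⟩
  · refine tendsto_const_nhds.congr' ?_
    filter_upwards [eventually_ge_atTop s] with x hx
    rw [expKernel, if_neg (by linarith)]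
  · have h1 : Tendsto (fun x : ℝ => ‖c‖ * Real.exp (-(2 * ρ.im * (ω * (x - s))))) atTop
        (𝓝 (‖c‖ * 0)) := by
      refine Tendsto.const_mul _ (Real.tendsto_exp_atBot.comp (tendsto_neg_atTop_atBot.comp ?_))
      refine Tendsto.const_mul_atTop (by positivity) (Tendsto.const_mul_atTop hω ?_)
      exact tendsto_atTop_add_const_right _ (-s) tendsto_id
    rw [mul_zero] at h1
    refine squeeze_zero_norm' ?_ h1
    filter_upwards [eventually_gt_atTop s] with x hx
    rw [expKernel, if_pos (by linarith), norm_mul, norm_exp_two_I_mul]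
    refine le_of_eq ?_
    congr 3; ring

theorem tendsto_integral_expKernel_zero (hω : 0 ≤ ω) (hc : ‖c‖ ≤ 1) (hρ : 0 ≤ ρ.im)
    (hε : ε = 1 ∨ (ε = -1 ∧ 0 < ω ∧ 0 < ρ.im)) (hh : IntegrableOn h (Ici α) volume) :
    Tendsto (fun x => ∫ s in Ici α, expKernel ε ω c x s ρ • h s) atTop (𝓝 0) := by
  have hε0 : ε ≠ 0 := by rcases hε with rfl | ⟨rfl, -⟩ <;> norm_num
  have hk := expKernel_isScalarKernel hε0 hω hc
  have := tendsto_integral_filter_of_dominated_convergence (μ := volume.restrict (Ici α))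
    (l := atTop) (F := fun x s => expKernel ε ω c x s ρ • h s) (f := fun _ => 0) (fun s => ‖h s‖)
    (Eventually.of_forall fun x => (hk.integrable_smul hρ hh x).aestronglyMeasurable)
    (Eventually.of_forall fun x => Eventually.of_forall fun s => by
      rw [norm_smul]; exact mul_le_of_le_one_left (norm_nonneg _) (hk.norm_le x s ρ hρ))
    hh.norm (Eventually.of_forall fun s => by
      simpa using (tendsto_expKernel_zero (c := c) hε s).smul_const (h s))
  simpa using this

/-- Integration by parts: the two boundary terms cost 2M, the remaining integral costs I₁, and a
factor 1/‖κ‖ is gained. The shift μ lets the exponential be normalised at a moving base point. -/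
theorem norm_integral_cexp_smul_le [CompleteSpace E] {g : ℝ → E} (hg : ContDiff ℝ 1 g) {M I₁ : ℝ}
    (hM : ∀ s, ‖g s‖ ≤ M) (hI : ∀ a b, a ≤ b → ∫ s in a..b, ‖deriv g s‖ ≤ I₁) {a b : ℝ}
    (hab : a ≤ b) {κ μ : ℂ} (hκ : κ ≠ 0)
    (hle : ∀ s ∈ Icc a b, ‖Complex.exp (κ * s + μ)‖ ≤ 1) :
    ‖∫ s in a..b, Complex.exp (κ * s + μ) • g s‖ ≤ (2 * M + I₁) / ‖κ‖ := by
  have hd : ∀ s : ℝ, HasDerivAt (fun s : ℝ => Complex.exp (κ * s + μ) • g s)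
      (κ • (Complex.exp (κ * s + μ) • g s) + Complex.exp (κ * s + μ) • deriv g s) s := by
    intro s
    have h1 : HasDerivAt (fun x : ℝ => κ * (x : ℂ) + μ) κ s := by
      simpa using ((Complex.ofRealCLM.hasDerivAt (x := s)).const_mul κ).add_const μ
    have h2 := h1.cexp.smul (hg.differentiable one_ne_zero s).hasDerivAt
    rw [add_comm, smul_smul, mul_comm κ (Complex.exp _)]
    exact h2
  have hgc : Continuous (deriv g) := hg.continuous_deriv le_rfl
  have hgc' : Continuous g := hg.continuous
  have hc1 : Continuous fun s : ℝ => Complex.exp (κ * s + μ) • g s := by fun_prop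
  have hc2 : Continuous fun s : ℝ => Complex.exp (κ * s + μ) • deriv g s := by fun_prop
  have hftc := intervalIntegral.integral_eq_sub_of_hasDerivAt (a := a) (b := b)
    (fun s _ => hd s) (((hc1.const_smul κ).add hc2).intervalIntegrable a b)
  have hadd := intervalIntegral.integral_add (μ := volume)
    ((hc1.const_smul κ).intervalIntegrable a b) (hc2.intervalIntegrable a b)
  simp only [Pi.smul_apply] at hadd
  rw [hadd, intervalIntegral.integral_smul] at hftc
  have hend : ∀ s ∈ Icc a b, ‖Complex.exp (κ * s + μ) • g s‖ ≤ M := fun s hs => by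
    rw [norm_smul]
    exact (mul_le_of_le_one_left (norm_nonneg _) (hle s hs)).trans (hM s)
  have h3 : ‖∫ s in a..b, Complex.exp (κ * s + μ) • deriv g s‖ ≤ I₁ := by
    refine le_trans ?_ (hI a b hab)
    refine intervalIntegral.norm_integral_le_of_norm_le hab ?_
      (hgc.norm.intervalIntegrable a b)
    refine Eventually.of_forall fun s hs => ?_
    rw [norm_smul]
    exact mul_le_of_le_one_left (norm_nonneg _) (hle s ⟨hs.1.le, hs.2⟩)
  rw [le_div_iff₀ (norm_pos_iff.2 hκ), mul_comm, ← norm_smul, eq_sub_of_add_eq hftc]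
  refine (norm_sub_le _ _).trans ?_
  have h4 := norm_sub_le (Complex.exp (κ * b + μ) • g b) (Complex.exp (κ * a + μ) • g a)
  have h5 := hend b ⟨hab, le_rfl⟩
  have h6 := hend a ⟨le_rfl, hab⟩
  linarith

/-- Riemann–Lebesgue, uniformly in the base point and in the closed upper half-plane. -/
theorem uniform_riemann_lebesgue [CompleteSpace E] (hε : ε = 1 ∨ ε = -1)
    (hh : IntegrableOn h (Ici α) volume)
    {δ : ℝ} (hδ : 0 < δ) :
    ∃ N : ℝ, ∀ ρ : ℂ, 0 ≤ ρ.im → N < ‖ρ‖ → ∀ x, α ≤ x →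
      ‖∫ s in Ici α, expKernel ε 1 1 x s ρ • h s‖ ≤ δ := by
  have hε0 : ε ≠ 0 := by rcases hε with rfl | rfl <;> norm_num
  have hk : IsScalarKernel (expKernel ε 1 1) :=
    expKernel_isScalarKernel hε0 zero_le_one norm_one.le
  let h₀ : ℝ → E := (Ici α).indicator h
  have hh₀ : Integrable h₀ := (integrable_indicator_iff measurableSet_Ici).2 hh
  -- A smooth compactly supported approximation in L¹: the error δ/2 survives any kernel of modulus
  -- at most one, for all x and ρ simultaneously.
  obtain ⟨g, hgs, hgd, hgle⟩ := (memLp_one_iff_integrable.2 hh₀).exist_eLpNorm_sub_le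
    (by norm_num) le_rfl (half_pos hδ)
  have hg1 : ContDiff ℝ 1 g := hgd.of_le (by exact_mod_cast le_top)
  have hgi : Integrable g := hg1.continuous.integrable_of_hasCompactSupport hgs
  have hdc : Continuous (deriv g) := hg1.continuous_deriv le_rfl
  have hdi : Integrable (deriv g) := hdc.integrable_of_hasCompactSupport hgs.deriv
  have hdiff : ∫ s in Ici α, ‖h s - g s‖ ≤ δ / 2 := by
    have h1 : ∫ s, ‖h₀ s - g s‖ ≤ δ / 2 := by
      rw [eLpNorm_one_eq_lintegral_enorm] at hgle
      have h2 := integral_norm_eq_lintegral_enorm (hh₀.sub hgi).aestronglyMeasurable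
      simp only [Pi.sub_apply] at h2 hgle
      rw [h2]
      exact ENNReal.toReal_le_of_le_ofReal (half_pos hδ).le hgle
    refine le_trans ?_ h1
    calc ∫ s in Ici α, ‖h s - g s‖ = ∫ s in Ici α, ‖h₀ s - g s‖ := by
          refine setIntegral_congr_fun measurableSet_Ici fun s hs => ?_
          simp only [h₀, indicator_of_mem hs]
      _ ≤ ∫ s, ‖h₀ s - g s‖ :=
          setIntegral_le_integral (hh₀.sub hgi).norm (Eventually.of_forall fun _ => norm_nonneg _)
  obtain ⟨M, hM⟩ := hgs.exists_bound_of_continuous hg1.continuous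
  have hI : ∀ a b, a ≤ b → ∫ s in a..b, ‖deriv g s‖ ≤ ∫ s, ‖deriv g s‖ := fun a b hab => by
    rw [intervalIntegral.integral_of_le hab]
    exact setIntegral_le_integral hdi.norm (Eventually.of_forall fun _ => norm_nonneg _)
  obtain ⟨B, hB⟩ : ∃ B : ℝ, ∀ s, B < s → g s = 0 := by
    obtain ⟨B, hB⟩ := hgs.isCompact.bddAbove
    exact ⟨B, fun s hs => image_eq_zero_of_notMem_tsupport fun hmem => hs.not_ge (hB hmem)⟩
  set D := 2 * M + ∫ s, ‖deriv g s‖ with hD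
  have hD0 : 0 ≤ D := by
    have : 0 ≤ M := (norm_nonneg _).trans (hM 0)
    have : 0 ≤ ∫ s, ‖deriv g s‖ := integral_nonneg fun _ => norm_nonneg _
    positivity
  -- The smooth part contributes at most D/(2‖ρ‖), with D independent of x; this is at most δ/2
  -- beyond D/δ.
  refine ⟨D / δ, fun ρ hρ hN x hx => ?_⟩
  have hρpos : 0 < ‖ρ‖ := lt_of_le_of_lt (by positivity) hN
  have hρ0 : ρ ≠ 0 := norm_pos_iff.1 hρpos
  have hsmooth : ‖∫ s in Ici α, expKernel ε 1 1 x s ρ • g s‖ ≤ D / (2 * ‖ρ‖) := by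
    rcases hε with rfl | rfl
    · rw [integral_expKernel_forward g 1 1 hx ρ]
      -- As g vanishes beyond B, the half-line may be cut at `max x B`, which also covers x > B.
      have h1 : ∫ s in Ioi x, (1 * Complex.exp (2 * Complex.I * ρ * (1 * (s - x) : ℝ))) • g s =
          ∫ s in x..max x B,
            Complex.exp (2 * Complex.I * ρ * s + -(2 * Complex.I * ρ * x)) • g s := by
        rw [intervalIntegral.integral_of_le (le_max_left _ _)]
        have h2 : ∀ s : ℝ, (1 * Complex.exp (2 * Complex.I * ρ * (1 * (s - x) : ℝ))) • g s =
            Complex.exp (2 * Complex.I * ρ * s + -(2 * Complex.I * ρ * x)) • g s := fun s => by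
          rw [one_mul, one_mul]; congr 2; push_cast; ring
        simp_rw [h2]
        refine setIntegral_eq_of_subset_of_forall_sdiff_eq_zero measurableSet_Ioi
          Ioc_subset_Ioi_self fun s hs => ?_
        have : max x B < s := not_le.1 fun hle => hs.2 ⟨hs.1, hle⟩
        rw [hB s ((le_max_right _ _).trans_lt this), smul_zero]
      rw [h1]
      refine (norm_integral_cexp_smul_le hg1 hM hI (le_max_left _ _) (by simp [hρ0]) ?_).trans ?_
      · intro s hs
        have h3 : 2 * Complex.I * ρ * s + -(2 * Complex.I * ρ * x) =
            2 * Complex.I * ρ * ((s - x : ℝ) : ℂ) := by push_cast; ring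
        rw [h3, norm_exp_two_I_mul, Real.exp_le_one_iff]
        have := mul_nonneg hρ (sub_nonneg.2 hs.1)
        linarith
      · simp [hD]
    · rw [integral_expKernel_backward g 1 1 hx ρ]
      have h1 : ∀ s : ℝ, (1 * Complex.exp (2 * Complex.I * ρ * (1 * (x - s) : ℝ))) • g s =
          Complex.exp (-(2 * Complex.I * ρ) * s + 2 * Complex.I * ρ * x) • g s := fun s => by
        rw [one_mul, one_mul]; congr 2; push_cast; ring
      simp_rw [h1]
      refine (norm_integral_cexp_smul_le hg1 hM hI hx (by simp [hρ0]) ?_).trans ?_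
      · intro s hs
        have h3 : -(2 * Complex.I * ρ) * s + 2 * Complex.I * ρ * x =
            2 * Complex.I * ρ * ((x - s : ℝ) : ℂ) := by push_cast; ring
        rw [h3, norm_exp_two_I_mul, Real.exp_le_one_iff]
        have := mul_nonneg hρ (sub_nonneg.2 hs.2)
        linarith
      · simp [hD]
  have hsub : IntegrableOn (fun s => h s - g s) (Ici α) volume := hh.sub hgi.integrableOn
  have hsplit : ∫ s in Ici α, expKernel ε 1 1 x s ρ • h s =
      (∫ s in Ici α, expKernel ε 1 1 x s ρ • (h s - g s)) +
        ∫ s in Ici α, expKernel ε 1 1 x s ρ • g s := by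
    rw [← integral_add (hk.integrable_smul hρ hsub x)
      (hk.integrable_smul hρ hgi.integrableOn x)]
    simp only [smul_sub, sub_add_cancel]
  rw [hsplit]
  have h5 := (hk.norm_integral_smul_le hρ hsub x).trans hdiff
  have h6 : D / (2 * ‖ρ‖) ≤ δ / 2 := by
    rw [div_lt_iff₀ hδ] at hN
    rw [div_le_iff₀ (by positivity)]
    linarith
  calc _ ≤ _ := norm_add_le _ _
    _ ≤ δ / 2 + δ / 2 := add_le_add h5 (hsmooth.trans h6)
    _ = δ := add_halves δ

end ScalarKernel

/-! ### The inverse of iρ − a for large ρ -/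

section Resolvent

variable {R : Type*} [NormedRing R] [NormedAlgebra ℂ R]

/-- The inverse of `iρ - a`. -/
def charInv (a : R) (ρ : ℂ) : R := Ring.inverse ((Complex.I * ρ) • (1 : R) - a)

theorem norm_I_mul (ρ : ℂ) : ‖Complex.I * ρ‖ = ‖ρ‖ := by simp

variable {a : R} {ρ : ℂ}

theorem isUnit_char [CompleteSpace R] (hρ : ρ ≠ 0) (ha : ‖a‖ ≤ ‖ρ‖ / 2) :
    IsUnit ((Complex.I * ρ) • (1 : R) - a) := by
  have hρ' : 0 < ‖ρ‖ := norm_pos_iff.2 hρ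
  have hI : Complex.I * ρ ≠ 0 := mul_ne_zero Complex.I_ne_zero hρ
  have h1 : ‖(Complex.I * ρ)⁻¹ • a‖ < 1 := by
    rw [norm_smul, norm_inv, norm_I_mul, inv_mul_lt_iff₀ hρ']
    linarith
  have h2 : (Complex.I * ρ) • (1 : R) - a =
      (Complex.I * ρ) • (1 - (Complex.I * ρ)⁻¹ • a) := by
    rw [smul_sub, smul_inv_smul₀ hI]
  rw [h2]
  exact (isUnit_one_sub_of_norm_lt_one h1).smul (Units.mk0 _ hI)

theorem char_mul_charInv (hu : IsUnit ((Complex.I * ρ) • (1 : R) - a)) :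
    ((Complex.I * ρ) • (1 : R) - a) * charInv a ρ = 1 := Ring.mul_inverse_cancel _ hu

theorem charInv_mul_char (hu : IsUnit ((Complex.I * ρ) • (1 : R) - a)) :
    charInv a ρ * ((Complex.I * ρ) • (1 : R) - a) = 1 := Ring.inverse_mul_cancel _ hu

/-- From the inverse relation, ‖ρ‖‖inverse‖ ≤ 1 + ‖inverse‖‖ρ‖/2, and the last term is absorbed on
the left. -/
theorem norm_charInv_le [CompleteSpace R] (h1 : ‖(1 : R)‖ ≤ 1) (hρ : ρ ≠ 0) (ha : ‖a‖ ≤ ‖ρ‖ / 2) :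
    ‖charInv a ρ‖ ≤ 2 / ‖ρ‖ := by
  have hρ' : 0 < ‖ρ‖ := norm_pos_iff.2 hρ
  have h2 := charInv_mul_char (isUnit_char hρ ha)
  rw [mul_sub, mul_smul_comm, mul_one, sub_eq_iff_eq_add] at h2
  have h3 : ‖ρ‖ * ‖charInv a ρ‖ ≤ 1 + ‖charInv a ρ‖ * (‖ρ‖ / 2) := by
    rw [← norm_I_mul ρ, ← norm_smul, h2, norm_I_mul]
    refine (norm_add_le _ _).trans (add_le_add h1 ((norm_mul_le _ _).trans ?_))
    gcongr
  rw [le_div_iff₀ hρ']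
  linarith

/-- The difference equals (iρ)⁻¹ times the inverse times a. This quadratic gain is what identifies
the limit of ρf. -/
theorem norm_charInv_sub_le [CompleteSpace R] (h1 : ‖(1 : R)‖ ≤ 1) (hρ : ρ ≠ 0)
    (ha : ‖a‖ ≤ ‖ρ‖ / 2) :
    ‖charInv a ρ - (Complex.I * ρ)⁻¹ • (1 : R)‖ ≤ 2 * ‖a‖ / ‖ρ‖ ^ 2 := by
  have hρ' : 0 < ‖ρ‖ := norm_pos_iff.2 hρ
  have hI : Complex.I * ρ ≠ 0 := mul_ne_zero Complex.I_ne_zero hρ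
  have h2 := charInv_mul_char (isUnit_char hρ ha)
  rw [mul_sub, mul_smul_comm, mul_one, sub_eq_iff_eq_add] at h2
  have h3 : charInv a ρ - (Complex.I * ρ)⁻¹ • (1 : R) = (Complex.I * ρ)⁻¹ • (charInv a ρ * a) := by
    rw [sub_eq_iff_eq_add, ← smul_add, add_comm (charInv a ρ * a), ← h2, inv_smul_smul₀ hI]
  rw [h3, norm_smul, norm_inv, norm_I_mul]
  calc ‖ρ‖⁻¹ * ‖charInv a ρ * a‖ ≤ ‖ρ‖⁻¹ * (2 / ‖ρ‖ * ‖a‖) := by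
        gcongr
        refine (norm_mul_le _ _).trans ?_
        gcongr
        exact norm_charInv_le h1 hρ ha
    _ = 2 * ‖a‖ / ‖ρ‖ ^ 2 := by field_simp

theorem differentiableAt_charInv [CompleteSpace R] (hu : IsUnit ((Complex.I * ρ) • (1 : R) - a)) :
    DifferentiableAt ℂ (charInv a) ρ := by
  have h1 : DifferentiableAt ℂ (fun ρ : ℂ => (Complex.I * ρ) • (1 : R) - a) ρ := by fun_prop
  obtain ⟨u, hu⟩ := hu
  have h2 : DifferentiableAt ℂ Ring.inverse ((Complex.I * ρ) • (1 : R) - a) := by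
    rw [← hu]; exact (hasFDerivAt_ringInverse (𝕜 := ℂ) u).differentiableAt
  exact h2.comp ρ h1

theorem continuousOn_charInv [CompleteSpace R] {q : ℝ → R} {S : Set ℝ} (hq : ContinuousOn q S)
    (hu : ∀ s ∈ S, IsUnit ((Complex.I * ρ) • (1 : R) - q s)) :
    ContinuousOn (fun s => charInv (q s) ρ) S := by
  intro s hs
  obtain ⟨u, hu⟩ := hu s hs
  have h2 : ContinuousAt Ring.inverse ((Complex.I * ρ) • (1 : R) - q s) := by
    rw [← hu]; exact NormedRing.inverse_continuousAt u
  exact h2.comp_continuousWithinAt (f := fun s => (Complex.I * ρ) • (1 : R) - q s)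
    (continuousWithinAt_const.sub (hq s hs))

end Resolvent

/-! ### The coupling of the two leading waves and its operator kernel -/

section WKB

section Density

variable {R : Type*} [NormedRing R]

/-- The dominating density of the coefficients. -/
def density (q dq v : ℝ → R) (s : ℝ) : ℝ := ‖dq s‖ + ‖q s‖ ^ 2 + ‖v s‖

/-- The mass of the density on `[α, ∞)`. -/
def mass (q dq v : ℝ → R) (α : ℝ) : ℝ := ∫ s in Ici α, density q dq v s

theorem density_nonneg (q dq v : ℝ → R) (s : ℝ) : 0 ≤ density q dq v s := by
  unfold density; positivity

theorem mass_nonneg (q dq v : ℝ → R) (α : ℝ) : 0 ≤ mass q dq v α :=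
  integral_nonneg fun s => density_nonneg q dq v s

/-- The residual coefficients of the two leading terms. -/
def coefM (q dq v pm : ℝ → R) (s : ℝ) : R := (dq s - q s * q s - v s) * pm s

/-- See `coefM`. -/
def coefP (q dq v pp : ℝ → R) (s : ℝ) : R := -((dq s + q s * q s + v s) * pp s)

end Density

variable {R : Type*} [NormedRing R] [NormedAlgebra ℂ R]

/-- Coefficients `q`, `q' = dq`, `v` of `Y'' + (ρ² + 2iρq + v)Y = 0`, and the propagators of
`∓q`. -/
structure WKBData (C : ℝ) (q dq v pm im pp ip : ℝ → R) : Prop where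
  norm_one_le : ‖(1 : R)‖ ≤ 1
  one_le : 1 ≤ C
  deriv : HasACDeriv 0 q dq
  int_q : IntegrableOn q (Ici 0) volume
  int_dq : IntegrableOn dq (Ici 0) volume
  int_v : IntegrableOn v (Ici 0) volume
  prop_m : IsPropagator C (fun x => -q x) pm im
  prop_p : IsPropagator C q pp ip

/-- The residual `(1/2)(iρ - q)⁻¹(N₋ a + N₊ b)` as an operator. -/
def residOp (A Nm Np : R) : R × R →L[ℂ] R :=
  (1 / 2 : ℂ) • (ContinuousLinearMap.mul ℂ R A ∘L
    (ContinuousLinearMap.mul ℂ R Nm ∘L ContinuousLinearMap.fst ℂ R R +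
      ContinuousLinearMap.mul ℂ R Np ∘L ContinuousLinearMap.snd ℂ R R))

/-- The operator `z ↦ (k₁ P₁ (resid z), k₂ P₂ (resid z))`. -/
def kernelOp (k₁ k₂ : ℂ) (P₁ P₂ A Nm Np : R) : R × R →L[ℂ] R × R :=
  ContinuousLinearMap.inl ℂ R R ∘L (k₁ • (ContinuousLinearMap.mul ℂ R P₁ ∘L residOp A Nm Np)) +
  ContinuousLinearMap.inr ℂ R R ∘L (k₂ • (ContinuousLinearMap.mul ℂ R P₂ ∘L residOp A Nm Np))

theorem residOp_apply (A Nm Np : R) (z : R × R) :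
    residOp A Nm Np z = (1 / 2 : ℂ) • (A * (Nm * z.1 + Np * z.2)) := by
  simp [residOp, mul_add]

theorem kernelOp_apply (k₁ k₂ : ℂ) (P₁ P₂ A Nm Np : R) (z : R × R) :
    kernelOp k₁ k₂ P₁ P₂ A Nm Np z =
      (k₁ • (P₁ * residOp A Nm Np z), k₂ • (P₂ * residOp A Nm Np z)) := by
  simp [kernelOp]

theorem differentiable_mul_comp {T E : Type*} [NormedAddCommGroup T] [NormedSpace ℂ T]
    [NormedAddCommGroup E] [NormedSpace ℂ E] {f : T → R} {L : T → E →L[ℂ] R}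
    (hf : Differentiable ℂ f) (hL : Differentiable ℂ L) :
    Differentiable ℂ fun t => ContinuousLinearMap.mul ℂ R (f t) ∘L L t :=
  ((ContinuousLinearMap.mul ℂ R).differentiable.comp hf).clm_comp hL

theorem differentiable_residOp {T : Type*} [NormedAddCommGroup T] [NormedSpace ℂ T]
    {A Nm Np : T → R} (hA : Differentiable ℂ A) (hm : Differentiable ℂ Nm)
    (hp : Differentiable ℂ Np) : Differentiable ℂ fun t => residOp (A t) (Nm t) (Np t) :=
  (differentiable_mul_comp hA ((differentiable_mul_comp hm (differentiable_const _)).fun_add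
    (differentiable_mul_comp hp (differentiable_const _)))).fun_const_smul _

theorem differentiable_const_comp_smul {T E F G : Type*} [NormedAddCommGroup T] [NormedSpace ℂ T]
    [NormedAddCommGroup E] [NormedSpace ℂ E] [NormedAddCommGroup F] [NormedSpace ℂ F]
    [NormedAddCommGroup G] [NormedSpace ℂ G] (B : F →L[ℂ] G) {k : T → ℂ} {L : T → E →L[ℂ] F}
    (hk : Differentiable ℂ k) (hL : Differentiable ℂ L) :
    Differentiable ℂ fun t => B ∘L (k t • L t) :=
  (differentiable_const B).clm_comp (hk.fun_smul hL)

/-- Joint smoothness in all seven arguments delivers measurability in s, continuity in (x, ρ) and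
holomorphy in ρ by composition. -/
theorem differentiable_kernelOp : Differentiable ℂ
    (fun t : ℂ × ℂ × R × R × R × R × R =>
      kernelOp t.1 t.2.1 t.2.2.1 t.2.2.2.1 t.2.2.2.2.1 t.2.2.2.2.2.1 t.2.2.2.2.2.2) := by
  have hres : Differentiable ℂ fun t : ℂ × ℂ × R × R × R × R × R =>
      residOp t.2.2.2.2.1 t.2.2.2.2.2.1 t.2.2.2.2.2.2 :=
    differentiable_residOp (by fun_prop) (by fun_prop) (by fun_prop)
  have h1 := differentiable_const_comp_smul (ContinuousLinearMap.inl ℂ R R)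
    (k := fun t : ℂ × ℂ × R × R × R × R × R => t.1) (by fun_prop)
    (differentiable_mul_comp (f := fun t : ℂ × ℂ × R × R × R × R × R => t.2.2.1) (by fun_prop) hres)
  have h2 := differentiable_const_comp_smul (ContinuousLinearMap.inr ℂ R R)
    (k := fun t : ℂ × ℂ × R × R × R × R × R => t.2.1) (by fun_prop)
    (differentiable_mul_comp (f := fun t : ℂ × ℂ × R × R × R × R × R => t.2.2.2.1) (by fun_prop)
      hres)
  exact h1.fun_add h2

theorem aestronglyMeasurable_kernelOp {β : Type*} [MeasurableSpace β] {μ : Measure β}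
    {k₁ k₂ : β → ℂ} {P₁ P₂ A Nm Np : β → R} (hk₁ : AEStronglyMeasurable k₁ μ)
    (hk₂ : AEStronglyMeasurable k₂ μ) (hP₁ : AEStronglyMeasurable P₁ μ)
    (hP₂ : AEStronglyMeasurable P₂ μ) (hA : AEStronglyMeasurable A μ)
    (hm : AEStronglyMeasurable Nm μ) (hp : AEStronglyMeasurable Np μ) :
    AEStronglyMeasurable
      (fun s => kernelOp (k₁ s) (k₂ s) (P₁ s) (P₂ s) (A s) (Nm s) (Np s)) μ := by
  have h1 : AEStronglyMeasurable
      (fun s => (k₁ s, k₂ s, P₁ s, P₂ s, A s, Nm s, Np s)) μ :=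
    hk₁.prodMk (hk₂.prodMk (hP₁.prodMk (hP₂.prodMk (hA.prodMk (hm.prodMk hp)))))
  have h2 := (differentiable_kernelOp (R := R)).continuous.comp_aestronglyMeasurable h1
  exact h2

theorem continuousAt_kernelOp {X : Type*} [TopologicalSpace X] {x : X} {k₁ k₂ : X → ℂ}
    {A : X → R} (P₁ P₂ Nm Np : R) (hk₁ : ContinuousAt k₁ x) (hk₂ : ContinuousAt k₂ x)
    (hA : ContinuousAt A x) :
    ContinuousAt (fun t => kernelOp (k₁ t) (k₂ t) P₁ P₂ (A t) Nm Np) x := by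
  have h1 : ContinuousAt (fun t => (k₁ t, k₂ t, P₁, P₂, A t, Nm, Np)) x :=
    hk₁.prodMk (hk₂.prodMk (continuousAt_const.prodMk (continuousAt_const.prodMk
      (hA.prodMk (continuousAt_const.prodMk continuousAt_const)))))
  have h2 := (differentiable_kernelOp (R := R)).continuous.continuousAt.comp h1
  exact h2

theorem differentiableAt_kernelOp {ρ : ℂ} {k₁ k₂ : ℂ → ℂ} {A : ℂ → R} (P₁ P₂ Nm Np : R)
    (hk₁ : DifferentiableAt ℂ k₁ ρ) (hk₂ : DifferentiableAt ℂ k₂ ρ)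
    (hA : DifferentiableAt ℂ A ρ) :
    DifferentiableAt ℂ (fun t => kernelOp (k₁ t) (k₂ t) P₁ P₂ (A t) Nm Np) ρ := by
  have h1 : DifferentiableAt ℂ (fun t => (k₁ t, k₂ t, P₁, P₂, A t, Nm, Np)) ρ :=
    hk₁.prodMk (hk₂.prodMk ((differentiableAt_const _).prodMk ((differentiableAt_const _).prodMk
      (hA.prodMk ((differentiableAt_const _).prodMk (differentiableAt_const _))))))
  have h2 : DifferentiableAt ℂ (fun t : ℂ × ℂ × R × R × R × R × R =>
      kernelOp t.1 t.2.1 t.2.2.1 t.2.2.2.1 t.2.2.2.2.1 t.2.2.2.2.2.1 t.2.2.2.2.2.2)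
      (k₁ ρ, k₂ ρ, P₁, P₂, A ρ, Nm, Np) := differentiable_kernelOp _
  exact DifferentiableAt.comp (𝕜 := ℂ) (E := ℂ) (F := ℂ × ℂ × R × R × R × R × R)
    (G := R × R →L[ℂ] R × R) (f := fun t => (k₁ t, k₂ t, P₁, P₂, A t, Nm, Np)) ρ h2 h1

theorem norm_residOp_apply_le {A Nm Np : R} {c d : ℝ} (hA : ‖A‖ ≤ c) (hm : ‖Nm‖ ≤ d)
    (hp : ‖Np‖ ≤ d) (z : R × R) : ‖residOp A Nm Np z‖ ≤ c * d * ‖z‖ := by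
  have hc : 0 ≤ c := (norm_nonneg _).trans hA
  have hd : 0 ≤ d := (norm_nonneg _).trans hm
  rw [residOp_apply, norm_smul]
  have h1 : ‖Nm * z.1 + Np * z.2‖ ≤ d * ‖z‖ + d * ‖z‖ :=
    (norm_add_le _ _).trans (add_le_add
      ((norm_mul_le _ _).trans (mul_le_mul hm (norm_fst_le z) (norm_nonneg _) hd))
      ((norm_mul_le _ _).trans (mul_le_mul hp (norm_snd_le z) (norm_nonneg _) hd)))
  have h2 : ‖A * (Nm * z.1 + Np * z.2)‖ ≤ c * (d * ‖z‖ + d * ‖z‖) :=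
    (norm_mul_le _ _).trans (mul_le_mul hA h1 (norm_nonneg _) hc)
  have h3 : ‖(1 / 2 : ℂ)‖ = 1 / 2 := by norm_num
  rw [h3]
  linarith

theorem norm_kernelOp_le {k₁ k₂ : ℂ} {P₁ P₂ A Nm Np : R} {C c d : ℝ} (hk₁ : ‖k₁‖ ≤ 1)
    (hk₂ : ‖k₂‖ ≤ 1) (hP₁ : ‖P₁‖ ≤ C) (hP₂ : ‖P₂‖ ≤ C) (hA : ‖A‖ ≤ c) (hm : ‖Nm‖ ≤ d)
    (hp : ‖Np‖ ≤ d) : ‖kernelOp k₁ k₂ P₁ P₂ A Nm Np‖ ≤ C * (c * d) := by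
  have hc : 0 ≤ c := (norm_nonneg _).trans hA
  have hd : 0 ≤ d := (norm_nonneg _).trans hm
  have hC : 0 ≤ C := (norm_nonneg _).trans hP₁
  refine ContinuousLinearMap.opNorm_le_bound _ (by positivity) fun z => ?_
  have hr := norm_residOp_apply_le hA hm hp z
  have hcomp : ∀ {k : ℂ} {P : R}, ‖k‖ ≤ 1 → ‖P‖ ≤ C →
      ‖k • (P * residOp A Nm Np z)‖ ≤ C * (c * d) * ‖z‖ := fun {k P} hk hP => by
    rw [norm_smul]
    refine (mul_le_of_le_one_left (norm_nonneg _) hk).trans ((norm_mul_le _ _).trans ?_)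
    rw [mul_assoc]
    exact mul_le_mul hP hr (norm_nonneg _) hC
  rw [kernelOp_apply, Prod.norm_def]
  exact max_le (hcomp hk₁ hP₁) (hcomp hk₂ hP₂)

/-- The closed upper half-plane outside a disc. -/
def closedDomain (r : ℝ) : Set ℂ := {ρ | 0 ≤ ρ.im ∧ r < ‖ρ‖}

/-- The open upper half-plane outside a disc. -/
def openDomain (r : ℝ) : Set ℂ := {ρ | 0 < ρ.im ∧ r < ‖ρ‖}

theorem isOpen_openDomain (r : ℝ) : IsOpen (openDomain r) :=
  (isOpen_lt continuous_const Complex.continuous_im).inter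
    (isOpen_lt continuous_const continuous_norm)

theorem openDomain_subset (r : ℝ) : openDomain r ⊆ closedDomain r := fun _ h => ⟨h.1.le, h.2⟩

namespace WKBData

variable {C : ℝ} {q dq v pm im pp ip : ℝ → R}

/-- Integrability of q' gives a limit at infinity, and integrability of q forces that limit to be
zero. -/
theorem tendsto_q [CompleteSpace R] (h : WKBData C q dq v pm im pp ip) :
    Tendsto q atTop (𝓝 0) := by
  have h1 := intervalIntegral_tendsto_integral_Ioi 0 (h.int_dq.mono_set Ioi_subset_Ici_self)
    tendsto_id
  have h2 : Tendsto q atTop (𝓝 (q 0 + ∫ s in Ioi 0, dq s)) := by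
    refine (h1.const_add (q 0)).congr' ?_
    filter_upwards [eventually_ge_atTop 0] with x hx
    have := h.deriv.sub_eq_integral (fun b => h.int_dq.mono_set Icc_subset_Ici_self) x hx
    simp only [id]
    rw [← this]; abel
  have h3 : IntegrableAtFilter q atTop volume := ⟨Ici 0, Ici_mem_atTop 0, h.int_q⟩
  have h4 := h3.eq_zero_of_tendsto (fun s hs => by
    obtain ⟨b, hb⟩ := mem_atTop_sets.1 hs
    exact measure_mono_top (fun x hx => hb x hx) (Real.volume_Ici (a := b))) h2
  rwa [h4] at h2

/-- Because q vanishes at infinity, q(x) = −∫ₓ^∞ q'. In particular q is bounded, so its square is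
integrable. -/
theorem norm_q_le_integral [CompleteSpace R] (h : WKBData C q dq v pm im pp ip) {α x : ℝ}
    (hα : 0 ≤ α) (hx : α ≤ x) : ‖q x‖ ≤ ∫ s in Ici α, ‖dq s‖ := by
  have hi : IntegrableOn dq (Ici x) volume := h.int_dq.mono_set (Ici_subset_Ici.2 (hα.trans hx))
  have h1 := intervalIntegral_tendsto_integral_Ioi x (hi.mono_set Ioi_subset_Ici_self)
    tendsto_id
  have h2 : Tendsto (fun y => q y - q x) atTop (𝓝 (∫ s in Ioi x, dq s)) := by
    refine h1.congr' ?_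
    filter_upwards [eventually_ge_atTop x] with y hy
    exact ((h.deriv.mono (hα.trans hx)).sub_eq_integral
      (fun b => hi.mono_set Icc_subset_Ici_self) y hy).symm
  have h3 := tendsto_nhds_unique h2 (h.tendsto_q.sub_const (q x))
  rw [zero_sub] at h3
  rw [← norm_neg, ← h3]
  refine (norm_integral_le_integral_norm _).trans ?_
  exact setIntegral_mono_set (h.int_dq.mono_set (Ici_subset_Ici.2 hα)).norm
    (Eventually.of_forall fun _ => norm_nonneg _) (Eventually.of_forall (Ioi_subset_Ici hx))

theorem int_density [CompleteSpace R] (h : WKBData C q dq v pm im pp ip) {α : ℝ} (hα : 0 ≤ α) :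
    IntegrableOn (density q dq v) (Ici α) volume := by
  have h1 : IntegrableOn (fun s => ‖q s‖ * ‖q s‖) (Ici 0) volume :=
    integrableOn_bdd_mul h.deriv.continuousOn.norm (C := ∫ s in Ici (0 : ℝ), ‖dq s‖)
      (fun x hx => by rw [norm_norm]; exact h.norm_q_le_integral le_rfl hx) h.int_q.norm
  have h2 : IntegrableOn (density q dq v) (Ici 0) volume := by
    refine ((h.int_dq.norm.add h1).add h.int_v.norm).congr (Eventually.of_forall fun s => ?_)
    simp [density, sq]
  exact h2.mono_set (Ici_subset_Ici.2 hα)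

theorem norm_q_le_mass [CompleteSpace R] (h : WKBData C q dq v pm im pp ip) {α x : ℝ}
    (hα : 0 ≤ α) (hx : α ≤ x) : ‖q x‖ ≤ mass q dq v α := by
  refine (h.norm_q_le_integral hα hx).trans ?_
  refine integral_mono_ae (h.int_dq.mono_set (Ici_subset_Ici.2 hα)).norm (h.int_density hα)
    (Eventually.of_forall fun s => ?_)
  have : 0 ≤ ‖q s‖ ^ 2 + ‖v s‖ := by positivity
  simp only [density]; linarith

theorem tendsto_mass [CompleteSpace R] (h : WKBData C q dq v pm im pp ip) :
    Tendsto (mass q dq v) atTop (𝓝 0) := by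
  refine (tendsto_integral_Ioi_zero (h.int_density le_rfl)).congr fun x => ?_
  rw [mass, integral_Ici_eq_integral_Ioi]

theorem norm_coefM_le (h : WKBData C q dq v pm im pp ip) {s : ℝ} (hs : 0 ≤ s) :
    ‖coefM q dq v pm s‖ ≤ C * density q dq v s := by
  rw [mul_comm]
  refine (norm_mul_le _ _).trans (mul_le_mul ?_ (h.prop_m.bound s hs) (norm_nonneg _)
    (density_nonneg _ _ _ s))
  refine (norm_sub_le _ _).trans (add_le_add ((norm_sub_le _ _).trans (add_le_add le_rfl ?_)) le_rfl)
  rw [sq]; exact norm_mul_le _ _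

theorem norm_coefP_le (h : WKBData C q dq v pm im pp ip) {s : ℝ} (hs : 0 ≤ s) :
    ‖coefP q dq v pp s‖ ≤ C * density q dq v s := by
  rw [mul_comm, coefP, norm_neg]
  refine (norm_mul_le _ _).trans (mul_le_mul ?_ (h.prop_p.bound s hs) (norm_nonneg _)
    (density_nonneg _ _ _ s))
  refine (norm_add_le _ _).trans (add_le_add ((norm_add_le _ _).trans (add_le_add le_rfl ?_)) le_rfl)
  rw [sq]; exact norm_mul_le _ _

theorem int_sq [CompleteSpace R] (h : WKBData C q dq v pm im pp ip) :
    IntegrableOn (fun s => q s * q s) (Ici 0) volume :=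
  integrableOn_bdd_mul h.deriv.continuousOn
    (fun _ hx => h.norm_q_le_integral le_rfl hx) h.int_q

theorem int_coefM [CompleteSpace R] (h : WKBData C q dq v pm im pp ip) :
    IntegrableOn (coefM q dq v pm) (Ici 0) volume :=
  integrableOn_mul_bdd h.prop_m.deriv.continuousOn h.prop_m.bound
    ((h.int_dq.sub h.int_sq).sub h.int_v)

theorem int_coefP [CompleteSpace R] (h : WKBData C q dq v pm im pp ip) :
    IntegrableOn (coefP q dq v pp) (Ici 0) volume :=
  (integrableOn_mul_bdd h.prop_p.deriv.continuousOn h.prop_p.bound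
    ((h.int_dq.add h.int_sq).add h.int_v)).neg

end WKBData

end WKB

/-! ### The contraction on [α, ∞) and the amplitudes -/

section System

variable {R : Type*} [NormedRing R] [NormedAlgebra ℂ R] {C : ℝ}
  {q dq v pm im pp ip : ℝ → R} {α r : ℝ} {k₁ k₂ : ℝ → ℝ → ℂ → ℂ}

/-- The operator kernel of the integral system for the amplitudes. -/
def systemKernel (q dq v pm im pp ip : ℝ → R) (k₁ k₂ : ℝ → ℝ → ℂ → ℂ) (x s : ℝ) (ρ : ℂ) :
    R × R →L[ℂ] R × R :=
  kernelOp (k₁ x s ρ) (k₂ x s ρ) (im s) (ip s) (charInv (q s) ρ) (coefM q dq v pm s)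
    (coefP q dq v pp s)

namespace WKBData

theorem norm_ne_zero_of_mem (hr : 0 < r) {ρ : ℂ} (hρ : ρ ∈ closedDomain r) : ρ ≠ 0 :=
  norm_pos_iff.1 (hr.trans hρ.2)

variable [CompleteSpace R]

/-- As C ≥ 1, the threshold condition gives 8‖q‖ ≤ r < ‖ρ‖ with room to spare, so iρ − q is
invertible on all of [α, ∞). -/
theorem norm_q_le_half (h : WKBData C q dq v pm im pp ip) (hα : 0 ≤ α)
    (hm : 8 * C ^ 2 * mass q dq v α ≤ r) {ρ : ℂ} (hρ : ρ ∈ closedDomain r) {s : ℝ} (hs : α ≤ s) :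
    ‖q s‖ ≤ ‖ρ‖ / 2 := by
  have h1 := h.norm_q_le_mass hα hs
  have h2 : 1 ≤ C ^ 2 := one_le_pow₀ h.one_le
  have h3 := mass_nonneg q dq v α
  have h4 : r < ‖ρ‖ := hρ.2
  nlinarith

theorem isUnit_char (h : WKBData C q dq v pm im pp ip) (hα : 0 ≤ α) (hr : 0 < r)
    (hm : 8 * C ^ 2 * mass q dq v α ≤ r) {ρ : ℂ} (hρ : ρ ∈ closedDomain r) {s : ℝ} (hs : α ≤ s) :
    IsUnit ((Complex.I * ρ) • (1 : R) - q s) :=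
  MatrixPencil.isUnit_char (norm_ne_zero_of_mem hr hρ) (h.norm_q_le_half hα hm hρ hs)

theorem norm_systemKernel_le (h : WKBData C q dq v pm im pp ip) (hα : 0 ≤ α) (hr : 0 < r)
    (hm : 8 * C ^ 2 * mass q dq v α ≤ r) (hk₁ : IsScalarKernel k₁) (hk₂ : IsScalarKernel k₂)
    {ρ : ℂ} (hρ : ρ ∈ closedDomain r) (x : ℝ) {s : ℝ} (hs : α ≤ s) :
    ‖systemKernel q dq v pm im pp ip k₁ k₂ x s ρ‖ ≤ 2 * C ^ 2 / ‖ρ‖ * density q dq v s := by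
  have hs0 := hα.trans hs
  refine (norm_kernelOp_le (hk₁.norm_le x s ρ hρ.1) (hk₂.norm_le x s ρ hρ.1)
    (h.prop_m.bound_inv s hs0) (h.prop_p.bound_inv s hs0)
    (norm_charInv_le h.norm_one_le (norm_ne_zero_of_mem hr hρ) (h.norm_q_le_half hα hm hρ hs))
    (h.norm_coefM_le hs0) (h.norm_coefP_le hs0)).trans (le_of_eq ?_)
  ring

/-- The kernel bound integrates to 2C² `mass` / ‖ρ‖. The factor 8 in the threshold makes this at
most 1/4, and the constant weight 1 suffices since the scalar kernels are bounded by one. -/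
theorem isNeumannKernel (h : WKBData C q dq v pm im pp ip) (hα : 0 ≤ α) (hr : 0 < r)
    (hm : 8 * C ^ 2 * mass q dq v α ≤ r) (hk₁ : IsScalarKernel k₁) (hk₂ : IsScalarKernel k₂) :
    IsNeumannKernel (Ici α) (closedDomain r) (openDomain r) (1 / 4) (fun _ _ => 1)
      (systemKernel q dq v pm im pp ip k₁ k₂) := by
  have hsub : Ici α ⊆ Ici 0 := Ici_subset_Ici.2 hα
  have hmeas : ∀ x ∈ Ici α, ∀ ρ ∈ closedDomain r, AEStronglyMeasurable
      (fun s => systemKernel q dq v pm im pp ip k₁ k₂ x s ρ) (volume.restrict (Ici α)) := by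
    intro x _ ρ hρ
    have hc : ContinuousOn (fun s => charInv (q s) ρ) (Ici α) :=
      continuousOn_charInv (h.deriv.continuousOn.mono hsub)
        fun s hs => h.isUnit_char hα hr hm hρ hs
    exact aestronglyMeasurable_kernelOp (hk₁.meas x ρ).aestronglyMeasurable
      (hk₂.meas x ρ).aestronglyMeasurable
      ((h.prop_m.deriv_inv.continuousOn.mono hsub).aestronglyMeasurable measurableSet_Ici)
      ((h.prop_p.deriv_inv.continuousOn.mono hsub).aestronglyMeasurable measurableSet_Ici)
      (hc.aestronglyMeasurable measurableSet_Ici)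
      (h.int_coefM.mono_set hsub).aestronglyMeasurable
      (h.int_coefP.mono_set hsub).aestronglyMeasurable
  have hle : ∀ {ρ : ℂ}, ρ ∈ closedDomain r → ∀ (x : ℝ) {s : ℝ}, α ≤ s →
      ‖systemKernel q dq v pm im pp ip k₁ k₂ x s ρ‖ * 1 ≤ 2 * C ^ 2 / ‖ρ‖ * density q dq v s :=
    fun hρ x s hs => by rw [mul_one]; exact h.norm_systemKernel_le hα hr hm hk₁ hk₂ hρ x hs
  have hdc : ∀ {s : ℝ} {ρ : ℂ}, α ≤ s → ρ ∈ closedDomain r →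
      DifferentiableAt ℂ (charInv (q s)) ρ :=
    fun hs hρ => differentiableAt_charInv (h.isUnit_char hα hr hm hρ hs)
  refine ⟨measurableSet_Ici, isOpen_openDomain r, openDomain_subset r, by norm_num, by norm_num,
    fun _ _ _ _ => le_rfl, continuousOn_const, hmeas, ?_, ?_, ?_, ?_⟩
  · intro p hp
    refine ⟨fun s => 2 * C ^ 2 / r * density q dq v s, (h.int_density hα).const_mul _, ?_⟩
    filter_upwards [self_mem_nhdsWithin] with p hp s hs
    refine (hle hp.2 p.1 hs).trans (mul_le_mul_of_nonneg_right ?_ (density_nonneg _ _ _ _))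
    have := hp.2.2
    gcongr
  · intro x hx ρ hρ
    have h1 : ∫ s in Ici α, 2 * C ^ 2 / ‖ρ‖ * density q dq v s ≤ 1 / 4 * 1 := by
      have hρ0 : 0 < ‖ρ‖ := hr.trans hρ.2
      rw [integral_const_mul, div_mul_eq_mul_div, div_le_iff₀ hρ0]
      have h2 : r < ‖ρ‖ := hρ.2
      simp only [mass] at hm
      linarith
    refine le_trans (integral_mono_ae ?_ ((h.int_density hα).const_mul _) ?_) h1
    · refine ((h.int_density hα).const_mul (2 * C ^ 2 / ‖ρ‖)).mono'
        ((hmeas x hx ρ hρ).norm.mul_const 1) ?_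
      filter_upwards [ae_restrict_mem measurableSet_Ici] with s hs
      rw [Real.norm_eq_abs, abs_of_nonneg (by positivity)]
      exact hle hρ x hs
    · filter_upwards [ae_restrict_mem measurableSet_Ici] with s hs using hle hρ x hs
  · rintro ⟨x, ρ⟩ hp s hs hsx
    have hsx : s ≠ x := hsx
    have h1 : ContinuousAt (fun p : ℝ × ℂ => charInv (q s) p.2) (x, ρ) :=
      (hdc hs hp.2).continuousAt.comp (f := Prod.snd) continuousAt_snd
    exact (continuousAt_kernelOp _ _ _ _ (hk₁.cont x s ρ hsx) (hk₂.cont x s ρ hsx)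
      h1).continuousWithinAt
  · intro x hx s hs ρ hρ
    have h1 := hdc hs (openDomain_subset r hρ)
    exact (differentiableAt_kernelOp _ _ _ _ (hk₁.diff x s ρ) (hk₂.diff x s ρ)
      h1).differentiableWithinAt

end WKBData

/-- Amplitudes `a`, `b` solving the integral system with kernels `k₁`, `k₂` and leading vector
`e`; `f` is the residual. -/
structure IsAmplitude (q dq v pm im pp ip : ℝ → R) (α r : ℝ) (k₁ k₂ : ℝ → ℝ → ℂ → ℂ) (e : R × R)
    (a b f : ℝ → ℂ → R) : Prop where
  cont_a : ContinuousOn (fun p : ℝ × ℂ => a p.1 p.2) (Ici α ×ˢ closedDomain r)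
  cont_b : ContinuousOn (fun p : ℝ × ℂ => b p.1 p.2) (Ici α ×ˢ closedDomain r)
  diff_a : ∀ x, α ≤ x → DifferentiableOn ℂ (a x) (openDomain r)
  diff_b : ∀ x, α ≤ x → DifferentiableOn ℂ (b x) (openDomain r)
  norm_a : ∀ x, α ≤ x → ∀ ρ ∈ closedDomain r, ‖a x ρ - e.1‖ ≤ 1 / 3
  norm_b : ∀ x, α ≤ x → ∀ ρ ∈ closedDomain r, ‖b x ρ - e.2‖ ≤ 1 / 3
  eq_a : ∀ x, α ≤ x → ∀ ρ ∈ closedDomain r,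
    a x ρ = e.1 + ∫ s in Ici α, k₁ x s ρ • (im s * f s ρ)
  eq_b : ∀ x, α ≤ x → ∀ ρ ∈ closedDomain r,
    b x ρ = e.2 + ∫ s in Ici α, k₂ x s ρ • (ip s * f s ρ)
  int_f : ∀ ρ ∈ closedDomain r, IntegrableOn (fun s => f s ρ) (Ici α) volume
  char_f : ∀ s, α ≤ s → ∀ ρ ∈ closedDomain r,
    (2 : ℂ) • (((Complex.I * ρ) • (1 : R) - q s) * f s ρ) =
      coefM q dq v pm s * a s ρ + coefP q dq v pp s * b s ρ
  approx : ∃ D, ∀ s, α ≤ s → ∀ ρ ∈ closedDomain r,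
    ‖ρ • f s ρ - (2 * Complex.I)⁻¹ • (coefM q dq v pm s * e.1 + coefP q dq v pp s * e.2)‖ ≤
      D / ‖ρ‖ * density q dq v s

/-- The factor 1/4 bounds the Neumann sum by 4/3. Putting this bound back into the equation shows
that the amplitudes differ from e by O(1/ρ) and by at most 1/3, the latter serving invertibility at
α. -/
theorem WKBData.exists_amplitude [CompleteSpace R] (h : WKBData C q dq v pm im pp ip)
    (hα : 0 ≤ α) (hr : 0 < r) (hm : 8 * C ^ 2 * mass q dq v α ≤ r) (hk₁ : IsScalarKernel k₁)
    (hk₂ : IsScalarKernel k₂) {e : R × R} (he : ‖e‖ ≤ 1) :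
    ∃ a b f, IsAmplitude q dq v pm im pp ip α r k₁ k₂ e a b f := by
  have hK := h.isNeumannKernel hα hr hm hk₁ hk₂
  obtain ⟨z, hz, heq⟩ := hK.exists_solution e
  have hsub : Ici α ⊆ Ici 0 := Ici_subset_Ici.2 hα
  let f : ℝ → ℂ → R := fun s ρ =>
    residOp (charInv (q s) ρ) (coefM q dq v pm s) (coefP q dq v pp s) (z s ρ)
  have hzb : ∀ x, α ≤ x → ∀ ρ ∈ closedDomain r, ‖z x ρ‖ ≤ 4 / 3 := fun x hx ρ hρ => by
    refine (hz.bound x hx ρ hρ).trans ?_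
    norm_num
    linarith
  have hint : ∀ x, α ≤ x → ∀ ρ ∈ closedDomain r,
      IntegrableOn (fun s => systemKernel q dq v pm im pp ip k₁ k₂ x s ρ (z s ρ)) (Ici α) volume :=
    fun x hx ρ hρ => hK.integrand_integrable hz hx hρ
  have hzeq : ∀ x, α ≤ x → ∀ ρ ∈ closedDomain r, z x ρ =
      (e.1 + ∫ s in Ici α, k₁ x s ρ • (im s * f s ρ),
       e.2 + ∫ s in Ici α, k₂ x s ρ • (ip s * f s ρ)) := by
    intro x hx ρ hρ
    rw [heq x hx ρ hρ]
    have h1 := (hint x hx ρ hρ)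
    have h2 : ∫ s in Ici α, k₁ x s ρ • (im s * f s ρ) =
        (∫ s in Ici α, systemKernel q dq v pm im pp ip k₁ k₂ x s ρ (z s ρ)).1 := by
      refine Eq.trans ?_ ((ContinuousLinearMap.fst ℂ R R).integral_comp_comm h1)
      simp only [systemKernel, kernelOp_apply, ContinuousLinearMap.coe_fst', f]
    have h3 : ∫ s in Ici α, k₂ x s ρ • (ip s * f s ρ) =
        (∫ s in Ici α, systemKernel q dq v pm im pp ip k₁ k₂ x s ρ (z s ρ)).2 := by
      refine Eq.trans ?_ ((ContinuousLinearMap.snd ℂ R R).integral_comp_comm h1)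
      simp only [systemKernel, kernelOp_apply, ContinuousLinearMap.coe_snd', f]
    refine Prod.ext ?_ ?_
    · rw [Prod.fst_add]; exact congrArg (e.1 + ·) h2.symm
    · rw [Prod.snd_add]; exact congrArg (e.2 + ·) h3.symm
  have hze : ∀ x, α ≤ x → ∀ ρ ∈ closedDomain r, ‖z x ρ - e‖ ≤ 8 / 3 * C ^ 2 * mass q dq v α / ‖ρ‖ := by
    intro x hx ρ hρ
    rw [heq x hx ρ hρ, add_sub_cancel_left]
    refine (norm_integral_le_of_norm_le ((h.int_density hα).const_mul (2 * C ^ 2 / ‖ρ‖ * (4 / 3)))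
      ?_).trans (le_of_eq ?_)
    · filter_upwards [ae_restrict_mem measurableSet_Ici] with s hs
      refine (ContinuousLinearMap.le_opNorm _ _).trans ?_
      have h1 := h.norm_systemKernel_le hα hr hm hk₁ hk₂ hρ x hs
      have h2 := hzb s hs ρ hρ
      calc _ ≤ 2 * C ^ 2 / ‖ρ‖ * density q dq v s * (4 / 3) :=
            mul_le_mul h1 h2 (norm_nonneg _)
              (mul_nonneg (by positivity) (density_nonneg _ _ _ _))
        _ = _ := by ring
    · rw [integral_const_mul, mass]; ring
  have hze3 : ∀ x, α ≤ x → ∀ ρ ∈ closedDomain r, ‖z x ρ - e‖ ≤ 1 / 3 := by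
    intro x hx ρ hρ
    refine (hze x hx ρ hρ).trans ?_
    have hρ0 : 0 < ‖ρ‖ := hr.trans hρ.2
    have h2 : r < ‖ρ‖ := hρ.2
    rw [div_le_iff₀ hρ0]
    linarith
  refine ⟨fun x ρ => (z x ρ).1, fun x ρ => (z x ρ).2, f, ?_⟩
  refine ⟨hz.cont.fst, hz.cont.snd, fun x hx => (hz.diff x hx).fst, fun x hx => (hz.diff x hx).snd,
    fun x hx ρ hρ => ?_, fun x hx ρ hρ => ?_, fun x hx ρ hρ => ?_, fun x hx ρ hρ => ?_,
    fun ρ hρ => ?_, fun s hs ρ hρ => ?_, ?_⟩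
  · exact (norm_fst_le (z x ρ - e)).trans (hze3 x hx ρ hρ)
  · exact (norm_snd_le (z x ρ - e)).trans (hze3 x hx ρ hρ)
  · exact congrArg Prod.fst (hzeq x hx ρ hρ)
  · exact congrArg Prod.snd (hzeq x hx ρ hρ)
  · have hc : ContinuousOn (fun s => charInv (q s) ρ) (Ici α) :=
      continuousOn_charInv (h.deriv.continuousOn.mono hsub)
        fun s hs => h.isUnit_char hα hr hm hρ hs
    have hzc : ContinuousOn (fun s => z s ρ) (Ici α) :=
      hz.cont.comp (f := fun s : ℝ => (s, ρ)) (by fun_prop) fun s hs => ⟨hs, hρ⟩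
    have hmeas : AEStronglyMeasurable (fun s => f s ρ) (volume.restrict (Ici α)) := by
      simp only [f, residOp_apply]
      exact ((hc.aestronglyMeasurable measurableSet_Ici).mul
        (((h.int_coefM.mono_set hsub).aestronglyMeasurable.mul
          (hzc.fst.aestronglyMeasurable measurableSet_Ici)).add
        ((h.int_coefP.mono_set hsub).aestronglyMeasurable.mul
          (hzc.snd.aestronglyMeasurable measurableSet_Ici)))).const_smul _
    refine ((h.int_density hα).const_mul (2 / ‖ρ‖ * C * (4 / 3))).mono' hmeas ?_
    filter_upwards [ae_restrict_mem measurableSet_Ici] with s hs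
    have hs0 : 0 ≤ s := hα.trans hs
    have h1 := norm_residOp_apply_le (norm_charInv_le h.norm_one_le (norm_ne_zero_of_mem hr hρ)
      (h.norm_q_le_half hα hm hρ hs)) (h.norm_coefM_le hs0) (h.norm_coefP_le hs0) (z s ρ)
    have h2 := hzb s hs ρ hρ
    have h3 := density_nonneg q dq v s
    have h4 := h.one_le
    calc ‖f s ρ‖ ≤ 2 / ‖ρ‖ * (C * density q dq v s) * ‖z s ρ‖ := h1
      _ ≤ 2 / ‖ρ‖ * (C * density q dq v s) * (4 / 3) := by gcongr
      _ = _ := by ring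
  · have h1 := char_mul_charInv (h.isUnit_char hα hr hm hρ hs)
    simp only [f, residOp_apply]
    rw [mul_smul_comm, smul_smul, ← mul_assoc, h1, one_mul]
    norm_num
  -- The first term of the constant comes from replacing the amplitudes by e, the second from
  -- replacing the inverse of iρ − q by (iρ)⁻¹.
  · refine ⟨16 / 3 * C ^ 3 * mass q dq v α + 2 * C * mass q dq v α, fun s hs ρ hρ => ?_⟩
    have hs0 : 0 ≤ s := hα.trans hs
    have hρ0 : 0 < ‖ρ‖ := hr.trans hρ.2
    have hρne := norm_ne_zero_of_mem hr hρ
    have hq := h.norm_q_le_half hα hm hρ hs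
    have hA := norm_charInv_le h.norm_one_le hρne hq
    have hA' := norm_charInv_sub_le h.norm_one_le hρne hq
    have hM := h.norm_coefM_le hs0
    have hP := h.norm_coefP_le hs0
    have hd := density_nonneg q dq v s
    have hC := h.one_le
    have hsplit : ρ • f s ρ - (2 * Complex.I)⁻¹ •
        (coefM q dq v pm s * e.1 + coefP q dq v pp s * e.2) =
        ρ • (residOp (charInv (q s) ρ) (coefM q dq v pm s) (coefP q dq v pp s) (z s ρ - e) +
        residOp (charInv (q s) ρ - (Complex.I * ρ)⁻¹ • (1 : R)) (coefM q dq v pm s)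
          (coefP q dq v pp s) e) := by
      have h0 : (2 * Complex.I)⁻¹ • (coefM q dq v pm s * e.1 + coefP q dq v pp s * e.2) =
          ρ • residOp ((Complex.I * ρ)⁻¹ • (1 : R)) (coefM q dq v pm s) (coefP q dq v pp s) e := by
        rw [residOp_apply, smul_mul_assoc, one_mul, smul_smul, smul_smul]
        congr 1
        field_simp
      rw [h0, ← smul_sub]
      congr 1
      simp only [f, map_sub, residOp_apply, sub_mul, smul_sub]
      abel
    rw [hsplit, norm_smul]
    have h1 := norm_residOp_apply_le hA hM hP (z s ρ - e)
    have h2 := norm_residOp_apply_le hA' hM hP e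
    have h3 := hze s hs ρ hρ
    have h4 := h.norm_q_le_mass hα hs
    have h5 := mass_nonneg q dq v α
    calc ‖ρ‖ * ‖_‖ ≤ ‖ρ‖ * (2 / ‖ρ‖ * (C * density q dq v s) * ‖z s ρ - e‖ +
          2 * ‖q s‖ / ‖ρ‖ ^ 2 * (C * density q dq v s) * ‖e‖) := by
          gcongr
          exact (norm_add_le _ _).trans (add_le_add h1 h2)
      _ ≤ ‖ρ‖ * (2 / ‖ρ‖ * (C * density q dq v s) * (8 / 3 * C ^ 2 * mass q dq v α / ‖ρ‖) +
          2 * mass q dq v α / ‖ρ‖ ^ 2 * (C * density q dq v s) * 1) := by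
          gcongr
      _ = _ := by field_simp; ring

end System

/-! ### Remainders that vanish uniformly as |ρ| → ∞ -/

section UnifSmall

variable {R : Type*} [NormedRing R] {r α : ℝ} {F G : ℝ → ℂ → R}

/-- `F x ρ → 0` as `|ρ| → ∞` in the closed upper half-plane, uniformly in `x ≥ α`. -/
def UnifSmall (r α : ℝ) (F : ℝ → ℂ → R) : Prop :=
  ∀ ε > 0, ∃ N : ℝ, ∀ ρ ∈ closedDomain r, N < ‖ρ‖ → ∀ x, α ≤ x → ‖F x ρ‖ ≤ ε

namespace UnifSmall

theorem congr (hF : UnifSmall r α F) (h : ∀ ρ ∈ closedDomain r, ∀ x, α ≤ x → G x ρ = F x ρ) :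
    UnifSmall r α G := fun ε hε => by
  obtain ⟨N, hN⟩ := hF ε hε
  exact ⟨N, fun ρ hρ hNρ x hx => by rw [h ρ hρ x hx]; exact hN ρ hρ hNρ x hx⟩

theorem add (hF : UnifSmall r α F) (hG : UnifSmall r α G) :
    UnifSmall r α (fun x ρ => F x ρ + G x ρ) := fun ε hε => by
  obtain ⟨N, hN⟩ := hF (ε / 2) (half_pos hε)
  obtain ⟨M, hM⟩ := hG (ε / 2) (half_pos hε)
  refine ⟨max N M, fun ρ hρ hNρ x hx => (norm_add_le _ _).trans ?_⟩
  have h1 := hN ρ hρ ((le_max_left _ _).trans_lt hNρ) x hx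
  have h2 := hM ρ hρ ((le_max_right _ _).trans_lt hNρ) x hx
  linarith

theorem of_norm_le {C : ℝ} (hF : UnifSmall r α F)
    (h : ∀ ρ ∈ closedDomain r, ∀ x, α ≤ x → ‖G x ρ‖ ≤ C * ‖F x ρ‖) : UnifSmall r α G :=
  fun ε hε => by
  obtain ⟨N, hN⟩ := hF (ε / (|C| + 1)) (by positivity)
  refine ⟨N, fun ρ hρ hNρ x hx => (h ρ hρ x hx).trans ?_⟩
  have h1 := hN ρ hρ hNρ x hx
  have h2 : C ≤ |C| + 1 := (le_abs_self C).trans (by linarith)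
  calc C * ‖F x ρ‖ ≤ (|C| + 1) * (ε / (|C| + 1)) :=
        mul_le_mul h2 h1 (norm_nonneg _) (by positivity)
    _ = ε := by field_simp

theorem neg (hF : UnifSmall r α F) : UnifSmall r α (fun x ρ => -F x ρ) :=
  hF.of_norm_le (C := 1) fun _ _ _ _ => by rw [norm_neg, one_mul]

theorem sub (hF : UnifSmall r α F) (hG : UnifSmall r α G) :
    UnifSmall r α (fun x ρ => F x ρ - G x ρ) :=
  (hF.add hG.neg).congr fun _ _ _ _ => sub_eq_add_neg _ _

theorem const_smul [NormedAlgebra ℂ R] (c : ℂ) (hF : UnifSmall r α F) : UnifSmall r α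
    (fun x ρ => c • F x ρ) :=
  hF.of_norm_le (C := ‖c‖) fun _ _ _ _ => (norm_smul _ _).le

theorem bdd_mul {p : ℝ → R} {C : ℝ} (hF : UnifSmall r α F) (hp : ∀ x, α ≤ x → ‖p x‖ ≤ C) :
    UnifSmall r α (fun x ρ => p x * F x ρ) :=
  hF.of_norm_le (C := C) fun _ _ x hx =>
    (norm_mul_le _ _).trans (mul_le_mul_of_nonneg_right (hp x hx) (norm_nonneg _))

theorem of_le_div {K : ℝ} (hr : 0 < r)
    (h : ∀ ρ ∈ closedDomain r, ∀ x, α ≤ x → ‖F x ρ‖ ≤ K / ‖ρ‖) : UnifSmall r α F :=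
  fun ε hε => by
  refine ⟨K / ε, fun ρ hρ hN x hx => (h ρ hρ x hx).trans ?_⟩
  have hρ0 : 0 < ‖ρ‖ := hr.trans hρ.2
  rw [div_lt_iff₀ hε] at hN
  rw [div_le_iff₀ hρ0]
  linarith

end UnifSmall

end UnifSmall

/-! ### From amplitudes to the expansions of Y and Y' -/

section Leading

variable {R : Type*} [NormedRing R] [NormedAlgebra ℂ R] {r α : ℝ}

/-- The main part `M` and the small part `S` of a scaled solution with leading terms
`P + T / ρ`. -/
structure HasLeadingForm (α r : ℝ) (P T : ℝ → R) (M S : ℝ → ℂ → R) : Prop where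
  main : UnifSmall r α (fun x ρ => ρ • (M x ρ - P x) - T x)
  small : UnifSmall r α (fun x ρ => ρ • S x ρ)
  main_lim : ∀ ρ ∈ openDomain r, Tendsto (fun x => M x ρ - P x) atTop (𝓝 0)
  small_lim : ∀ ρ ∈ openDomain r, Tendsto (fun x => S x ρ) atTop (𝓝 0)

namespace HasLeadingForm

variable {P T q : ℝ → R} {M S : ℝ → ℂ → R}

theorem sum (h : HasLeadingForm α r P T M S) :
    UnifSmall r α (fun x ρ => ρ • (M x ρ + S x ρ - P x) - T x) :=
  (h.main.add h.small).congr fun ρ _ x _ => by module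

theorem sum_lim (h : HasLeadingForm α r P T M S) {ρ : ℂ} (hρ : ρ ∈ openDomain r) :
    Tendsto (fun x => M x ρ + S x ρ - P x) atTop (𝓝 0) := by
  have := (h.main_lim ρ hρ).add (h.small_lim ρ hρ)
  rw [add_zero] at this
  exact this.congr fun x => by abel

/-- The factor iρ multiplies M − P and S, whose scaled limits are T and 0, leaving iT. The part with
q multiplies quantities that themselves tend to zero, hence contributes nothing. -/
theorem derivative (h : HasLeadingForm α r P T M S) (hr : 0 < r) {B D : ℝ}
    (hq : ∀ x, α ≤ x → ‖q x‖ ≤ B) (hT : ∀ x, α ≤ x → ‖T x‖ ≤ D) :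
    UnifSmall r α (fun x ρ => ((Complex.I * ρ) • (1 : R) - q x) * (M x ρ - S x ρ) -
      (((Complex.I * ρ) • (1 : R) - q x) * P x + Complex.I • T x)) := by
  have hTρ : UnifSmall r α (fun x ρ => ρ⁻¹ • T x) :=
    UnifSmall.of_le_div (K := D) hr fun ρ hρ x hx => by
      rw [norm_smul, norm_inv, inv_mul_eq_div]
      gcongr
      exact hT x hx
  have hinv : ∀ {F : ℝ → ℂ → R}, UnifSmall r α F → UnifSmall r α (fun x ρ => ρ⁻¹ • F x ρ) :=
    fun hF => hF.of_norm_le (C := r⁻¹) fun ρ hρ x _ => by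
      rw [norm_smul, norm_inv]
      have := hρ.2
      gcongr
  have h1 : UnifSmall r α (fun x ρ => M x ρ - P x) :=
    ((hinv h.main).add hTρ).congr fun ρ hρ x _ => by
      have hρ0 : ρ ≠ 0 := norm_pos_iff.1 (hr.trans hρ.2)
      rw [← smul_add, sub_add_cancel, inv_smul_smul₀ hρ0]
  have h2 : UnifSmall r α S := (hinv h.small).congr fun ρ hρ x _ => by
    have hρ0 : ρ ≠ 0 := norm_pos_iff.1 (hr.trans hρ.2)
    rw [inv_smul_smul₀ hρ0]
  refine (((h.main.sub h.small).const_smul Complex.I).sub ((h1.sub h2).bdd_mul hq)).congr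
    fun ρ _ x _ => ?_
  simp only [sub_mul, mul_sub, smul_mul_assoc, one_mul]
  module

theorem derivative_lim (h : HasLeadingForm α r P T M S) (hr : 0 < r) {C : ℝ}
    (hP : ∀ x, α ≤ x → ‖P x‖ ≤ C) (hq : Tendsto q atTop (𝓝 0)) {ρ : ℂ}
    (hρ : ρ ∈ openDomain r) :
    Tendsto (fun x => (Complex.I * ρ)⁻¹ •
      (((Complex.I * ρ) • (1 : R) - q x) * (M x ρ - S x ρ)) - P x) atTop (𝓝 0) := by
  have hI : Complex.I * ρ ≠ 0 :=
    mul_ne_zero Complex.I_ne_zero (norm_pos_iff.1 (hr.trans hρ.2))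
  have h1 := (h.main_lim ρ hρ).sub (h.small_lim ρ hρ)
  rw [sub_zero] at h1
  have h2 : Tendsto (fun x => q x * P x) atTop (𝓝 0) := by
    have h3 := hq.norm.mul_const C
    rw [norm_zero, zero_mul] at h3
    refine squeeze_zero_norm' ?_ h3
    filter_upwards [eventually_ge_atTop α] with x hx
    exact (norm_mul_le _ _).trans (mul_le_mul_of_nonneg_left (hP x hx) (norm_nonneg _))
  have h4 := h1.sub ((((hq.mul h1)).add h2).const_smul (Complex.I * ρ)⁻¹)
  simp only [mul_zero, add_zero, smul_zero, sub_zero] at h4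
  refine h4.congr fun x => ?_
  simp only [sub_mul, mul_sub, smul_mul_assoc, one_mul, smul_sub, inv_smul_smul₀ hI, smul_add]
  abel

end HasLeadingForm

end Leading

/-! ### Uniform limits of the amplitude integrals -/

section Components

variable {R : Type*} [NormedRing R] [NormedAlgebra ℂ R] {r α C D : ℝ}
  {q dq v pm im pp ip : ℝ → R} {f : ℝ → ℂ → R} {j n : ℝ → R} {k : ℝ → ℝ → ℂ → ℂ}

/-- Replacing ρf by its limit n inside the integral costs O(1/ρ), uniformly in x, because the
approximation error carries the integrable density. -/
theorem WKBData.norm_component_sub_le [CompleteSpace R] (h : WKBData C q dq v pm im pp ip)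
    (hα : 0 ≤ α)
    (hk : IsScalarKernel k) (hj : ContinuousOn j (Ici 0)) (hjC : ∀ x, 0 ≤ x → ‖j x‖ ≤ C)
    (hf : ∀ ρ ∈ closedDomain r, IntegrableOn (fun s => f s ρ) (Ici α) volume)
    (hn : IntegrableOn n (Ici α) volume)
    (happ : ∀ s, α ≤ s → ∀ ρ ∈ closedDomain r, ‖ρ • f s ρ - n s‖ ≤ D / ‖ρ‖ * density q dq v s)
    {ρ : ℂ} (hρ : ρ ∈ closedDomain r) (x : ℝ) :
    ‖ρ • (∫ s in Ici α, k x s ρ • (j s * f s ρ)) - ∫ s in Ici α, k x s ρ • (j s * n s)‖ ≤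
      C * D * mass q dq v α / ‖ρ‖ := by
  have hj' := hj.mono (Ici_subset_Ici.2 hα)
  have hjC' : ∀ x, α ≤ x → ‖j x‖ ≤ C := fun x hx => hjC x (hα.trans hx)
  have hC : 0 ≤ C := zero_le_one.trans h.one_le
  have h1 := hk.integrable_smul hρ.1 (integrableOn_bdd_mul hj' hjC' (hf ρ hρ)) x
  have h2 := hk.integrable_smul hρ.1 (integrableOn_bdd_mul hj' hjC' hn) x
  have hsub := integral_sub (h1.smul ρ) h2
  simp only [Pi.smul_apply] at hsub
  rw [← integral_smul, ← hsub]
  refine (norm_integral_le_of_norm_le ((h.int_density hα).const_mul (C * (D / ‖ρ‖))) ?_).trans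
    (le_of_eq ?_)
  · filter_upwards [ae_restrict_mem measurableSet_Ici] with s hs
    have h3 : ρ • k x s ρ • (j s * f s ρ) - k x s ρ • (j s * n s) =
        k x s ρ • (j s * (ρ • f s ρ - n s)) := by
      rw [mul_sub, mul_smul_comm, smul_sub, smul_comm]
    rw [h3, norm_smul]
    refine (mul_le_of_le_one_left (norm_nonneg _) (hk.norm_le x s ρ hρ.1)).trans
      ((norm_mul_le _ _).trans ?_)
    rw [mul_assoc]
    exact mul_le_mul (hjC' s hs) (happ s hs ρ hρ) (norm_nonneg _) hC
  · rw [integral_const_mul, mass]; ring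

/-- Once ρf is replaced by the ρ-free limit n, the Riemann–Lebesgue lemma applies. -/
theorem WKBData.unifSmall_oscillating [CompleteSpace R] (h : WKBData C q dq v pm im pp ip)
    (hα : 0 ≤ α) (hr : 0 < r) {ε : ℝ} (hε : ε = 1 ∨ ε = -1) (hj : ContinuousOn j (Ici 0))
    (hjC : ∀ x, 0 ≤ x → ‖j x‖ ≤ C)
    (hf : ∀ ρ ∈ closedDomain r, IntegrableOn (fun s => f s ρ) (Ici α) volume)
    (hn : IntegrableOn n (Ici α) volume)
    (happ : ∀ s, α ≤ s → ∀ ρ ∈ closedDomain r, ‖ρ • f s ρ - n s‖ ≤ D / ‖ρ‖ * density q dq v s) :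
    UnifSmall r α (fun x ρ => ρ • ∫ s in Ici α, expKernel ε 1 1 x s ρ • (j s * f s ρ)) := by
  have hε0 : ε ≠ 0 := by rcases hε with rfl | rfl <;> norm_num
  have hk : IsScalarKernel (expKernel ε 1 1) :=
    expKernel_isScalarKernel hε0 zero_le_one norm_one.le
  have hj' := hj.mono (Ici_subset_Ici.2 hα)
  have hjC' : ∀ x, α ≤ x → ‖j x‖ ≤ C := fun x hx => hjC x (hα.trans hx)
  have h1 : UnifSmall r α (fun x ρ => ∫ s in Ici α, expKernel ε 1 1 x s ρ • (j s * n s)) := by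
    intro δ hδ
    obtain ⟨N, hN⟩ := uniform_riemann_lebesgue hε (integrableOn_bdd_mul hj' hjC' hn) hδ
    exact ⟨N, fun ρ hρ hNρ x hx => hN ρ hρ.1 hNρ x hx⟩
  have h2 := UnifSmall.of_le_div hr fun ρ (hρ : ρ ∈ closedDomain r) x (_ : α ≤ x) =>
    h.norm_component_sub_le hα hk hj hjC hf hn happ hρ x
  exact (h2.add h1).congr fun ρ _ x _ => (sub_add_cancel _ _).symm

/-- With ω = 0 there is no oscillation, so the limit is a genuine tail integral; this is what
produces T. -/
theorem WKBData.unifSmall_main [CompleteSpace R] (h : WKBData C q dq v pm im pp ip)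
    (hα : 0 ≤ α) (hr : 0 < r) {c : ℂ} (hc : ‖c‖ ≤ 1) {P T : ℝ → R}
    (hP : ∀ x, 0 ≤ x → ‖P x‖ ≤ C) (hj : ContinuousOn j (Ici 0))
    (hjC : ∀ x, 0 ≤ x → ‖j x‖ ≤ C)
    (hf : ∀ ρ ∈ closedDomain r, IntegrableOn (fun s => f s ρ) (Ici α) volume)
    (hn : IntegrableOn n (Ici α) volume)
    (happ : ∀ s, α ≤ s → ∀ ρ ∈ closedDomain r, ‖ρ • f s ρ - n s‖ ≤ D / ‖ρ‖ * density q dq v s)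
    (hT : ∀ x, α ≤ x → T x = P x * (c • ∫ s in Ioi x, j s * n s)) {a : ℝ → ℂ → R}
    (ha : ∀ x, α ≤ x → ∀ ρ ∈ closedDomain r,
      a x ρ = 1 + ∫ s in Ici α, expKernel 1 0 c x s ρ • (j s * f s ρ)) :
    UnifSmall r α (fun x ρ => ρ • (P x * a x ρ - P x) - T x) := by
  have hk : IsScalarKernel (expKernel 1 0 c) := expKernel_isScalarKernel one_ne_zero le_rfl hc
  have h2 := UnifSmall.of_le_div hr fun ρ (hρ : ρ ∈ closedDomain r) x (_ : α ≤ x) =>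
    h.norm_component_sub_le hα hk hj hjC hf hn happ hρ x
  refine (h2.bdd_mul fun x hx => hP x (hα.trans hx)).congr fun ρ hρ x hx => ?_
  have h3 : ∫ s in Ici α, expKernel 1 0 c x s ρ • (j s * n s) = c • ∫ s in Ioi x, j s * n s := by
    rw [integral_expKernel_forward _ _ _ hx, ← integral_smul]
    simp
  rw [h3, ha x hx ρ hρ, hT x hx]
  simp only [mul_sub, mul_add, mul_one, mul_smul_comm, add_sub_cancel_left]

end Components

/-! ### Why the amplitude system solves the second order equation -/

section AmplitudeEquation

variable {R : Type*} [NormedRing R] [NormedAlgebra ℂ R] {C α : ℝ}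
  {q dq v pm im pp ip a b f : ℝ → R} {ρ κ : ℂ}

/-- The amplitude form of the second order equation. -/
theorem WKBData.hasACDeriv_solution (h : WKBData C q dq v pm im pp ip) (hα : 0 ≤ α)
    (ha : HasACDeriv α a (fun x => (Complex.I * ρ - κ) • a x + im x * f x))
    (hb : HasACDeriv α b (fun x => -(Complex.I * ρ + κ) • b x - ip x * f x))
    (hf : ∀ s, α ≤ s → (2 : ℂ) • (((Complex.I * ρ) • (1 : R) - q s) * f s) =
      coefM q dq v pm s * a s + coefP q dq v pp s * b s) :
    HasACDeriv α (fun x : ℝ => Complex.exp (κ * x) • (pm x * a x + pp x * b x))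
      (fun x : ℝ => Complex.exp (κ * x) •
        (((Complex.I * ρ) • (1 : R) - q x) * (pm x * a x - pp x * b x))) ∧
    HasACDeriv α (fun x : ℝ => Complex.exp (κ * x) •
        (((Complex.I * ρ) • (1 : R) - q x) * (pm x * a x - pp x * b x)))
      (fun x : ℝ => -((ρ ^ 2 • (1 : R) + (2 * Complex.I * ρ) • q x + v x) *
        (Complex.exp (κ * x) • (pm x * a x + pp x * b x)))) := by
  -- In terms of c = iρ the pencil reads −(c − q)² + q² + v, so two applications of c − q reproduce
  -- it up to q² + v.
  have hρ2 : ρ ^ 2 = -(Complex.I * ρ) ^ 2 := by rw [mul_pow, Complex.I_sq]; ring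
  have h2ρ : 2 * Complex.I * ρ = 2 * (Complex.I * ρ) := mul_assoc _ _ _
  rw [h2ρ, hρ2]
  generalize Complex.I * ρ = c at *
  have hu : HasACDeriv α (fun x => pm x * a x)
      (fun x => c • (pm x * a x) - q x * (pm x * a x) - κ • (pm x * a x) + f x) :=
    ((h.prop_m.deriv.mono hα).mul ha).congr_deriv fun x hx => by
      rw [mul_add, ← mul_assoc (pm x) (im x), h.prop_m.mul_inv x (hα.trans hx.le), one_mul,
        mul_smul_comm, mul_assoc, neg_mul]
      module
  have hw : HasACDeriv α (fun x => pp x * b x)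
      (fun x => q x * (pp x * b x) - c • (pp x * b x) - κ • (pp x * b x) - f x) :=
    ((h.prop_p.deriv.mono hα).mul hb).congr_deriv fun x hx => by
      rw [mul_sub, ← mul_assoc (pp x) (ip x), h.prop_p.mul_inv x (hα.trans hx.le), one_mul,
        mul_smul_comm, mul_assoc]
      module
  have he := hasACDeriv_cexp α κ
  have hA : HasACDeriv α (fun x => c • (1 : R) - q x) (fun x => 0 - dq x) :=
    (HasACDeriv.const (c • (1 : R))).sub (h.deriv.mono hα)
  refine ⟨(he.smul (hu.add hw)).congr_deriv fun x _ => ?_,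
    (he.smul (hA.mul (hu.sub hw))).congr_deriv fun x hx => ?_⟩
  · simp only [sub_mul, mul_sub, smul_mul_assoc, one_mul]
    module
  · have h1 := hf x hx.le
    simp only [coefM, coefP, mul_assoc, neg_mul] at h1
    generalize pm x * a x = u at *
    generalize pp x * b x = w at *
    -- The contributions of f are isolated as 2(c − q)f, the only combination the coupling relation
    -- determines.
    have h2 : (c • (1 : R) - q x) * (c • u - q x * u - κ • u + f x -
        (q x * w - c • w - κ • w - f x)) = (c • (1 : R) - q x) *
        (c • u - q x * u - κ • u - (q x * w - c • w - κ • w)) +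
        (2 : ℂ) • ((c • (1 : R) - q x) * f x) := by
      rw [two_smul]; noncomm_ring
    rw [h2, h1]
    simp only [sub_mul, mul_sub, add_mul, mul_add, smul_mul_assoc, mul_smul_comm, one_mul, mul_assoc,
      zero_mul]
    module

end AmplitudeEquation

theorem sgn_mul_self (σ : ℤˣ) : sgn σ * sgn σ = 1 := by
  rcases Int.units_eq_one_or σ with rfl | rfl <;> simp [sgn]

theorem ex_ne_zero (σ : ℤˣ) (ρ : ℂ) (x : ℝ) : ex σ ρ x ≠ 0 := Complex.exp_ne_zero _

/-! ### Solution pairs with prescribed leading terms -/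

section Asymptotic

variable {R : Type*} [NormedRing R] [NormedAlgebra ℂ R]

/-- A pair `(Y, Y')` on `x ≥ a` solving the pencil equation, regular in the parameter. -/
structure IsPencilSolution (q v : ℝ → R) (a r : ℝ) (Y Z : ℝ → ℂ → R) : Prop where
  cont : ContinuousOn (fun p : ℝ × ℂ => Y p.1 p.2) (Ici a ×ˢ closedDomain r)
  cont' : ContinuousOn (fun p : ℝ × ℂ => Z p.1 p.2) (Ici a ×ˢ closedDomain r)
  diff : ∀ x, a ≤ x → DifferentiableOn ℂ (Y x) (openDomain r)
  diff' : ∀ x, a ≤ x → DifferentiableOn ℂ (Z x) (openDomain r)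
  deriv : ∀ ρ ∈ closedDomain r, HasACDeriv a (fun x => Y x ρ) (fun x => Z x ρ)
  deriv' : ∀ ρ ∈ closedDomain r, HasACDeriv a (fun x => Z x ρ)
    (fun x => -((ρ ^ 2 • (1 : R) + (2 * Complex.I * ρ) • q x + v x) * Y x ρ))

/-- The pair `(Y, Y')` has leading terms `P`, `T` after division by `exp (σ i ρ x)`. -/
structure IsAsymptotic (q : ℝ → R) (α r : ℝ) (σ : ℤˣ) (P T : ℝ → R) (Y Z : ℝ → ℂ → R) :
    Prop where
  leading : UnifSmall r α (fun x ρ => ρ • ((ex σ ρ x)⁻¹ • Y x ρ - P x) - T x)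
  leading' : UnifSmall r α (fun x ρ => (sgn σ * (ex σ ρ x)⁻¹) • Z x ρ -
    (((Complex.I * ρ) • (1 : R) - q x) * P x + Complex.I • T x))
  lim : ∀ ρ ∈ openDomain r, Tendsto (fun x => (ex σ ρ x)⁻¹ • Y x ρ - P x) atTop (𝓝 0)
  lim' : ∀ ρ ∈ openDomain r,
    Tendsto (fun x => ((sgn σ * Complex.I * ρ)⁻¹ * (ex σ ρ x)⁻¹) • Z x ρ - P x) atTop (𝓝 0)

variable {C D α r : ℝ} {q dq v pm im pp ip P T : ℝ → R} {M S Y Z : ℝ → ℂ → R}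

theorem continuous_ex (σ : ℤˣ) : Continuous (fun p : ℝ × ℂ => ex σ p.2 p.1) := by
  unfold ex; fun_prop

theorem differentiable_ex (σ : ℤˣ) (x : ℝ) : Differentiable ℂ (fun ρ => ex σ ρ x) := by
  unfold ex; fun_prop

theorem HasLeadingForm.isPencilSolution_isAsymptotic [CompleteSpace R]
    (h : WKBData C q dq v pm im pp ip)
    (hα : 0 ≤ α) (hr : 0 < r) (hL : HasLeadingForm α r P T M S) (σ : ℤˣ)
    (hP : ∀ x, 0 ≤ x → ‖P x‖ ≤ C) (hT : ∀ x, 0 ≤ x → ‖T x‖ ≤ D)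
    (hM : ContinuousOn (fun p : ℝ × ℂ => M p.1 p.2) (Ici α ×ˢ closedDomain r))
    (hS : ContinuousOn (fun p : ℝ × ℂ => S p.1 p.2) (Ici α ×ˢ closedDomain r))
    (hM' : ∀ x, α ≤ x → DifferentiableOn ℂ (M x) (openDomain r))
    (hS' : ∀ x, α ≤ x → DifferentiableOn ℂ (S x) (openDomain r))
    (hY : ∀ x ρ, Y x ρ = ex σ ρ x • (M x ρ + S x ρ))
    (hZ : ∀ x ρ, Z x ρ = ex σ ρ x • (sgn σ • (((Complex.I * ρ) • (1 : R) - q x) *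
      (M x ρ - S x ρ))))
    (hd : ∀ ρ ∈ closedDomain r, HasACDeriv α (fun x => Y x ρ) (fun x => Z x ρ))
    (hd' : ∀ ρ ∈ closedDomain r, HasACDeriv α (fun x => Z x ρ)
      (fun x => -((ρ ^ 2 • (1 : R) + (2 * Complex.I * ρ) • q x + v x) * Y x ρ))) :
    IsPencilSolution q v α r Y Z ∧ IsAsymptotic q α r σ P T Y Z := by
  have hYe : ∀ x ρ, (ex σ ρ x)⁻¹ • Y x ρ = M x ρ + S x ρ := fun x ρ => by
    rw [hY, inv_smul_smul₀ (ex_ne_zero σ ρ x)]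
  have hZe : ∀ x ρ, (ex σ ρ x)⁻¹ • Z x ρ =
      sgn σ • (((Complex.I * ρ) • (1 : R) - q x) * (M x ρ - S x ρ)) := fun x ρ => by
    rw [hZ, inv_smul_smul₀ (ex_ne_zero σ ρ x)]
  have hqc : ContinuousOn (fun p : ℝ × ℂ => q p.1) (Ici α ×ˢ closedDomain r) :=
    h.deriv.continuousOn.comp continuousOn_fst fun p hp => hα.trans hp.1
  refine ⟨⟨?_, ?_, fun x hx => ?_, fun x hx => ?_, hd, hd'⟩, ⟨?_, ?_, fun ρ hρ => ?_,
    fun ρ hρ => ?_⟩⟩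
  · simp only [hY]
    exact (continuous_ex σ).continuousOn.smul (hM.add hS)
  · simp only [hZ]
    refine (continuous_ex σ).continuousOn.smul (continuousOn_const.smul
      (ContinuousOn.mul (ContinuousOn.sub ?_ hqc) (hM.sub hS)))
    fun_prop
  · rw [show Y x = fun ρ => ex σ ρ x • (M x ρ + S x ρ) from funext (hY x)]
    exact (differentiable_ex σ x).differentiableOn.smul ((hM' x hx).add (hS' x hx))
  · rw [show Z x = _ from funext (hZ x)]
    have h1 : DifferentiableOn ℂ (fun ρ : ℂ => (Complex.I * ρ) • (1 : R) - q x) (openDomain r) := by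
      fun_prop
    exact (differentiable_ex σ x).differentiableOn.smul
      ((h1.mul ((hM' x hx).sub (hS' x hx))).const_smul (sgn σ))
  · exact hL.sum.congr fun ρ _ x _ => by rw [hYe]
  · refine (hL.derivative hr (fun x hx => h.norm_q_le_mass hα hx)
      fun x hx => hT x (hα.trans hx)).congr fun ρ _ x _ => ?_
    rw [mul_smul, hZe, smul_smul, sgn_mul_self, one_smul]
  · exact (hL.sum_lim hρ).congr fun x => by rw [hYe]
  · refine (hL.derivative_lim hr (fun x hx => hP x (hα.trans hx)) h.tendsto_q hρ).congr fun x => ?_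
    have hσ : sgn σ ≠ 0 := left_ne_zero_of_mul_eq_one (sgn_mul_self σ)
    rw [mul_smul _ (ex σ ρ x)⁻¹, hZe, smul_smul]
    congr 2
    rw [mul_assoc, mul_inv (sgn σ), mul_right_comm, inv_mul_cancel₀ hσ, one_mul]

end Asymptotic

/-! ### The recessive and the dominant solution -/

section Solutions

variable {R : Type*} [NormedRing R] [NormedAlgebra ℂ R] {C α r : ℝ}
  {q dq v pm im pp ip : ℝ → R}

theorem tendsto_mul_integral_expKernel {P j g : ℝ → R}
    (hα : 0 ≤ α) (hP : ∀ x, 0 ≤ x → ‖P x‖ ≤ C) (hj : ContinuousOn j (Ici 0))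
    (hjC : ∀ x, 0 ≤ x → ‖j x‖ ≤ C) (hg : IntegrableOn g (Ici α) volume) {ε ω : ℝ} {c ρ : ℂ}
    (hω : 0 ≤ ω) (hc : ‖c‖ ≤ 1) (hρ : 0 ≤ ρ.im) (hε : ε = 1 ∨ (ε = -1 ∧ 0 < ω ∧ 0 < ρ.im)) :
    Tendsto (fun x => P x * ∫ s in Ici α, expKernel ε ω c x s ρ • (j s * g s)) atTop (𝓝 0) := by
  have h1 := tendsto_integral_expKernel_zero hω hc hρ hε
    (integrableOn_bdd_mul (hj.mono (Ici_subset_Ici.2 hα)) (fun x hx => hjC x (hα.trans hx)) hg)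
  have h2 := h1.norm.const_mul C
  rw [norm_zero, mul_zero] at h2
  refine squeeze_zero_norm' ?_ h2
  filter_upwards [eventually_ge_atTop 0] with x hx
  exact (norm_mul_le _ _).trans (mul_le_mul_of_nonneg_right (hP x hx) (norm_nonneg _))

/-- The solution recessive in the upper half-plane. -/
theorem WKBData.exists_recessive [CompleteSpace R] (h : WKBData C q dq v pm im pp ip) (hα : 0 ≤ α)
    (hr : 0 < r)
    (hm : 8 * C ^ 2 * mass q dq v α ≤ r) :
    ∃ a b Y Z : ℝ → ℂ → R, (IsPencilSolution q v α r Y Z ∧ IsAsymptotic q α r 1 pm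
      (IsPropagator.correction pm im fun s => (2 * Complex.I)⁻¹ • (dq s - q s * q s - v s)) Y Z) ∧
      (∀ ρ ∈ closedDomain r, ‖a α ρ - 1‖ ≤ 1 / 3) ∧
      (∀ x ρ, Y x ρ = ex 1 ρ x • (pm x * a x ρ + pp x * b x ρ)) ∧
      (∀ x ρ, Z x ρ = ex 1 ρ x • (((Complex.I * ρ) • (1 : R) - q x) *
        (pm x * a x ρ - pp x * b x ρ))) := by
  -- With phase e^{iρx}, a' carries no exponential and b' carries −2iρb. Integrating both from
  -- infinity gives a → 1 and the bounded factor e^{2iρ(s−x)} in b.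
  have hk₁ : IsScalarKernel (expKernel 1 0 (-1)) :=
    expKernel_isScalarKernel one_ne_zero le_rfl (by simp)
  have hk₂ : IsScalarKernel (expKernel 1 1 1) :=
    expKernel_isScalarKernel one_ne_zero zero_le_one (by simp)
  obtain ⟨a, b, f, H⟩ := h.exists_amplitude (e := (1, 0)) hα hr hm hk₁ hk₂
    (by simpa [Prod.norm_def] using h.norm_one_le)
  obtain ⟨D, hD⟩ := H.approx
  have hsub : Ici α ⊆ Ici 0 := Ici_subset_Ici.2 hα
  have hpm := h.prop_m.deriv.continuousOn
  have hpp := h.prop_p.deriv.continuousOn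
  have him := h.prop_m.deriv_inv.continuousOn
  have hip := h.prop_p.deriv_inv.continuousOn
  have hpmc : ContinuousOn (fun p : ℝ × ℂ => pm p.1) (Ici α ×ˢ closedDomain r) :=
    hpm.comp continuousOn_fst fun p hp => hα.trans hp.1
  have hppc : ContinuousOn (fun p : ℝ × ℂ => pp p.1) (Ici α ×ˢ closedDomain r) :=
    hpp.comp continuousOn_fst fun p hp => hα.trans hp.1
  have hn : IntegrableOn (fun s => (2 * Complex.I)⁻¹ • coefM q dq v pm s) (Ici α) volume :=
    (h.int_coefM.mono_set hsub).smul (2 * Complex.I)⁻¹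
  have happ : ∀ s, α ≤ s → ∀ ρ ∈ closedDomain r,
      ‖ρ • f s ρ - (2 * Complex.I)⁻¹ • coefM q dq v pm s‖ ≤ D / ‖ρ‖ * density q dq v s :=
    fun s hs ρ hρ => by simpa using hD s hs ρ hρ
  have hw : IntegrableOn (fun s => (2 * Complex.I)⁻¹ • (dq s - q s * q s - v s)) (Ici 0) volume :=
    ((h.int_dq.sub h.int_sq).sub h.int_v).smul (2 * Complex.I)⁻¹
  have heq_a : ∀ x, α ≤ x → ∀ ρ ∈ closedDomain r, a x ρ = 1 +
      ∫ s in Ici α, expKernel 1 0 (-1) x s ρ • (im s * f s ρ) := H.eq_a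
  have heq_b : ∀ x, α ≤ x → ∀ ρ ∈ closedDomain r, b x ρ =
      ∫ s in Ici α, expKernel 1 1 1 x s ρ • (ip s * f s ρ) := fun x hx ρ hρ =>
    (H.eq_b x hx ρ hρ).trans (zero_add _)
  have hfm : ∀ ρ ∈ closedDomain r, IntegrableOn (fun s => im s * f s ρ) (Ici α) volume :=
    fun ρ hρ => integrableOn_bdd_mul (him.mono hsub)
      (fun x hx => h.prop_m.bound_inv x (hα.trans hx)) (H.int_f ρ hρ)
  have hfp : ∀ ρ ∈ closedDomain r, IntegrableOn (fun s => ip s * f s ρ) (Ici α) volume :=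
    fun ρ hρ => integrableOn_bdd_mul (hip.mono hsub)
      (fun x hx => h.prop_p.bound_inv x (hα.trans hx)) (H.int_f ρ hρ)
  have hL : HasLeadingForm α r pm
      (IsPropagator.correction pm im fun s => (2 * Complex.I)⁻¹ • (dq s - q s * q s - v s))
      (fun x ρ => pm x * a x ρ) (fun x ρ => pp x * b x ρ) := by
    refine ⟨h.unifSmall_main hα hr (c := -1) (by simp) h.prop_m.bound him h.prop_m.bound_inv
      H.int_f hn happ (fun x _ => ?_) heq_a, ?_, fun ρ hρ => ?_, fun ρ hρ => ?_⟩
    · rw [IsPropagator.correction, neg_smul, one_smul, mul_neg]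
      simp only [coefM, mul_smul_comm, smul_mul_assoc, mul_assoc]
    · refine ((h.unifSmall_oscillating hα hr (Or.inl rfl) hip h.prop_p.bound_inv H.int_f hn
        happ).bdd_mul fun x hx => h.prop_p.bound x (hα.trans hx)).congr fun ρ hρ x hx => ?_
      rw [heq_b x hx ρ hρ, mul_smul_comm]
    · refine (tendsto_mul_integral_expKernel hα h.prop_m.bound him h.prop_m.bound_inv
        (H.int_f ρ (openDomain_subset r hρ)) (c := -1) le_rfl (by simp) hρ.1.le
        (Or.inl rfl)).congr' ?_
      filter_upwards [eventually_ge_atTop α] with x hx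
      rw [heq_a x hx ρ (openDomain_subset r hρ), mul_add, mul_one, add_sub_cancel_left]
    · refine (tendsto_mul_integral_expKernel hα h.prop_p.bound hip h.prop_p.bound_inv
        (H.int_f ρ (openDomain_subset r hρ)) (c := 1) zero_le_one (by simp) hρ.1.le
        (Or.inl rfl)).congr' ?_
      filter_upwards [eventually_ge_atTop α] with x hx
      rw [heq_b x hx ρ (openDomain_subset r hρ)]
  obtain ⟨D', hD'⟩ := h.prop_m.correction_bound hw
  have hode : ∀ ρ ∈ closedDomain r, _ := fun ρ hρ =>
    h.hasACDeriv_solution (ρ := ρ) (κ := Complex.I * ρ) (a := fun x => a x ρ) (b := fun x => b x ρ)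
      (f := fun x => f x ρ) hα
      ((((HasACDeriv.const (1 : R)).add
        (hasACDeriv_expKernel_forward (c := -1) hα le_rfl hρ.1 (hfm ρ hρ))).congr
          fun x hx => heq_a x hx ρ hρ).congr_deriv fun x hx => by simp)
      (((hasACDeriv_expKernel_forward (c := 1) hα zero_le_one hρ.1 (hfp ρ hρ)).congr
          fun x hx => heq_b x hx ρ hρ).congr_deriv fun x hx => by
            rw [heq_b x hx.le ρ hρ, one_smul]
            push_cast
            congr 2
            ring)
      (fun s hs => H.char_f s hs ρ hρ)
  have hex : ∀ (x : ℝ) (ρ : ℂ), Complex.exp (Complex.I * ρ * x) = ex 1 ρ x := fun x ρ => by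
    simp [ex, sgn]
  simp only [hex] at hode
  refine ⟨a, b, _, _, hL.isPencilSolution_isAsymptotic h hα hr 1 h.prop_m.bound hD' (hpmc.mul H.cont_a)
    (hppc.mul H.cont_b) (fun x hx => (H.diff_a x hx).const_mul _)
    (fun x hx => (H.diff_b x hx).const_mul _) (fun _ _ => rfl) (fun _ _ => ?_)
    (fun ρ hρ => (hode ρ hρ).1) (fun ρ hρ => (hode ρ hρ).2),
    fun ρ hρ => H.norm_a α le_rfl ρ hρ, fun _ _ => rfl, fun _ _ => rfl⟩
  simp [sgn]

/-- The solution dominant in the upper half-plane. -/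
theorem WKBData.exists_dominant [CompleteSpace R] (h : WKBData C q dq v pm im pp ip) (hα : 0 ≤ α)
    (hr : 0 < r)
    (hm : 8 * C ^ 2 * mass q dq v α ≤ r) :
    ∃ b Y Z : ℝ → ℂ → R, (IsPencilSolution q v α r Y Z ∧ IsAsymptotic q α r (-1) pp
      (IsPropagator.correction pp ip fun s => (2 * Complex.I)⁻¹ • (dq s + q s * q s + v s)) Y Z) ∧
      (∀ ρ ∈ closedDomain r, ‖b α ρ - 1‖ ≤ 1 / 3) ∧
      (∀ ρ ∈ closedDomain r, Y α ρ = ex (-1) ρ α • (pp α * b α ρ)) ∧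
      (∀ ρ ∈ closedDomain r, Z α ρ = -(ex (-1) ρ α • (((Complex.I * ρ) • (1 : R) - q α) *
        (pp α * b α ρ)))) := by
  -- With phase e^{−iρx}, a' carries +2iρa, so a is integrated from α to keep the factor
  -- e^{2iρ(x−s)} bounded; b is integrated from infinity and tends to 1.
  have hk₁ : IsScalarKernel (expKernel (-1) 1 1) :=
    expKernel_isScalarKernel (by norm_num) zero_le_one (by simp)
  have hk₂ : IsScalarKernel (expKernel 1 0 1) :=
    expKernel_isScalarKernel one_ne_zero le_rfl (by simp)
  obtain ⟨a, b, f, H⟩ := h.exists_amplitude (e := (0, 1)) hα hr hm hk₁ hk₂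
    (by simpa [Prod.norm_def] using h.norm_one_le)
  obtain ⟨D, hD⟩ := H.approx
  have hsub : Ici α ⊆ Ici 0 := Ici_subset_Ici.2 hα
  have hpm := h.prop_m.deriv.continuousOn
  have hpp := h.prop_p.deriv.continuousOn
  have him := h.prop_m.deriv_inv.continuousOn
  have hip := h.prop_p.deriv_inv.continuousOn
  have hpmc : ContinuousOn (fun p : ℝ × ℂ => pm p.1) (Ici α ×ˢ closedDomain r) :=
    hpm.comp continuousOn_fst fun p hp => hα.trans hp.1
  have hppc : ContinuousOn (fun p : ℝ × ℂ => pp p.1) (Ici α ×ˢ closedDomain r) :=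
    hpp.comp continuousOn_fst fun p hp => hα.trans hp.1
  have hn : IntegrableOn (fun s => (2 * Complex.I)⁻¹ • coefP q dq v pp s) (Ici α) volume :=
    (h.int_coefP.mono_set hsub).smul (2 * Complex.I)⁻¹
  have happ : ∀ s, α ≤ s → ∀ ρ ∈ closedDomain r,
      ‖ρ • f s ρ - (2 * Complex.I)⁻¹ • coefP q dq v pp s‖ ≤ D / ‖ρ‖ * density q dq v s :=
    fun s hs ρ hρ => by simpa using hD s hs ρ hρ
  have hw : IntegrableOn (fun s => (2 * Complex.I)⁻¹ • (dq s + q s * q s + v s)) (Ici 0) volume :=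
    ((h.int_dq.add h.int_sq).add h.int_v).smul (2 * Complex.I)⁻¹
  have heq_a : ∀ x, α ≤ x → ∀ ρ ∈ closedDomain r, a x ρ =
      ∫ s in Ici α, expKernel (-1) 1 1 x s ρ • (im s * f s ρ) := fun x hx ρ hρ =>
    (H.eq_a x hx ρ hρ).trans (zero_add _)
  have heq_b : ∀ x, α ≤ x → ∀ ρ ∈ closedDomain r, b x ρ = 1 +
      ∫ s in Ici α, expKernel 1 0 1 x s ρ • (ip s * f s ρ) := H.eq_b
  -- Integration starting at α makes this amplitude vanish there, which later allows elimination in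
  -- the initial data.
  have ha0 : ∀ ρ ∈ closedDomain r, a α ρ = 0 := fun ρ hρ => by
    rw [heq_a α le_rfl ρ hρ, integral_expKernel_backward _ _ _ le_rfl,
      intervalIntegral.integral_same]
  have hfm : ∀ ρ ∈ closedDomain r, IntegrableOn (fun s => im s * f s ρ) (Ici α) volume :=
    fun ρ hρ => integrableOn_bdd_mul (him.mono hsub)
      (fun x hx => h.prop_m.bound_inv x (hα.trans hx)) (H.int_f ρ hρ)
  have hfp : ∀ ρ ∈ closedDomain r, IntegrableOn (fun s => ip s * f s ρ) (Ici α) volume :=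
    fun ρ hρ => integrableOn_bdd_mul (hip.mono hsub)
      (fun x hx => h.prop_p.bound_inv x (hα.trans hx)) (H.int_f ρ hρ)
  have hL : HasLeadingForm α r pp
      (IsPropagator.correction pp ip fun s => (2 * Complex.I)⁻¹ • (dq s + q s * q s + v s))
      (fun x ρ => pp x * b x ρ) (fun x ρ => pm x * a x ρ) := by
    refine ⟨h.unifSmall_main hα hr (c := 1) (by simp) h.prop_p.bound hip h.prop_p.bound_inv
      H.int_f hn happ (fun x _ => ?_) heq_b, ?_, fun ρ hρ => ?_, fun ρ hρ => ?_⟩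
    · rw [IsPropagator.correction, one_smul, ← mul_neg, ← integral_neg]
      simp only [coefP, mul_smul_comm, smul_mul_assoc, mul_assoc, smul_neg, mul_neg]
    · refine ((h.unifSmall_oscillating hα hr (Or.inr rfl) him h.prop_m.bound_inv H.int_f hn
        happ).bdd_mul fun x hx => h.prop_m.bound x (hα.trans hx)).congr fun ρ hρ x hx => ?_
      rw [heq_a x hx ρ hρ, mul_smul_comm]
    · refine (tendsto_mul_integral_expKernel hα h.prop_p.bound hip h.prop_p.bound_inv
        (H.int_f ρ (openDomain_subset r hρ)) (c := 1) le_rfl (by simp) hρ.1.le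
        (Or.inl rfl)).congr' ?_
      filter_upwards [eventually_ge_atTop α] with x hx
      rw [heq_b x hx ρ (openDomain_subset r hρ), mul_add, mul_one, add_sub_cancel_left]
    · refine (tendsto_mul_integral_expKernel hα h.prop_m.bound him h.prop_m.bound_inv
        (H.int_f ρ (openDomain_subset r hρ)) (c := 1) zero_le_one (by simp) hρ.1.le
        (Or.inr ⟨rfl, one_pos, hρ.1⟩)).congr' ?_
      filter_upwards [eventually_ge_atTop α] with x hx
      rw [heq_a x hx ρ (openDomain_subset r hρ)]
  obtain ⟨D', hD'⟩ := h.prop_p.correction_bound hw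
  have hode : ∀ ρ ∈ closedDomain r, _ := fun ρ hρ =>
    h.hasACDeriv_solution (ρ := ρ) (κ := -(Complex.I * ρ)) (a := fun x => a x ρ)
      (b := fun x => b x ρ) (f := fun x => f x ρ) hα
      (((hasACDeriv_expKernel_backward (ω := 1) (c := 1) (ρ := ρ) (hfm ρ hρ)).congr
          fun x hx => heq_a x hx ρ hρ).congr_deriv fun x hx => by
            rw [heq_a x hx.le ρ hρ, one_smul]
            push_cast
            congr 2
            ring)
      ((((HasACDeriv.const (1 : R)).add
        (hasACDeriv_expKernel_forward (c := 1) hα le_rfl hρ.1 (hfp ρ hρ))).congr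
          fun x hx => heq_b x hx ρ hρ).congr_deriv fun x hx => by simp)
      (fun s hs => H.char_f s hs ρ hρ)
  have hex : ∀ (x : ℝ) (ρ : ℂ), Complex.exp (-(Complex.I * ρ) * x) = ex (-1) ρ x := fun x ρ => by
    simp [ex, sgn]
  simp only [hex] at hode
  refine ⟨b, _, _, hL.isPencilSolution_isAsymptotic h hα hr (-1) h.prop_p.bound hD' (hppc.mul H.cont_b)
    (hpmc.mul H.cont_a) (fun x hx => (H.diff_b x hx).const_mul _)
    (fun x hx => (H.diff_a x hx).const_mul _) (fun _ _ => ?_) (fun _ _ => ?_)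
    (fun ρ hρ => (hode ρ hρ).1) (fun ρ hρ => (hode ρ hρ).2),
    fun ρ hρ => H.norm_b α le_rfl ρ hρ, fun ρ hρ => ?_, fun ρ hρ => ?_⟩
  · rw [add_comm]
  · simp only [sgn, Units.val_neg, Units.val_one, Int.cast_neg, Int.cast_one, neg_smul, one_smul]
    rw [← mul_neg, neg_sub]
  · simp only [ha0 ρ hρ, mul_zero, zero_add]
  · simp only [ha0 ρ hρ, mul_zero, zero_sub, mul_neg, smul_neg]

end Solutions

/-! ### Fundamental matrices in finite dimension -/

section Vector

variable {V : Type*} [NormedAddCommGroup V] [NormedSpace ℂ V]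
  {M Φ Ψ : ℝ → ℂ → (V →L[ℂ] V)}

namespace IsFundamentalPair

theorem inv_apply_eq (h : IsFundamentalPair M Φ Ψ) {a : ℝ} (ha : 0 ≤ a) {ρ : ℂ} {z : ℝ → V}
    (hz : HasACDeriv a z (fun x => M x ρ (z x))) {x : ℝ} (hx : a ≤ x) :
    Ψ x ρ (z x) = Ψ a ρ (z a) :=
  (((h.deriv' ρ).mono ha).clm_apply hz).eq_of_deriv_zero (fun x _ => by simp) x hx

/-- In finite dimension a left inverse of an endomorphism is also a right inverse. -/
theorem apply_inv [FiniteDimensional ℂ V] (h : IsFundamentalPair M Φ Ψ) {x : ℝ} (hx : 0 ≤ x)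
    (ρ : ℂ) (w : V) : Φ x ρ (Ψ x ρ w) = w := by
  have h1 : (Ψ x ρ : V →ₗ[ℂ] V) * (Φ x ρ : V →ₗ[ℂ] V) = 1 := by
    ext w
    exact DFunLike.congr_fun (h.inv_mul x hx ρ) w
  exact DFunLike.congr_fun (mul_eq_one_comm.1 h1) w

theorem eq_apply [FiniteDimensional ℂ V] (h : IsFundamentalPair M Φ Ψ) {a : ℝ} (ha : 0 ≤ a)
    {ρ : ℂ} {z : ℝ → V} (hz : HasACDeriv a z (fun x => M x ρ (z x))) {x : ℝ} (hx : a ≤ x) :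
    Φ x ρ (Ψ a ρ (z a)) = z x := by
  rw [← h.inv_apply_eq ha hz hx, h.apply_inv (ha.trans hx)]

theorem eq_zero [FiniteDimensional ℂ V] (h : IsFundamentalPair M Φ Ψ) {a : ℝ} (ha : 0 ≤ a)
    {ρ : ℂ} {z : ℝ → V} (hz : HasACDeriv 0 z (fun x => M x ρ (z x))) (hza : z a = 0) {x : ℝ}
    (hx : 0 ≤ x) : z x = 0 := by
  rw [← h.eq_apply le_rfl hz hx, ← h.inv_apply_eq le_rfl hz ha, hza, map_zero, map_zero]

end IsFundamentalPair

end Vector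

/-! ### First order system: continuation to [0, α] and the basis property -/

section Companion

variable {R : Type*} [NormedRing R] [NormedAlgebra ℂ R]

/-- The matrix of the first order system for `Y'' + w Y = 0`. -/
def companion (w : R) : R × R →L[ℂ] R × R :=
  ContinuousLinearMap.inl ℂ R R ∘L ContinuousLinearMap.snd ℂ R R -
    ContinuousLinearMap.inr ℂ R R ∘L
      (ContinuousLinearMap.mul ℂ R w ∘L ContinuousLinearMap.fst ℂ R R)

theorem companion_apply (w : R) (z : R × R) : companion w z = (z.2, -(w * z.1)) := by
  simp [companion]

theorem norm_companion_le (w : R) : ‖companion w‖ ≤ 1 + ‖w‖ := by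
  refine ContinuousLinearMap.opNorm_le_bound _ (by positivity) fun z => ?_
  rw [companion_apply, Prod.norm_def, add_mul, one_mul]
  have h1 := norm_fst_le z
  have h2 := norm_snd_le z
  have h3 : ‖w * z.1‖ ≤ ‖w‖ * ‖z‖ := (norm_mul_le _ _).trans (by gcongr)
  have h4 : 0 ≤ ‖w‖ * ‖z‖ := by positivity
  refine max_le ?_ ?_
  · simp only; linarith
  · simp only [norm_neg]; linarith [norm_nonneg z]

theorem differentiable_companion : Differentiable ℂ (companion : R → _) := by
  have h1 : Differentiable ℂ fun w : R =>
      ContinuousLinearMap.mul ℂ R w ∘L ContinuousLinearMap.fst ℂ R R :=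
    differentiable_mul_comp differentiable_id (differentiable_const _)
  exact (differentiable_const _).sub
    ((ContinuousLinearMap.compL ℂ (R × R) R (R × R)
      (ContinuousLinearMap.inr ℂ R R)).differentiable.comp h1)

/-- The potential `ρ² + 2 i ρ q + v` of the pencil. -/
def pencil (q v : ℝ → R) (x : ℝ) (ρ : ℂ) : R :=
  ρ ^ 2 • (1 : R) + (2 * Complex.I * ρ) • q x + v x

/-- The first order system is entire in ρ and locally integrable in x, so its fundamental pair
exists for every ρ, with no lower bound on |ρ|. -/
theorem isVolterraCoeff_companion {q v : ℝ → R} (h1 : ‖(1 : R)‖ ≤ 1)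
    (hq : IntegrableOn q (Ici 0) volume) (hv : IntegrableOn v (Ici 0) volume) :
    IsVolterraCoeff (fun x ρ => companion (pencil q v x ρ)) (fun x => 1 + ‖q x‖ + ‖v x‖)
      (fun ρ => (1 + ‖ρ‖) ^ 2) where
  g_nonneg s := by positivity
  g_int b := by
    have hs : Icc (0 : ℝ) b ⊆ Ici 0 := Icc_subset_Ici_self
    exact ((integrableOn_const (by simp)).add (hq.mono_set hs).norm).add (hv.mono_set hs).norm
  c_nonneg ρ := by positivity
  c_cont := by fun_prop
  bound s ρ _ := by
    refine (norm_companion_le _).trans ?_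
    have h2 : ‖pencil q v s ρ‖ ≤ ‖ρ‖ ^ 2 * 1 + 2 * ‖ρ‖ * ‖q s‖ + ‖v s‖ := by
      refine (norm_add_le _ _).trans (add_le_add ((norm_add_le _ _).trans
        (add_le_add ?_ ?_)) le_rfl)
      · rw [norm_smul, norm_pow]; gcongr
      · rw [norm_smul]; simp
    have h3 := norm_nonneg ρ
    have h4 := norm_nonneg (q s)
    have h5 := norm_nonneg (v s)
    have h6 : 0 ≤ ‖ρ‖ ^ 2 * ‖q s‖ := by positivity
    have h7 : 0 ≤ ‖ρ‖ ^ 2 * ‖v s‖ := by positivity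
    have h8 : 0 ≤ ‖ρ‖ * ‖v s‖ := by positivity
    nlinarith
  meas ρ := differentiable_companion.continuous.comp_aestronglyMeasurable
    ((aestronglyMeasurable_const.add (hq.aestronglyMeasurable.const_smul _)).add
      hv.aestronglyMeasurable)
  diff s := by
    have h2 : Differentiable ℂ (pencil q v s) := by unfold pencil; fun_prop
    exact Differentiable.comp (g := companion) differentiable_companion h2

theorem HasACDeriv.prodMk_companion {q v y y' : ℝ → R} {a : ℝ} {ρ : ℂ} (hy : HasACDeriv a y y')
    (hy' : HasACDeriv a y' (fun x => -(pencil q v x ρ * y x))) :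
    HasACDeriv a (fun x => (y x, y' x)) (fun x => companion (pencil q v x ρ) (y x, y' x)) :=
  (hy.prodMk hy').congr_deriv fun x _ =>
    (companion_apply (pencil q v x ρ) (y x, y' x)).symm

variable {q v : ℝ → R} {α r : ℝ} {Y Z : ℝ → ℂ → R}
  {Φ Ψ : ℝ → ℂ → (R × R →L[ℂ] R × R)}

theorem IsAsymptotic.congr {σ : ℤˣ} {P T : ℝ → R} {E E' : ℝ → ℂ → R}
    (h : IsAsymptotic q α r σ P T Y Z)
    (hE : ∀ x, α ≤ x → ∀ ρ ∈ closedDomain r, E x ρ = Y x ρ ∧ E' x ρ = Z x ρ) :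
    IsAsymptotic q α r σ P T E E' := by
  refine ⟨h.leading.congr fun ρ hρ x hx => by rw [(hE x hx ρ hρ).1],
    h.leading'.congr fun ρ hρ x hx => by rw [(hE x hx ρ hρ).2],
    fun ρ hρ => (h.lim ρ hρ).congr' ?_, fun ρ hρ => (h.lim' ρ hρ).congr' ?_⟩
  · filter_upwards [eventually_ge_atTop α] with x hx
    rw [(hE x hx ρ (openDomain_subset r hρ)).1]
  · filter_upwards [eventually_ge_atTop α] with x hx
    rw [(hE x hx ρ (openDomain_subset r hρ)).2]

/-- The data at α are carried along by Φ(x)Ψ(α), which is entire in ρ, so continuity and holomorphy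
at α persist for all x ≥ 0. Thus the contraction is needed on [α, ∞) only and the threshold may
shrink with α. -/
theorem IsPencilSolution.exists_extension [FiniteDimensional ℂ R]
    (hF : IsFundamentalPair (fun x ρ => companion (pencil q v x ρ)) Φ Ψ) (hα : 0 ≤ α)
    (h : IsPencilSolution q v α r Y Z) :
    ∃ E E' : ℝ → ℂ → R, IsPencilSolution q v 0 r E E' ∧
      ∀ x, α ≤ x → ∀ ρ ∈ closedDomain r, E x ρ = Y x ρ ∧ E' x ρ = Z x ρ := by
  have hc0 : ContinuousOn (fun p : ℝ × ℂ => (Y α p.2, Z α p.2)) (Ici 0 ×ˢ closedDomain r) :=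
    (h.cont.comp (f := fun p : ℝ × ℂ => (α, p.2)) (by fun_prop) fun p hp => ⟨mem_Ici.2 (le_refl α), hp.2⟩).prodMk
      (h.cont'.comp (f := fun p : ℝ × ℂ => (α, p.2)) (by fun_prop) fun p hp => ⟨mem_Ici.2 (le_refl α), hp.2⟩)
  have hc1 : ContinuousOn (fun p : ℝ × ℂ => Ψ α p.2) (Ici 0 ×ˢ closedDomain r) :=
    hF.cont'.comp (f := fun p : ℝ × ℂ => (α, p.2)) (by fun_prop) fun p _ => ⟨hα, mem_univ _⟩
  have hc2 : ContinuousOn (fun p : ℝ × ℂ => Φ p.1 p.2) (Ici 0 ×ˢ closedDomain r) :=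
    hF.cont.mono (prod_mono le_rfl (subset_univ _))
  have hc := hc2.clm_apply (hc1.clm_apply hc0)
  have hd : ∀ x, 0 ≤ x → DifferentiableOn ℂ (fun ρ => Φ x ρ (Ψ α ρ (Y α ρ, Z α ρ)))
      (openDomain r) := fun x hx => (hF.diff x hx).differentiableOn.clm_apply
    ((hF.diff' α hα).differentiableOn.clm_apply ((h.diff α le_rfl).prodMk (h.diff' α le_rfl)))
  have hz : ∀ ρ, HasACDeriv 0 (fun x => Φ x ρ (Ψ α ρ (Y α ρ, Z α ρ)))
      (fun x => companion (pencil q v x ρ) (Φ x ρ (Ψ α ρ (Y α ρ, Z α ρ)))) := fun ρ =>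
    ((hF.deriv ρ).clm_apply (HasACDeriv.const (Ψ α ρ (Y α ρ, Z α ρ)))).congr_deriv
      fun x _ => by simp
  refine ⟨fun x ρ => (Φ x ρ (Ψ α ρ (Y α ρ, Z α ρ))).1, fun x ρ => (Φ x ρ (Ψ α ρ (Y α ρ, Z α ρ))).2,
    ⟨hc.fst, hc.snd, fun x hx => (hd x hx).fst, fun x hx => (hd x hx).snd,
      fun ρ _ => ?_, fun ρ _ => ?_⟩, fun x hx ρ hρ => ?_⟩
  · exact ((hz ρ).clm_comp (ContinuousLinearMap.fst ℂ R R)).congr_deriv fun x _ => by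
      simp [companion_apply]
  · exact ((hz ρ).clm_comp (ContinuousLinearMap.snd ℂ R R)).congr_deriv fun x _ => by
      simp [companion_apply, pencil]
  · have := hF.eq_apply hα (HasACDeriv.prodMk_companion (h.deriv ρ hρ) (h.deriv' ρ hρ)) hx
    simp [this]

/-- Adding the first equation to A⁻¹ times the second cancels t and w and leaves 2s times the first
unknown; the second unknown follows from w. So nothing need be known about t. -/
theorem existsUnique_of_isUnit {R : Type*} [Ring R] [Algebra ℂ R] {A s t w : R} (hA : IsUnit A)
    (hs : IsUnit s) (hw : IsUnit w) (y y' : R) :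
    ∃! c : R × R, (s + t) * c.1 + w * c.2 = y ∧ A * (s - t) * c.1 + -(A * w) * c.2 = y' := by
  obtain ⟨A, rfl⟩ := hA
  obtain ⟨s, rfl⟩ := hs
  obtain ⟨w, rfl⟩ := hw
  have key : ∀ c : R × R, ((s + t) * c.1 + w * c.2 = y ∧
      A * (s - t) * c.1 + -(A * w) * c.2 = y') ↔
      (c.1 = (1 / 2 : ℂ) • (↑s⁻¹ * (y + ↑A⁻¹ * y')) ∧ c.2 = ↑w⁻¹ * (y - (s + t) * c.1)) := by
    intro c
    have h1 : A * (s - t) * c.1 + -(A * w) * c.2 = y' ↔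
        (s - t) * c.1 - w * c.2 = ↑A⁻¹ * y' := by
      have h0 : ↑A * ((s - t) * c.1 - w * c.2) = A * (s - t) * c.1 + -(A * w) * c.2 := by
        noncomm_ring
      rw [Units.eq_inv_mul_iff_mul_eq, h0]
    have h2 : c.2 = ↑w⁻¹ * (y - (s + t) * c.1) ↔ (s + t) * c.1 + w * c.2 = y := by
      rw [Units.eq_inv_mul_iff_mul_eq, eq_sub_iff_add_eq']
    rw [h1, h2, and_comm]
    refine and_congr_left fun h3 => ?_
    have h5 : ∀ u : R, c.1 = ↑s⁻¹ * u ↔ s * c.1 = u := fun u => by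
      rw [Units.eq_inv_mul_iff_mul_eq]
    rw [← mul_smul_comm, h5, ← h3]
    have h4 : (1 / 2 : ℂ) • ((s + t) * c.1 + w * c.2 + ↑A⁻¹ * y') =
        s * c.1 + (1 / 2 : ℂ) • (↑A⁻¹ * y' - ((s - t) * c.1 - w * c.2)) := by
      rw [add_mul, sub_mul]; module
    rw [h4, left_eq_add, smul_eq_zero_iff_right (by norm_num), sub_eq_zero]
    exact eq_comm
  refine ⟨((1 / 2 : ℂ) • (↑s⁻¹ * (y + ↑A⁻¹ * y')), ↑w⁻¹ * (y - (s + t) *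
    ((1 / 2 : ℂ) • (↑s⁻¹ * (y + ↑A⁻¹ * y'))))), (key _).2 ⟨rfl, rfl⟩, fun c hc => ?_⟩
  obtain ⟨h1, h2⟩ := (key c).1 hc
  rw [h1] at h2
  exact Prod.ext h1 h2

theorem isUnit_of_norm_sub_one_le {R : Type*} [NormedRing R] [CompleteSpace R] {a : R}
    (ha : ‖a - 1‖ ≤ 1 / 3) : IsUnit a := by
  have h1 : ‖1 - a‖ < 1 := by rw [norm_sub_rev]; linarith
  simpa using (Units.oneSub (1 - a) h1).isUnit

/-- A solution is determined by its value and derivative at α, where the coefficients are matched.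
For uniqueness, equality of functions on the half-line gives equality of their derivatives at α. -/
theorem existsUnique_combination {Y₁ Z₁ Y₂ Z₂ : ℝ → ℂ → R} [CompleteSpace R]
    [FiniteDimensional ℂ R]
    (hF : IsFundamentalPair (fun x ρ => companion (pencil q v x ρ)) Φ Ψ) (hα : 0 ≤ α)
    (h₁ : IsPencilSolution q v 0 r Y₁ Z₁) (h₂ : IsPencilSolution q v 0 r Y₂ Z₂) {ρ : ℂ}
    (hρ : ρ ∈ closedDomain r)
    (hdata : ∀ y y' : R, ∃! c : R × R, Y₁ α ρ * c.1 + Y₂ α ρ * c.2 = y ∧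
      Z₁ α ρ * c.1 + Z₂ α ρ * c.2 = y') {y y' : ℝ → R} (hy : HasACDeriv 0 y y')
    (hy' : HasACDeriv 0 y' (fun x => -(pencil q v x ρ * y x))) :
    ∃! c : R × R, ∀ x, 0 ≤ x → y x = Y₁ x ρ * c.1 + Y₂ x ρ * c.2 := by
  have hmul : ∀ {F f : ℝ → R} (c : R), HasACDeriv 0 F f →
      HasACDeriv 0 (fun x => F x * c) (fun x => f x * c) := fun c h =>
    (h.mul (HasACDeriv.const c)).congr_deriv fun x _ => by simp
  have hD : ∀ c : R × R, HasACDeriv 0 (fun x => Y₁ x ρ * c.1 + Y₂ x ρ * c.2)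
      (fun x => Z₁ x ρ * c.1 + Z₂ x ρ * c.2) := fun c =>
    (hmul c.1 (h₁.deriv ρ hρ)).add (hmul c.2 (h₂.deriv ρ hρ))
  have hD' : ∀ c : R × R, HasACDeriv 0 (fun x => Z₁ x ρ * c.1 + Z₂ x ρ * c.2)
      (fun x => -(pencil q v x ρ * (Y₁ x ρ * c.1 + Y₂ x ρ * c.2))) := fun c =>
    ((hmul c.1 (h₁.deriv' ρ hρ)).add (hmul c.2 (h₂.deriv' ρ hρ))).congr_deriv fun x _ => by
      simp only [pencil]; noncomm_ring
  obtain ⟨c, ⟨hc, hc'⟩, hu⟩ := hdata (y α) (y' α)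
  refine ⟨c, fun x hx => ?_, fun d hd => hu d ⟨(hd α hα).symm, ?_⟩⟩
  · have hz := HasACDeriv.prodMk_companion (q := q) (v := v) (ρ := ρ) (hy.sub (hD c))
      ((hy'.sub (hD' c)).congr_deriv fun x _ => by rw [mul_sub]; abel)
    have h0 := hF.eq_zero hα hz (by rw [hc, hc', sub_self, sub_self]; rfl) hx
    exact sub_eq_zero.1 (congrArg Prod.fst h0)
  · have e1 := (hD d).hasDerivWithinAt (hD' d).continuousOn hα
    have e2 := hy.hasDerivWithinAt hy'.continuousOn hα
    exact (uniqueDiffOn_Ici (0 : ℝ) α hα).eq_deriv _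
      (e1.congr (fun x hx => hd x hx) (hd α hα)) e2

end Companion

/-! ### The fundamental system in the upper half-plane -/

section HalfPlane

variable {R : Type*} [NormedRing R] [NormedAlgebra ℂ R] [FiniteDimensional ℂ R] [CompleteSpace R]
  {C α r : ℝ} {q dq v im ip : ℝ → R} {P T : ℤˣ → ℝ → R}

/-- A fundamental system with the prescribed asymptotics in the upper half-plane. -/
theorem WKBData.exists_fundamentalSystem (h : WKBData C q dq v (P (-1)) im (P 1) ip) (hα : 0 ≤ α)
    (hr : 0 < r) (hm : 8 * C ^ 2 * mass q dq v α ≤ r)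
    (hT₁ : T (-1) = IsPropagator.correction (P (-1)) im
      fun s => (2 * Complex.I)⁻¹ • (dq s - q s * q s - v s))
    (hT₂ : T 1 = IsPropagator.correction (P 1) ip
      fun s => (2 * Complex.I)⁻¹ • (dq s + q s * q s + v s)) :
    ∃ E E' : ℤˣ → ℝ → ℂ → R,
      (∀ σ, IsPencilSolution q v 0 r (E σ) (E' σ) ∧
        IsAsymptotic q α r σ (P (-σ)) (T (-σ)) (E σ) (E' σ)) ∧
      ∀ ρ ∈ closedDomain r, ∀ y y' : ℝ → R, HasACDeriv 0 y y' →
        HasACDeriv 0 y' (fun x => -(pencil q v x ρ * y x)) →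
        ∃! c : R × R, ∀ x, 0 ≤ x → y x = E 1 x ρ * c.1 + E (-1) x ρ * c.2 := by
  obtain ⟨Φ, Ψ, hF, -⟩ :=
    IsVolterraCoeff.exists_fundamentalPair (R := R × R →L[ℂ] R × R)
      (isVolterraCoeff_companion h.norm_one_le h.int_q h.int_v)
  obtain ⟨a, b, Y₁, Z₁, ⟨hs₁, ha₁⟩, haα, hY₁, hZ₁⟩ := h.exists_recessive hα hr hm
  obtain ⟨b₂, Y₂, Z₂, ⟨hs₂, ha₂⟩, hbα, hY₂, hZ₂⟩ := h.exists_dominant hα hr hm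
  obtain ⟨E₁, E₁', hE₁, hEY₁⟩ := hs₁.exists_extension hF hα
  obtain ⟨E₂, E₂', hE₂, hEY₂⟩ := hs₂.exists_extension hF hα
  have hne : (-1 : ℤˣ) ≠ 1 := by decide
  refine ⟨fun σ => if σ = 1 then E₁ else E₂, fun σ => if σ = 1 then E₁' else E₂', fun σ => ?_,
    fun ρ hρ y y' hy hy' => ?_⟩
  · rcases Int.units_eq_one_or σ with rfl | rfl
    · simp only [if_true, hT₁]
      exact ⟨hE₁, ha₁.congr hEY₁⟩
    · simp only [hne, if_false, neg_neg, hT₂]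
      exact ⟨hE₂, ha₂.congr hEY₂⟩
  · simp only [if_true, hne, if_false]
    refine existsUnique_combination hF hα hE₁ hE₂ hρ (fun u u' => ?_) hy hy'
    rw [(hEY₁ α le_rfl ρ hρ).1, (hEY₁ α le_rfl ρ hρ).2, (hEY₂ α le_rfl ρ hρ).1,
      (hEY₂ α le_rfl ρ hρ).2, hY₁, hZ₁, hY₂ ρ hρ, hZ₂ ρ hρ]
    have hsmul : ∀ (σ : ℤˣ) {u : R}, IsUnit u → IsUnit (ex σ ρ α • u) := fun σ u hu =>
      (hu.smul (Units.mk0 _ (ex_ne_zero σ ρ α)))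
    have hpm : IsUnit (P (-1) α) :=
      ⟨⟨_, _, h.prop_m.mul_inv α hα, h.prop_m.inv_mul α hα⟩, rfl⟩
    have hpp : IsUnit (P 1 α) :=
      ⟨⟨_, _, h.prop_p.mul_inv α hα, h.prop_p.inv_mul α hα⟩, rfl⟩
    -- At α the recessive data are s + t and A(s − t), the dominant data w and −Aw, all with A = iρ
    -- − q(α). The units s and w exist because the leading amplitudes lie within 1/3 of one.
    have := existsUnique_of_isUnit (t := ex 1 ρ α • (P 1 α * b α ρ))
      (h.isUnit_char hα hr hm hρ le_rfl)
      (hsmul 1 (hpm.mul (isUnit_of_norm_sub_one_le (haα ρ hρ))))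
      (hsmul (-1) (hpp.mul (isUnit_of_norm_sub_one_le (hbα ρ hρ)))) u u'
    simpa only [smul_add, smul_sub, mul_add, mul_sub, mul_smul_comm] using this

end HalfPlane

open scoped Matrix.Norms.Operator

/-! ### Entrywise statements and matrix-valued functions -/

section Entries

variable {m : ℕ} {a : ℝ}

/-- The entry of a matrix as a continuous linear map. -/
def entryCLM (i j : Fin m) : Matrix (Fin m) (Fin m) ℂ →L[ℂ] ℂ :=
  (Matrix.entryLinearMap ℂ ℂ i j).toContinuousLinearMap

/-- The inclusion of an entry as a continuous linear map. -/
def singleCLM (i j : Fin m) : ℂ →L[ℂ] Matrix (Fin m) (Fin m) ℂ :=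
  ContinuousLinearMap.toSpanSingleton ℂ (Matrix.single i j 1)

theorem sum_singleCLM (A : Matrix (Fin m) (Fin m) ℂ) :
    ∑ i, ∑ j, singleCLM i j (A i j) = A := by
  conv_rhs => rw [Matrix.matrix_eq_sum_single A]
  simp [singleCLM]

theorem norm_matrix_one_le : ‖(1 : Matrix (Fin m) (Fin m) ℂ)‖ ≤ 1 := by
  rcases isEmpty_or_nonempty (Fin m) with h | h
  · rw [Subsingleton.elim (1 : Matrix (Fin m) (Fin m) ℂ) 0, norm_zero]; exact zero_le_one
  · exact norm_one.le

theorem HasACDeriv.sum {E ι : Type*} [NormedAddCommGroup E] [NormedSpace ℝ E] (s : Finset ι)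
    {F f : ι → ℝ → E} (h : ∀ i ∈ s, HasACDeriv a (F i) (f i)) :
    HasACDeriv a (fun x => ∑ i ∈ s, F i x) (fun x => ∑ i ∈ s, f i x) := by
  classical
  induction s using Finset.induction_on with
  | empty => simpa using HasACDeriv.const (0 : E)
  | insert i s hi ih =>
    simp only [Finset.sum_insert hi]
    exact (h i (Finset.mem_insert_self i s)).add
      (ih fun j hj => h j (Finset.mem_insert_of_mem hj))

theorem integrableOn_of_sum {E ι : Type*} [NormedAddCommGroup E] [NormedSpace ℂ E] [Fintype ι]
    {F : ℝ → E} {c : ι → ℝ → ℂ} {e : ι → ℂ →L[ℂ] E} (hF : ∀ x, ∑ i, e i (c i x) = F x)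
    (h : ∀ i, IntegrableOn (c i) (Ioi 0) volume) : IntegrableOn F (Ici 0) volume := by
  rw [integrableOn_Ici_iff_integrableOn_Ioi, ← funext hF]
  exact integrable_finsetSum _ fun i _ => (e i).integrable_comp (h i)

variable {F f : ℝ → Matrix (Fin m) (Fin m) ℂ}

theorem HasACDeriv.entry (h : HasACDeriv a F f) (i j : Fin m) :
    HasACDeriv a (fun x => F x i j) (fun x => f x i j) := h.clm_comp (entryCLM i j)

theorem HasACDeriv.of_entries
    (h : ∀ i j, HasACDeriv a (fun x => F x i j) (fun x => f x i j)) : HasACDeriv a F f := by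
  have := HasACDeriv.sum Finset.univ fun i _ => HasACDeriv.sum Finset.univ fun j _ =>
    (h i j).clm_comp (singleCLM i j)
  exact (this.congr fun x _ => (sum_singleCLM (F x)).symm).congr_deriv
    fun x _ => sum_singleCLM (f x)

theorem hasDerivWithinAt_of_entries {F' : Matrix (Fin m) (Fin m) ℂ} {s : Set ℝ} {x : ℝ}
    (h : ∀ i j, HasDerivWithinAt (fun x => F x i j) (F' i j) s x) : HasDerivWithinAt F F' s x := by
  have := HasDerivWithinAt.fun_sum (u := Finset.univ) fun i _ =>
    HasDerivWithinAt.fun_sum (u := Finset.univ) fun j _ =>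
      ((singleCLM i j).restrictScalars ℝ).hasFDerivAt.comp_hasDerivWithinAt x (h i j)
  have h2 := this.congr (f₁ := F) (fun x _ => (sum_singleCLM (F x)).symm) (sum_singleCLM (F x)).symm
  exact h2.congr_deriv (sum_singleCLM F')

theorem hasDerivWithinAt_entry {F' : Matrix (Fin m) (Fin m) ℂ} {s : Set ℝ} {x : ℝ}
    (h : HasDerivWithinAt F F' s x) (i j : Fin m) :
    HasDerivWithinAt (fun x => F x i j) (F' i j) s x :=
  ((entryCLM i j).restrictScalars ℝ).hasFDerivAt.comp_hasDerivWithinAt x h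

theorem sum_singleCLM_prod (A : Matrix (Fin m) (Fin m) ℂ) :
    ∑ p : Fin m × Fin m, singleCLM p.1 p.2 (A p.1 p.2) = A :=
  (Fintype.sum_prod_type _).trans (sum_singleCLM A)

theorem EntriesIntegrable.exists_propagator (h : EntriesIntegrable F) (c : ℂ) :
    ∃ C p pinv, IsPropagator C (fun x => c • F x) p pinv :=
  MatrixPencil.exists_propagator (Integrable.smul c (integrableOn_of_sum
    (fun x => sum_singleCLM_prod (F x)) fun p => h p.1 p.2))

theorem LocallyAC.ac_entry (h : LocallyAC F) (i j : Fin m) {b : ℝ} (hb : 0 ≤ b) :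
    AbsolutelyContinuousOnInterval (fun x => F x i j) 0 b :=
  (h (b + 1) (by linarith) i j).mono (by
    rw [uIcc_of_le hb, uIcc_of_le (by linarith)]; exact Icc_subset_Icc_right (by linarith))

theorem LocallyAC.hasACDeriv (h : LocallyAC F)
    (hd : ∀ᵐ x ∂(volume.restrict (Ioi (0 : ℝ))), ∀ i j,
      HasDerivAt (fun t => F t i j) (f x i j) x) : HasACDeriv 0 F f :=
  HasACDeriv.of_entries fun i j => ⟨fun _ hb => h.ac_entry i j hb, hd.mono fun _ hx => hx i j⟩

theorem HasACDeriv.locallyAC (h : HasACDeriv 0 F f) : LocallyAC F :=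
  fun b hb i j => (h.entry i j).ac b hb.le

theorem HasACDeriv.ae_entries (h : HasACDeriv 0 F f) :
    ∀ᵐ x ∂(volume.restrict (Ioi (0 : ℝ))), ∀ i j,
      HasDerivAt (fun t => F t i j) (f x i j) x :=
  ae_all_iff.2 fun i => ae_all_iff.2 fun j => (h.entry i j).deriv

/-- Absolute continuity gives locally bounded variation, hence differentiability almost everywhere;
at interior points the one-sided derivative is the derivative. -/
theorem LocallyAC.hasACDeriv_mderiv (h : LocallyAC F) : HasACDeriv 0 F (mderiv F) := by
  refine h.hasACDeriv (ae_all_iff.2 fun i => ae_all_iff.2 fun j => ?_)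
  have hbv : LocallyBoundedVariationOn (fun x => F x i j) (Ici 0) := fun x y _ hy =>
    (h.ac_entry i j hy).boundedVariationOn.mono fun t ht => by
      rw [uIcc_of_le hy]; exact ⟨ht.1, ht.2.2⟩
  rw [ae_restrict_iff' measurableSet_Ioi]
  filter_upwards [hbv.ae_differentiableWithinAt_of_mem] with x hx hx0
  exact (hx (Ioi_subset_Ici_self hx0)).hasDerivWithinAt.hasDerivAt (Ici_mem_nhds hx0)

theorem HasACDeriv.mderiv_eq (h : HasACDeriv 0 F f) (hf : ContinuousOn f (Ici 0)) {x : ℝ}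
    (hx : 0 ≤ x) : mderiv F x = f x := by
  ext i j
  exact (hasDerivWithinAt_entry (h.hasDerivWithinAt hf hx) i j).derivWithin (uniqueDiffOn_Ici (0 : ℝ) x hx)

end Entries

/-! ### Matrix solutions and column solutions -/

section Solution

variable {m : ℕ} {Q₁ Q₀ : ℝ → Matrix (Fin m) (Fin m) ℂ} {ρ : ℂ}
  {Y Z : ℝ → Matrix (Fin m) (Fin m) ℂ}

theorem IsSolution.of_hasACDeriv (h : HasACDeriv 0 Y Z)
    (h' : HasACDeriv 0 Z (fun x => -(pencil Q₁ Q₀ x ρ * Y x))) : IsSolution Q₁ Q₀ ρ Y := by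
  have hd : HasACDeriv 0 (mderiv Y) (fun x => -(pencil Q₁ Q₀ x ρ * Y x)) :=
    h'.congr fun x hx => h.mderiv_eq h'.continuousOn hx
  exact ⟨fun i j x hx =>
    (hasDerivWithinAt_entry (h.hasDerivWithinAt h'.continuousOn hx) i j).differentiableWithinAt,
    hd.locallyAC, hd.ae_entries⟩

theorem IsSolution.hasACDeriv (h : IsSolution Q₁ Q₀ ρ Y) :
    HasACDeriv 0 Y (mderiv Y) ∧
      HasACDeriv 0 (mderiv Y) (fun x => -(pencil Q₁ Q₀ x ρ * Y x)) := by
  have h2 : HasACDeriv 0 (mderiv Y) (fun x => -(pencil Q₁ Q₀ x ρ * Y x)) := h.ac.hasACDeriv h.eqn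
  exact ⟨HasACDeriv.of_hasDerivWithinAt h2.continuousOn fun x hx =>
    hasDerivWithinAt_of_entries fun i j => (h.diff i j x hx).hasDerivWithinAt, h2⟩

/-- Repeating a column m times makes it a square matrix, so the ring-valued theory applies to vector
solutions. -/
theorem IsSolution.replicate {y : ℝ → Matrix (Fin m) Unit ℂ} (h : IsSolution Q₁ Q₀ ρ y) :
    IsSolution Q₁ Q₀ ρ (fun x => Matrix.of fun i (_ : Fin m) => y x i ()) where
  diff i _ := h.diff i ()
  ac b hb i _ := h.ac b hb i ()
  eqn := h.eqn.mono fun x hx i j => by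
    have := hx i ()
    simpa [Matrix.mul_apply, mderiv] using this

theorem existsUnique_column {E₁ E₂ : ℝ → Matrix (Fin m) (Fin m) ℂ}
    {y : ℝ → Matrix (Fin m) Unit ℂ}
    (h : ∃! c : Matrix (Fin m) (Fin m) ℂ × Matrix (Fin m) (Fin m) ℂ, ∀ x, 0 ≤ x →
      (Matrix.of fun i (_ : Fin m) => y x i ()) = E₁ x * c.1 + E₂ x * c.2) :
    ∃! c : Matrix (Fin m) Unit ℂ × Matrix (Fin m) Unit ℂ, ∀ x, 0 ≤ x →
      y x = E₁ x * c.1 + E₂ x * c.2 := by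
  rcases isEmpty_or_nonempty (Fin m) with hm | ⟨⟨j₀⟩⟩
  -- For m = 0 there is no column index to extract, but everything is trivially equal.
  · exact ⟨0, fun _ _ => Subsingleton.elim _ _, fun _ _ => Subsingleton.elim _ _⟩
  obtain ⟨c, hc, hu⟩ := h
  refine ⟨(Matrix.of fun i _ => c.1 i j₀, Matrix.of fun i _ => c.2 i j₀), fun x hx => ?_,
    fun d hd => ?_⟩
  · ext i k
    have := congrFun (congrFun (hc x hx) i) j₀
    simpa [Matrix.mul_apply] using this
  · have := hu (Matrix.of fun i _ => d.1 i (), Matrix.of fun i _ => d.2 i ()) fun x hx => by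
      ext i k
      have := congrFun (congrFun (hd x hx) i) ()
      simpa [Matrix.mul_apply] using this
    rw [← this]
    rfl

end Solution

/-! ### Reduction of the lower half-plane to the upper one -/

section Reflection

theorem sgn_mul (σ τ : ℤˣ) : sgn (σ * τ) = sgn σ * sgn τ := by simp [sgn]

theorem norm_sgn (σ : ℤˣ) : ‖sgn σ‖ = 1 := by
  rcases Int.units_eq_one_or σ with rfl | rfl <;> simp [sgn]

theorem sgn_ne_zero (σ : ℤˣ) : sgn σ ≠ 0 := left_ne_zero_of_mul_eq_one (sgn_mul_self σ)

theorem ex_mul (τ σ : ℤˣ) (ρ : ℂ) (x : ℝ) : ex (τ * σ) (sgn τ * ρ) x = ex σ ρ x := by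
  unfold ex
  rw [sgn_mul]
  congr 1
  linear_combination (sgn σ * Complex.I * ρ * x) * sgn_mul_self τ

theorem im_sgn_mul (τ : ℤˣ) (ρ : ℂ) : (sgn τ * ρ).im = ((τ : ℤ) : ℝ) * ρ.im := by
  rcases Int.units_eq_one_or τ with rfl | rfl <;> simp [sgn]

theorem norm_sgn_mul (τ : ℤˣ) (ρ : ℂ) : ‖sgn τ * ρ‖ = ‖ρ‖ := by rw [norm_mul, norm_sgn, one_mul]

theorem sgn_mul_mem_closedDomain {τ : ℤˣ} {ρ : ℂ} {r : ℝ} :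
    sgn τ * ρ ∈ closedDomain r ↔ ρ ∈ closedHalf τ ∧ r < ‖ρ‖ := by
  simp only [closedDomain, closedHalf, mem_ofPred_eq, im_sgn_mul, norm_sgn_mul]

theorem sgn_mul_mem_openDomain {τ : ℤˣ} {ρ : ℂ} {r : ℝ} :
    sgn τ * ρ ∈ openDomain r ↔ ρ ∈ openHalf τ ∧ r < ‖ρ‖ := by
  simp only [openDomain, openHalf, mem_ofPred_eq, im_sgn_mul, norm_sgn_mul]

variable {R : Type*} [NormedRing R] [NormedAlgebra ℂ R] {C : ℝ}
  {q dq v : ℝ → R} {P inv T : ℤˣ → ℝ → R}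

theorem density_sgn_smul (τ : ℤˣ) (q dq v : ℝ → R) :
    density (fun x => sgn τ • q x) (fun x => sgn τ • dq x) v = density q dq v := by
  funext s
  simp only [density, norm_smul, norm_sgn, one_mul]

theorem pencil_sgn_smul (τ : ℤˣ) (q v : ℝ → R) (x : ℝ) (ρ : ℂ) :
    pencil (fun x => sgn τ • q x) v x (sgn τ * ρ) = pencil q v x ρ := by
  have h := sgn_mul_self τ
  simp only [pencil, smul_smul]
  congr 3
  · linear_combination ρ ^ 2 * h
  · linear_combination (2 * Complex.I * ρ) * h

theorem IsPropagator.correction_smul (p pinv w : ℝ → R) (c : ℂ) :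
    IsPropagator.correction p pinv (fun s => c • w s) =
      fun x => c • IsPropagator.correction p pinv w x := by
  funext x
  simp only [IsPropagator.correction, mul_smul_comm, smul_mul_assoc, integral_smul, smul_neg]

/-- Changing the sign of q exchanges the two propagators and preserves all norms, hence the
constants. -/
theorem WKBData.reflect (h : WKBData C q dq v (P (-1)) (inv (-1)) (P 1) (inv 1)) (τ : ℤˣ) :
    WKBData C (fun x => sgn τ • q x) (fun x => sgn τ • dq x) v
      (P (τ * -1)) (inv (τ * -1)) (P (τ * 1)) (inv (τ * 1)) := by
  refine ⟨h.norm_one_le, h.one_le, h.deriv.const_smul _, h.int_q.smul (sgn τ),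
    h.int_dq.smul (sgn τ), h.int_v, ?_, ?_⟩
  · rcases Int.units_eq_one_or τ with rfl | rfl
    · simpa [sgn] using h.prop_m
    · simpa [sgn] using h.prop_p
  · rcases Int.units_eq_one_or τ with rfl | rfl
    · simpa [sgn] using h.prop_p
    · simpa [sgn] using h.prop_m

/-- The family of right-hand sides of the equations for the first corrections. -/
def correctionSource (q dq v : ℝ → R) (σ : ℤˣ) (s : ℝ) : R :=
  (2 * Complex.I)⁻¹ • (dq s + sgn σ • q s ^ 2 + sgn σ • v s)

/-- The source picks up the factor `sgn τ`, and therefore so does T; this compensates the sign of ρ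
in T/ρ. -/
theorem correctionSource_reflect (q dq v : ℝ → R) (τ σ : ℤˣ) :
    correctionSource (fun x => sgn τ • q x) (fun x => sgn τ • dq x) v σ =
      fun s => sgn τ • correctionSource q dq v (τ * σ) s := by
  funext s
  have h := sgn_mul_self τ
  have h2 : sgn τ ^ 2 = 1 := by rw [sq, h]
  simp only [correctionSource, smul_pow, h2, one_smul]
  rw [smul_comm (sgn τ)]
  congr 1
  simp only [smul_add, sgn_mul, smul_smul, ← mul_assoc, h, one_mul]

theorem WKBData.int_correctionSource [CompleteSpace R] {pm im pp ip : ℝ → R}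
    (h : WKBData C q dq v pm im pp ip) (σ : ℤˣ) :
    IntegrableOn (correctionSource q dq v σ) (Ici 0) volume := by
  have h2 : IntegrableOn (fun s => q s ^ 2) (Ici 0) volume := by simpa only [sq] using h.int_sq
  exact ((h.int_dq.add (h2.smul (sgn σ))).add (h.int_v.smul (sgn σ))).smul (2 * Complex.I)⁻¹

variable [FiniteDimensional ℂ R] [CompleteSpace R] {α r : ℝ}

theorem WKBData.exists_fundamentalSystem_reflect
    (h : WKBData C q dq v (P (-1)) (inv (-1)) (P 1) (inv 1)) (hα : 0 ≤ α)
    (hr : 0 < r) (hm : 8 * C ^ 2 * mass q dq v α ≤ r)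
    (hT : ∀ σ, T σ = IsPropagator.correction (P σ) (inv σ) (correctionSource q dq v σ)) (τ : ℤˣ) :
    ∃ E E' : ℤˣ → ℝ → ℂ → R,
      (∀ σ, IsPencilSolution (fun x => sgn τ • q x) v 0 r (E σ) (E' σ) ∧
        IsAsymptotic (fun x => sgn τ • q x) α r σ (P (τ * -σ)) (fun x => sgn τ • T (τ * -σ) x)
          (E σ) (E' σ)) ∧
      ∀ ρ, sgn τ * ρ ∈ closedDomain r → ∀ y y' : ℝ → R, HasACDeriv 0 y y' →
        HasACDeriv 0 y' (fun x => -(pencil q v x ρ * y x)) →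
        ∃! c : R × R, ∀ x, 0 ≤ x →
          y x = E τ x (sgn τ * ρ) * c.1 + E (-τ) x (sgn τ * ρ) * c.2 := by
  have hT' : ∀ σ, (fun x => sgn τ • T (τ * σ) x) = IsPropagator.correction (P (τ * σ))
      (inv (τ * σ)) (correctionSource (fun x => sgn τ • q x) (fun x => sgn τ • dq x) v σ) := by
    intro σ
    rw [correctionSource_reflect, IsPropagator.correction_smul, hT]
  obtain ⟨E, E', hE, hb⟩ := (h.reflect τ).exists_fundamentalSystem (P := fun σ => P (τ * σ))
    (T := fun σ x => sgn τ • T (τ * σ) x) hα hr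
    (by rw [mass, density_sgn_smul]; exact hm)
    (by rw [hT']; congr 1; funext s; simp [correctionSource, sgn, sq, sub_eq_add_neg])
    (by rw [hT']; congr 1; funext s; simp [correctionSource, sgn, sq])
  refine ⟨E, E', hE, fun ρ hρ y y' hy hy' => ?_⟩
  have h1 := hb _ hρ y y' hy (hy'.congr_deriv fun x _ => by rw [pencil_sgn_smul])
  rcases Int.units_eq_one_or τ with rfl | rfl
  · exact h1
  -- For τ = −1 the two solutions change places, and so do the two coefficients.
  · obtain ⟨c, hc, hu⟩ := h1
    refine ⟨(c.2, c.1), fun x hx => ?_, fun d hd => ?_⟩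
    · rw [hc x hx, neg_neg, add_comm]
    · have := hu (d.2, d.1) fun x hx => by rw [hd x hx, neg_neg, add_comm]
      rw [← this]

end Reflection

/-! ### Systems of solutions in either half-plane -/

section HalfPlaneSystem

variable {R : Type*} [NormedRing R] [NormedAlgebra ℂ R]

/-- A system of solutions for `τ Im ρ ≥ 0`, `|ρ| > r` with leading terms `P`, `T` on `x ≥ α`. -/
structure IsHalfPlaneSystem (q v : ℝ → R) (α r : ℝ) (τ : ℤˣ) (P T : ℤˣ → ℝ → R)
    (E E' : ℤˣ → ℝ → ℂ → R) : Prop where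
  cont : ∀ σ, ContinuousOn (fun p : ℝ × ℂ => E σ p.1 p.2)
    (Ici 0 ×ˢ {ρ | ρ ∈ closedHalf τ ∧ r < ‖ρ‖})
  cont' : ∀ σ, ContinuousOn (fun p : ℝ × ℂ => E' σ p.1 p.2)
    (Ici 0 ×ˢ {ρ | ρ ∈ closedHalf τ ∧ r < ‖ρ‖})
  diff : ∀ σ x, 0 ≤ x → DifferentiableOn ℂ (E σ x) {ρ | ρ ∈ openHalf τ ∧ r < ‖ρ‖}
  diff' : ∀ σ x, 0 ≤ x → DifferentiableOn ℂ (E' σ x) {ρ | ρ ∈ openHalf τ ∧ r < ‖ρ‖}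
  deriv : ∀ σ, ∀ ρ ∈ closedHalf τ, r < ‖ρ‖ → HasACDeriv 0 (fun x => E σ x ρ) (fun x => E' σ x ρ)
  deriv' : ∀ σ, ∀ ρ ∈ closedHalf τ, r < ‖ρ‖ →
    HasACDeriv 0 (fun x => E' σ x ρ) (fun x => -(pencil q v x ρ * E σ x ρ))
  leading : ∀ σ, ∀ ε > 0, ∃ N, ∀ ρ ∈ closedHalf τ, r < ‖ρ‖ → N < ‖ρ‖ → ∀ x, α ≤ x →
    ‖ρ • ((ex σ ρ x)⁻¹ • E σ x ρ - P (-σ) x) - T (-σ) x‖ ≤ ε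
  leading' : ∀ σ, ∀ ε > 0, ∃ N, ∀ ρ ∈ closedHalf τ, r < ‖ρ‖ → N < ‖ρ‖ → ∀ x, α ≤ x →
    ‖(sgn σ * (ex σ ρ x)⁻¹) • E' σ x ρ -
      (((Complex.I * ρ) • (1 : R) - q x) * P (-σ) x + Complex.I • T (-σ) x)‖ ≤ ε
  lim : ∀ σ, ∀ ρ ∈ openHalf τ, r < ‖ρ‖ →
    Tendsto (fun x => (ex σ ρ x)⁻¹ • E σ x ρ - P (-σ) x) atTop (𝓝 0)
  lim' : ∀ σ, ∀ ρ ∈ openHalf τ, r < ‖ρ‖ →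
    Tendsto (fun x => ((sgn σ * Complex.I * ρ)⁻¹ * (ex σ ρ x)⁻¹) • E' σ x ρ - P (-σ) x) atTop (𝓝 0)
  basis : ∀ ρ ∈ closedHalf τ, r < ‖ρ‖ → ∀ y y' : ℝ → R, HasACDeriv 0 y y' →
    HasACDeriv 0 y' (fun x => -(pencil q v x ρ * y x)) →
    ∃! c : R × R, ∀ x, 0 ≤ x → y x = E 1 x ρ * c.1 + E (-1) x ρ * c.2

variable [FiniteDimensional ℂ R] [CompleteSpace R] {C α r : ℝ} {q dq v : ℝ → R}
  {P inv T : ℤˣ → ℝ → R}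

theorem WKBData.exists_halfPlaneSystem
    (h : WKBData C q dq v (P (-1)) (inv (-1)) (P 1) (inv 1)) (hα : 0 ≤ α)
    (hr : 0 < r) (hm : 8 * C ^ 2 * mass q dq v α ≤ r)
    (hT : ∀ σ, T σ = IsPropagator.correction (P σ) (inv σ) (correctionSource q dq v σ)) (τ : ℤˣ) :
    ∃ E E' : ℤˣ → ℝ → ℂ → R, IsHalfPlaneSystem q v α r τ P T E E' := by
  obtain ⟨E, E', hE, hb⟩ := h.exists_fundamentalSystem_reflect hα hr hm hT τ
  -- The solution of sign σ at ρ is taken to be the one of sign τσ at τρ: both have the same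
  -- exponential, and the two reflections cancel in the index of P and T.
  have hidx : ∀ σ, τ * -(τ * σ) = -σ := fun σ => by
    rw [mul_neg, ← mul_assoc, Int.units_mul_self, one_mul]
  have hS := fun σ => (hE (τ * σ)).1
  have hA : ∀ σ, IsAsymptotic (fun x => sgn τ • q x) α r (τ * σ) (P (-σ))
      (fun x => sgn τ • T (-σ) x) (E (τ * σ)) (E' (τ * σ)) := fun σ => by
    have := (hE (τ * σ)).2
    rwa [hidx] at this
  have hmap : MapsTo (fun p : ℝ × ℂ => (p.1, sgn τ * p.2))
      (Ici 0 ×ˢ {ρ | ρ ∈ closedHalf τ ∧ r < ‖ρ‖}) (Ici 0 ×ˢ closedDomain r) := fun p hp =>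
    ⟨hp.1, sgn_mul_mem_closedDomain.2 hp.2⟩
  have hmap' : MapsTo (fun ρ : ℂ => sgn τ * ρ) {ρ | ρ ∈ openHalf τ ∧ r < ‖ρ‖} (openDomain r) :=
    fun ρ hρ => sgn_mul_mem_openDomain.2 hρ
  refine ⟨fun σ x ρ => E (τ * σ) x (sgn τ * ρ), fun σ x ρ => E' (τ * σ) x (sgn τ * ρ),
    fun σ => ?_, fun σ => ?_, fun σ x hx => ?_, fun σ x hx => ?_, fun σ ρ hρ hρr => ?_,
    fun σ ρ hρ hρr => ?_, fun σ ε hε => ?_, fun σ ε hε => ?_, fun σ ρ hρ hρr => ?_,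
    fun σ ρ hρ hρr => ?_, fun ρ hρ hρr y y' hy hy' => ?_⟩
  · exact (hS σ).cont.comp (by fun_prop) hmap
  · exact (hS σ).cont'.comp (by fun_prop) hmap
  · exact ((hS σ).diff x hx).comp (by fun_prop) hmap'
  · exact ((hS σ).diff' x hx).comp (by fun_prop) hmap'
  · exact (hS σ).deriv _ (sgn_mul_mem_closedDomain.2 ⟨hρ, hρr⟩)
  · refine ((hS σ).deriv' _ (sgn_mul_mem_closedDomain.2 ⟨hρ, hρr⟩)).congr_deriv fun x _ => ?_
    rw [← pencil_sgn_smul τ q v x ρ]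
    rfl
  · obtain ⟨N, hN⟩ := (hA σ).leading ε hε
    refine ⟨N, fun ρ hρ hρr hρN x hx => ?_⟩
    have h1 := hN _ (sgn_mul_mem_closedDomain.2 ⟨hρ, hρr⟩) (by rwa [norm_sgn_mul]) x hx
    beta_reduce at h1
    rwa [ex_mul, mul_smul, ← smul_sub, norm_smul, norm_sgn, one_mul] at h1
  · obtain ⟨N, hN⟩ := (hA σ).leading' ε hε
    refine ⟨N, fun ρ hρ hρr hρN x hx => ?_⟩
    have h1 := hN _ (sgn_mul_mem_closedDomain.2 ⟨hρ, hρr⟩) (by rwa [norm_sgn_mul]) x hx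
    beta_reduce at h1
    have h2 : (sgn (τ * σ) * (ex σ ρ x)⁻¹) • E' (τ * σ) x (sgn τ * ρ) -
        (((Complex.I * (sgn τ * ρ)) • (1 : R) - sgn τ • q x) * P (-σ) x +
          Complex.I • sgn τ • T (-σ) x) = sgn τ • ((sgn σ * (ex σ ρ x)⁻¹) •
        E' (τ * σ) x (sgn τ * ρ) - (((Complex.I * ρ) • (1 : R) - q x) * P (-σ) x +
          Complex.I • T (-σ) x)) := by
      simp only [sgn_mul, sub_mul, smul_mul_assoc, one_mul]
      module
    rwa [ex_mul, h2, norm_smul, norm_sgn, one_mul] at h1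
  · simpa only [ex_mul] using (hA σ).lim _ (sgn_mul_mem_openDomain.2 ⟨hρ, hρr⟩)
  · have h1 := (hA σ).lim' _ (sgn_mul_mem_openDomain.2 ⟨hρ, hρr⟩)
    have h2 : sgn (τ * σ) * Complex.I * (sgn τ * ρ) = sgn σ * Complex.I * ρ := by
      rw [sgn_mul]
      linear_combination (sgn σ * Complex.I * ρ) * sgn_mul_self τ
    simpa only [ex_mul, h2] using h1
  · have := hb ρ (sgn_mul_mem_closedDomain.2 ⟨hρ, hρr⟩) y y' hy hy'
    simpa only [mul_one, mul_neg] using this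

end HalfPlaneSystem

/-! ### The threshold tends to zero -/

section Threshold

variable {R : Type*} [NormedRing R] [NormedAlgebra ℂ R] {C : ℝ} {q dq v pm im pp ip : ℝ → R}

/-- The summand `α⁻¹` keeps the threshold positive when the mass vanishes and leaves room for a
strictly smaller radius. -/
theorem WKBData.tendsto_threshold [CompleteSpace R] (h : WKBData C q dq v pm im pp ip) :
    Tendsto (fun α => 8 * C ^ 2 * mass q dq v α + α⁻¹) atTop (𝓝 0) := by
  simpa using (h.tendsto_mass.const_mul (8 * C ^ 2)).add tendsto_inv_atTop_zero

end Threshold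

/-! ### Cauchy problems for P and T in matrix form -/

section Cauchy

variable {m : ℕ} {C : ℝ} {σ : ℤˣ} {Q₁ Q₀ p pinv : ℝ → Matrix (Fin m) (Fin m) ℂ}

theorem IsPropagator.solvesP (h : IsPropagator C (fun x => sgn σ • Q₁ x) p pinv)
    (hQ : ContinuousOn Q₁ (Ici 0)) : SolvesP σ Q₁ p := by
  refine ⟨fun x hx i j => ?_, h.init⟩
  have h1 := hasDerivWithinAt_entry (h.deriv.hasDerivWithinAt
    ((hQ.const_smul (sgn σ)).mul h.deriv.continuousOn) hx) i j
  rwa [smul_mul_assoc] at h1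

/-- The equation holds at every point with a continuous right-hand side, so absolute continuity is
automatic and need not be assumed for P. -/
theorem SolvesP.hasACDeriv (h : SolvesP σ Q₁ p) (hQ : ContinuousOn Q₁ (Ici 0)) :
    HasACDeriv 0 p (fun x => (sgn σ • Q₁ x) * p x) := by
  have h1 : ∀ x, 0 ≤ x → HasDerivWithinAt p ((sgn σ • Q₁ x) * p x) (Ici 0) x := fun x hx => by
    rw [smul_mul_assoc]
    exact hasDerivWithinAt_of_entries (h.eqn x hx)
  exact HasACDeriv.of_hasDerivWithinAt
    ((hQ.const_smul (sgn σ)).mul fun x hx => (h1 x hx).continuousWithinAt) h1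

theorem solvesT_rhs_eq (T : ℝ → Matrix (Fin m) (Fin m) ℂ) (x : ℝ) :
    sgn σ • (Q₁ x * T x) + (1 / (2 * Complex.I)) •
      ((mderiv Q₁ x + sgn σ • (Q₁ x) ^ 2 + sgn σ • Q₀ x) * p x) =
    (sgn σ • Q₁ x) * T x + correctionSource Q₁ (mderiv Q₁) Q₀ σ x * p x := by
  rw [correctionSource, smul_mul_assoc, smul_mul_assoc, one_div]

theorem SolvesT.of_hasACDeriv {T : ℝ → Matrix (Fin m) (Fin m) ℂ}
    (h : HasACDeriv 0 T (fun x => (sgn σ • Q₁ x) * T x +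
      correctionSource Q₁ (mderiv Q₁) Q₀ σ x * p x)) (hlim : Tendsto T atTop (𝓝 0)) :
    SolvesT σ Q₁ Q₀ p T where
  ac := h.locallyAC
  eqn := (h.congr_deriv fun x _ => (solvesT_rhs_eq T x).symm).ae_entries
  lim := hlim

theorem SolvesT.hasACDeriv {T : ℝ → Matrix (Fin m) (Fin m) ℂ} (h : SolvesT σ Q₁ Q₀ p T) :
    HasACDeriv 0 T (fun x => (sgn σ • Q₁ x) * T x +
      correctionSource Q₁ (mderiv Q₁) Q₀ σ x * p x) :=
  (h.ac.hasACDeriv h.eqn).congr_deriv fun x _ => solvesT_rhs_eq T x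

end Cauchy

section Data

variable {m : ℕ} {Q₁ Q₀ : ℝ → Matrix (Fin m) (Fin m) ℂ}

theorem CoeffClass.exists_wkbData (hQ : CoeffClass Q₁ Q₀) :
    ∃ (C : ℝ) (P inv : ℤˣ → ℝ → Matrix (Fin m) (Fin m) ℂ),
      (∀ σ, IsPropagator C (fun x => sgn σ • Q₁ x) (P σ) (inv σ)) ∧
      WKBData C Q₁ (mderiv Q₁) Q₀ (P (-1)) (inv (-1)) (P 1) (inv 1) := by
  choose K P inv hP using fun σ : ℤˣ => hQ.int_Q₁.exists_propagator (sgn σ)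
  have hP' : ∀ σ, IsPropagator (max 1 (max (K 1) (K (-1)))) (fun x => sgn σ • Q₁ x) (P σ)
      (inv σ) := fun σ => by
    rcases Int.units_eq_one_or σ with rfl | rfl
    · exact (hP 1).mono ((le_max_left _ _).trans (le_max_right _ _))
    · exact (hP (-1)).mono ((le_max_right _ _).trans (le_max_right _ _))
  refine ⟨_, P, inv, hP', norm_matrix_one_le, le_max_left _ _, hQ.ac.hasACDeriv_mderiv,
    integrableOn_of_sum (fun x => sum_singleCLM_prod (Q₁ x)) fun p => hQ.int_Q₁ p.1 p.2,
    integrableOn_of_sum (fun x => sum_singleCLM_prod (mderiv Q₁ x)) fun p => hQ.int_deriv p.1 p.2,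
    integrableOn_of_sum (fun x => sum_singleCLM_prod (Q₀ x)) fun p => hQ.int_Q₀ p.1 p.2, ?_, ?_⟩
  · simpa [sgn] using hP' (-1)
  · simpa [sgn] using hP' 1

end Data

/-! ### Assembly of the matrix statements -/

section System

variable {m : ℕ} {Q₁ Q₀ : ℝ → Matrix (Fin m) (Fin m) ℂ} {α r R₀ : ℝ} {τ : ℤˣ}
  {P T : ℤˣ → ℝ → Matrix (Fin m) (Fin m) ℂ} {E E' : ℤˣ → ℝ → ℂ → Matrix (Fin m) (Fin m) ℂ}

theorem norm_entry_le (A : Matrix (Fin m) (Fin m) ℂ) (i j : Fin m) : ‖A i j‖ ≤ ‖A‖ := by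
  have h1 : ‖A i j‖₊ ≤ ∑ k, ‖A i k‖₊ :=
    Finset.single_le_sum (f := fun k => ‖A i k‖₊) (fun _ _ => zero_le) (Finset.mem_univ j)
  have h2 : ‖A i j‖₊ ≤ ‖A‖₊ := by
    rw [Matrix.linfty_opNNNorm_def]
    exact h1.trans (Finset.le_sup (f := fun i => ∑ k, ‖A i k‖₊) (Finset.mem_univ i))
  exact h2

theorem isOpen_openHalf (τ : ℤˣ) (r : ℝ) : IsOpen {ρ | ρ ∈ openHalf τ ∧ r < ‖ρ‖} :=
  (isOpen_lt continuous_const (continuous_const.mul Complex.continuous_im)).inter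
    (isOpen_lt continuous_const continuous_norm)

theorem openHalf_subset_closedHalf (τ : ℤˣ) : openHalf τ ⊆ closedHalf τ := fun ρ h =>
  le_of_lt (show 0 < ((τ : ℤ) : ℝ) * ρ.im from h)

namespace IsHalfPlaneSystem

theorem mderivN_eq (h : IsHalfPlaneSystem Q₁ Q₀ α r τ P T E E') (σ : ℤˣ) {ρ : ℂ}
    (hρ : ρ ∈ closedHalf τ) (hρr : r < ‖ρ‖) {x : ℝ} (hx : 0 ≤ x) :
    mderivN 1 (fun t => E σ t ρ) x = E' σ x ρ :=
  (h.deriv σ ρ hρ hρr).mderiv_eq (h.deriv' σ ρ hρ hρr).continuousOn hx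

theorem isFundamentalSystem (h : IsHalfPlaneSystem Q₁ Q₀ α r τ P T E E') {ρ : ℂ}
    (hρ : ρ ∈ closedHalf τ) (hρr : r < ‖ρ‖) :
    IsFundamentalSystem Q₁ Q₀ ρ (fun x => E 1 x ρ) (fun x => E (-1) x ρ) where
  left := IsSolution.of_hasACDeriv (h.deriv 1 ρ hρ hρr) (h.deriv' 1 ρ hρ hρr)
  right := IsSolution.of_hasACDeriv (h.deriv (-1) ρ hρ hρr) (h.deriv' (-1) ρ hρ hρr)
  basis _ hy := existsUnique_column
    (h.basis ρ hρ hρr _ _ hy.replicate.hasACDeriv.1 hy.replicate.hasACDeriv.2)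

theorem continuousOn_mderivN (h : IsHalfPlaneSystem Q₁ Q₀ α r τ P T E E') (σ : ℤˣ) {ν : ℕ}
    (hν : ν ≤ 1) : ContinuousOn (fun p : ℝ × ℂ => mderivN ν (fun t => E σ t p.2) p.1)
      (Ici 0 ×ˢ {ρ | ρ ∈ closedHalf τ ∧ r < ‖ρ‖}) := by
  interval_cases ν
  · exact h.cont σ
  · exact (h.cont' σ).congr fun p hp => h.mderivN_eq σ hp.2.1 hp.2.2 hp.1

theorem analyticOnNhd_mderivN (h : IsHalfPlaneSystem Q₁ Q₀ α r τ P T E E') (σ : ℤˣ) {ν : ℕ}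
    (hν : ν ≤ 1) {x : ℝ} (hx : 0 ≤ x) (i j : Fin m) :
    AnalyticOnNhd ℂ (fun ρ => mderivN ν (fun t => E σ t ρ) x i j)
      {ρ | ρ ∈ openHalf τ ∧ r < ‖ρ‖} := by
  have hd : DifferentiableOn ℂ (fun ρ => mderivN ν (fun t => E σ t ρ) x)
      {ρ | ρ ∈ openHalf τ ∧ r < ‖ρ‖} := by
    interval_cases ν
    · exact h.diff σ x hx
    · exact (h.diff' σ x hx).congr fun ρ hρ =>
        h.mderivN_eq σ (openHalf_subset_closedHalf τ hρ.1) hρ.2 hx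
  exact DifferentiableOn.analyticOnNhd
    ((entryCLM i j).differentiable.comp_differentiableOn hd) (isOpen_openHalf τ r)

/-- The remainders are obtained by solving the two expansions for them, so only their smallness has
content. -/
theorem exists_uniform_asymptotics (h : IsHalfPlaneSystem Q₁ Q₀ α r τ P T E E') (hα : 0 ≤ α)
    (hr : 0 ≤ r) (σ : ℤˣ) :
    ∃ u w : ℝ → ℂ → Matrix (Fin m) (Fin m) ℂ, UniformSmall τ α u ∧ UniformSmall τ α w ∧
      ∀ ρ ∈ closedHalf τ, r < ‖ρ‖ → ∀ x : ℝ, α ≤ x →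
        E σ x ρ = ex σ ρ x • (P (-σ) x + ρ⁻¹ • T (-σ) x + ρ⁻¹ • u x ρ) ∧
        mderivN 1 (fun t => E σ t ρ) x = (sgn σ * ex σ ρ x) •
          (((Complex.I * ρ) • (1 : Matrix (Fin m) (Fin m) ℂ) - Q₁ x) * P (-σ) x
            + Complex.I • T (-σ) x + w x ρ) := by
  refine ⟨fun x ρ => ρ • ((ex σ ρ x)⁻¹ • E σ x ρ - P (-σ) x) - T (-σ) x,
    fun x ρ => (sgn σ * (ex σ ρ x)⁻¹) • E' σ x ρ -
      (((Complex.I * ρ) • (1 : Matrix (Fin m) (Fin m) ℂ) - Q₁ x) * P (-σ) x +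
        Complex.I • T (-σ) x), fun ε hε => ?_, fun ε hε => ?_, fun ρ hρ hρr x hx => ⟨?_, ?_⟩⟩
  · obtain ⟨N, hN⟩ := h.leading σ ε hε
    exact ⟨max N r, fun ρ hρ hρN x hx i j => (norm_entry_le _ i j).trans
      (hN ρ hρ ((le_max_right _ _).trans_lt hρN) ((le_max_left _ _).trans_lt hρN) x hx)⟩
  · obtain ⟨N, hN⟩ := h.leading' σ ε hε
    exact ⟨max N r, fun ρ hρ hρN x hx i j => (norm_entry_le _ i j).trans
      (hN ρ hρ ((le_max_right _ _).trans_lt hρN) ((le_max_left _ _).trans_lt hρN) x hx)⟩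
  · have hρ0 : ρ ≠ 0 := norm_pos_iff.1 (hr.trans_lt hρr)
    rw [smul_sub ρ⁻¹, inv_smul_smul₀ hρ0, add_assoc, add_sub_cancel, add_sub_cancel,
      smul_inv_smul₀ (ex_ne_zero σ ρ x)]
  · rw [h.mderivN_eq σ hρ hρr (hα.trans hx), add_sub_cancel, smul_smul]
    have h1 : sgn σ * ex σ ρ x * (sgn σ * (ex σ ρ x)⁻¹) = 1 := by
      rw [mul_mul_mul_comm, sgn_mul_self, mul_inv_cancel₀ (ex_ne_zero σ ρ x), one_mul]
    rw [h1, one_smul]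

theorem exists_spatial_asymptotics (h : IsHalfPlaneSystem Q₁ Q₀ α r τ P T E E')
    (hr : 0 ≤ r) (σ : ℤˣ) {ν : ℕ} (hν : ν ≤ 1) {ρ : ℂ} (hρ : ρ ∈ openHalf τ) (hρr : r < ‖ρ‖) :
    ∃ u : ℝ → Matrix (Fin m) (Fin m) ℂ, Tendsto u atTop (𝓝 0) ∧ ∀ x : ℝ, 0 ≤ x →
      mderivN ν (fun t => E σ t ρ) x =
        ((sgn σ * Complex.I * ρ) ^ ν * ex σ ρ x) • (P (-σ) x + u x) := by
  have hρ0 : ρ ≠ 0 := norm_pos_iff.1 (hr.trans_lt hρr)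
  have hc : ∀ x, (sgn σ * Complex.I * ρ) ^ ν * ex σ ρ x ≠ 0 := fun x =>
    mul_ne_zero (pow_ne_zero _ (mul_ne_zero (mul_ne_zero (sgn_ne_zero σ) Complex.I_ne_zero) hρ0))
      (ex_ne_zero σ ρ x)
  refine ⟨fun x => ((sgn σ * Complex.I * ρ) ^ ν * ex σ ρ x)⁻¹ • mderivN ν (fun t => E σ t ρ) x -
    P (-σ) x, ?_, fun x _ => by rw [add_sub_cancel, smul_inv_smul₀ (hc x)]⟩
  interval_cases ν
  · refine (h.lim σ ρ hρ hρr).congr fun x => ?_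
    rw [pow_zero, one_mul]
    rfl
  · refine (h.lim' σ ρ hρ hρr).congr' ?_
    filter_upwards [eventually_ge_atTop 0] with x hx
    rw [pow_one, mul_inv _ (ex σ ρ x), h.mderivN_eq σ (openHalf_subset_closedHalf τ hρ) hρr hx]

end IsHalfPlaneSystem

theorem CoeffClass.exists_halfPlaneSystem (hQ : CoeffClass Q₁ Q₀) :
    ∃ P T : ℤˣ → ℝ → Matrix (Fin m) (Fin m) ℂ,
      (∀ σ, SolvesP σ Q₁ (P σ) ∧ ∀ P', SolvesP σ Q₁ P' → EqOn P' (P σ) (Ici 0)) ∧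
      (∀ σ, SolvesT σ Q₁ Q₀ (P σ) (T σ) ∧
        ∀ T', SolvesT σ Q₁ Q₀ (P σ) T' → EqOn T' (T σ) (Ici 0)) ∧
      ∃ ρ₀ : ℝ → ℝ, (∀ α, 0 < α → 0 < ρ₀ α) ∧ Tendsto ρ₀ atTop (𝓝 0) ∧
        ∀ α, 0 < α → ∃ r, 0 < r ∧ r < ρ₀ α ∧ ∀ τ, ∃ E E', IsHalfPlaneSystem Q₁ Q₀ α r τ P T E E' := by
  obtain ⟨C, P, inv, hP, hW⟩ := hQ.exists_wkbData
  have hQc := hW.deriv.continuousOn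
  have hm0 : ∀ α, 0 ≤ 8 * C ^ 2 * mass Q₁ (mderiv Q₁) Q₀ α := fun α =>
    mul_nonneg (by positivity) (mass_nonneg _ _ _ α)
  refine ⟨P, fun σ => IsPropagator.correction (P σ) (inv σ)
      (correctionSource Q₁ (mderiv Q₁) Q₀ σ),
    fun σ => ⟨(hP σ).solvesP hQc, fun P' hP' x hx =>
      (hP σ).unique (hP'.hasACDeriv hQc) hP'.init hx⟩,
    fun σ => ⟨SolvesT.of_hasACDeriv
        ((hP σ).correction_deriv (hW.int_correctionSource σ))
        ((hP σ).correction_tendsto (hW.int_correctionSource σ)), fun T' hT' x hx =>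
      (hP σ).correction_unique (hW.int_correctionSource σ) hT'.hasACDeriv hT'.lim hx⟩,
    fun α => 8 * C ^ 2 * mass Q₁ (mderiv Q₁) Q₀ α + α⁻¹,
    fun α hα => add_pos_of_nonneg_of_pos (hm0 α) (inv_pos.2 hα), hW.tendsto_threshold,
    fun α hα => ?_⟩
  -- The contraction is run at a radius strictly below the threshold; this yields analyticity in a
  -- neighbourhood of |ρ| ≥ `ρ₀ α`.
  obtain ⟨r, hmr, hrR⟩ := exists_between (lt_add_of_pos_right
    (8 * C ^ 2 * mass Q₁ (mderiv Q₁) Q₀ α) (inv_pos.2 hα))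
  have hr : 0 < r := (hm0 α).trans_lt hmr
  exact ⟨r, hr, hrR, hW.exists_halfPlaneSystem hα.le hr hmr.le fun _ => rfl⟩

end System

end MatrixPencil

end

theorem mainTheorem2 {m : ℕ} (Q₁ Q₀ : ℝ → Matrix (Fin m) (Fin m) ℂ)
    (hQ : MatrixPencil.CoeffClass Q₁ Q₀) :
    ∃ P T : ℤˣ → ℝ → Matrix (Fin m) (Fin m) ℂ,
      -- `P σ` and `T σ` are the unique solutions of their Cauchy problems
      (∀ σ, MatrixPencil.SolvesP σ Q₁ (P σ) ∧
        ∀ P', MatrixPencil.SolvesP σ Q₁ P' → Set.EqOn P' (P σ) (Set.Ici 0)) ∧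
      (∀ σ, MatrixPencil.SolvesT σ Q₁ Q₀ (P σ) (T σ) ∧
        ∀ T', MatrixPencil.SolvesT σ Q₁ Q₀ (P σ) T' → Set.EqOn T' (T σ) (Set.Ici 0)) ∧
      ∃ ρ₀ : ℝ → ℝ, (∀ α, 0 < α → 0 < ρ₀ α) ∧ Filter.Tendsto ρ₀ Filter.atTop (nhds 0) ∧
        -- `τ` is the sign of the half-plane, `E σ` is the solution written with the sign `σ`
        ∀ α, 0 < α → ∀ τ : ℤˣ, ∃ E : ℤˣ → ℝ → ℂ → Matrix (Fin m) (Fin m) ℂ,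
          (∀ ρ ∈ MatrixPencil.closedHalf τ, ρ₀ α < ‖ρ‖ →
            MatrixPencil.IsFundamentalSystem Q₁ Q₀ ρ (fun x => E 1 x ρ) (fun x => E (-1) x ρ)) ∧
          -- continuity
          (∀ σ : ℤˣ, ∀ ν : ℕ, ν ≤ 1 →
            ContinuousOn
              (fun p : ℝ × ℂ => MatrixPencil.mderivN ν (fun t => E σ t p.2) p.1)
              (Set.Ici (0 : ℝ) ×ˢ {ρ | ρ ∈ MatrixPencil.closedHalf τ ∧ ρ₀ α < ‖ρ‖})) ∧
          -- analyticity
          (∀ σ : ℤˣ, ∀ ν : ℕ, ν ≤ 1 → ∀ x : ℝ, 0 ≤ x → ∀ j k,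
            AnalyticOnNhd ℂ (fun ρ => MatrixPencil.mderivN ν (fun t => E σ t ρ) x j k)
              {ρ | ρ ∈ MatrixPencil.openHalf τ ∧ ρ₀ α ≤ ‖ρ‖}) ∧
          -- asymptotics as `|ρ| → ∞`, uniform in `x ≥ α`
          (∀ σ : ℤˣ, ∃ r s : ℝ → ℂ → Matrix (Fin m) (Fin m) ℂ,
            MatrixPencil.UniformSmall τ α r ∧ MatrixPencil.UniformSmall τ α s ∧
            ∀ ρ ∈ MatrixPencil.closedHalf τ, ρ₀ α < ‖ρ‖ → ∀ x : ℝ, α ≤ x →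
              E σ x ρ = MatrixPencil.ex σ ρ x •
                (P (-σ) x + ρ⁻¹ • T (-σ) x + ρ⁻¹ • r x ρ) ∧
              MatrixPencil.mderivN 1 (fun t => E σ t ρ) x =
                (MatrixPencil.sgn σ * MatrixPencil.ex σ ρ x) •
                  (((Complex.I * ρ) • (1 : Matrix (Fin m) (Fin m) ℂ) - Q₁ x) * P (-σ) x
                    + Complex.I • T (-σ) x + s x ρ)) ∧
          -- asymptotics as `x → ∞`
          (∀ σ : ℤˣ, ∀ ν : ℕ, ν ≤ 1 → ∀ ρ ∈ MatrixPencil.openHalf τ, ρ₀ α < ‖ρ‖ →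
            ∃ r : ℝ → Matrix (Fin m) (Fin m) ℂ, Filter.Tendsto r Filter.atTop (nhds 0) ∧
              ∀ x : ℝ, 0 ≤ x →
                MatrixPencil.mderivN ν (fun t => E σ t ρ) x =
                  ((MatrixPencil.sgn σ * Complex.I * ρ) ^ ν * MatrixPencil.ex σ ρ x) •
                    (P (-σ) x + r x)) := by
  obtain ⟨P, T, hP, hT, ρ₀, hpos, hlim, hsys⟩ := hQ.exists_halfPlaneSystem
  refine ⟨P, T, hP, hT, ρ₀, hpos, hlim, fun α hα τ => ?_⟩
  obtain ⟨r, hr, hrρ, hE⟩ := hsys α hα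
  obtain ⟨E, E', h⟩ := hE τ
  refine ⟨E, fun ρ hρ hρr => h.isFundamentalSystem hρ (hrρ.trans hρr), fun σ ν hν => ?_,
    fun σ ν hν x hx j k => ?_, fun σ => ?_, fun σ ν hν ρ hρ hρr =>
      h.exists_spatial_asymptotics hr.le σ hν hρ (hrρ.trans hρr)⟩
  · exact (h.continuousOn_mderivN σ hν).mono
      (Set.prod_mono le_rfl fun ρ hρ => ⟨hρ.1, hrρ.trans hρ.2⟩)
  -- Since r < `ρ₀ α`, the points with |ρ| equal to the threshold are interior to the domain of
  -- holomorphy.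
  · exact (h.analyticOnNhd_mderivN σ hν hx j k).mono fun ρ hρ => ⟨hρ.1, hrρ.trans_le hρ.2⟩
  · obtain ⟨u, w, hu, hw, hEq⟩ := h.exists_uniform_asymptotics hα.le hr.le σ
    exact ⟨u, w, hu, hw, fun ρ hρ hρr => hEq ρ hρ (hrρ.trans hρr)⟩
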